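/- Let $n,m\in\mathbb N$, $k\in\{\infty,\omega\}$, let $\Omega\subset\mathbb R^n\times\mathbb R^m$ be open, let $f:\Omega\to\mathbb R^n$ be of class $C^k$ ($C^\omega$ meaning real analytic), and let $(\bar x,\bar u)\in\Omega$. Consider the control system $\dot x=f(x,u)$. **Definitions.** *Solutions.* A solution of $\dot x=f(x,u)$ that remains in an open set $\Omega_1\subset\Omega$ is a map $\gamma=(\gamma_{\rm I},\gamma_{\rm II}):I\to\Omega_1$ on a real interval $I$ that is Lebesgue measurable and locally bounded, with $\gamma_{\rm I}$ absolutely continuous on compact subintervals of $I$ and, whenever $[T_1,T_2]\subset I$, with $f\circ\gamma$ integrable on $[T_1,T_2]$ and $\gamma_{\rm I}(T_2)-\gamma_{\rm I}(T_1)=\int_{T_1}^{T_2}f(\gamma(t))\,dt$. *Linearizability.* The system is locally $C^k$ linearizable at $(\bar x,\bar u)$ if there are matrices $A\in\mathbb R^{n\times n}$, $B\in\mathbb R^{n\times m}$ with $\operatorname{rank}(B,AB,\dots,A^{n-1}B)=n$, an open neighborhood $\Omega_1\subset\Omega$ of $(\bar x,\bar u)$, an open set $\Omega'\subset\mathbb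 R^{n}\times\mathbb R^m$, and a $C^k$ diffeomorphism $\chi:\Omega_1\to\Omega'$ such that, for every real interval $I$, a map $\gamma:I\to\Omega_1$ is a solution of $\dot x=f(x,u)$ that remains in $\Omega_1$ if and only if $\chi\circ\gamma$ is a solution of $\dot z=Az+Bv$ that remains in $\Omega'$. *Limit directions.* For $\mathcal X\times\mathcal U\subset\Omega$ with $\mathcal X,\mathcal U$ open and $(x,u)\in\mathcal X\times\mathcal U$, let $D(x,u)\subset\mathbb R^n$ be the linear span of all limits $$\lim_{j\to\infty}\frac{f(x,w_j)-f(x,u)}{\|f(x,w_j)-f(x,u)\|},$$ where $(w_j)$ is a sequence in $\mathcal U$ converging to $u$ with $f(x,w_j)\neq f(x,u)$ for all $j$. *Distributions.* A distribution $\Delta$ on $\mathcal X$ assigns to each $x\in\mathcal X$ a linear subspace $\Delta(x)$ of $\mathbb R^n$; a section of $\Delta$ on an open set $V\subset\mathcal X$ is a $C^k$ vector field $g$ on $V$ with $g(x)\in\Delta(x)$ for all $x\in V$. For a $C^k$ vector field $h$ on $\mathcal X$, $[h,\Delta](x)$ is the span of the vectors $[h,g](x)$, where $[\ ,\ ]$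 is the Lie bracket and $g$ runs over the sections of $\Delta$ on open neighborhoods of $x$ in $\mathcal X$. $\Delta$ is integrable if $\dim\Delta(x)$ is constant on $\mathcal X$ and the Lie bracket of any two sections of $\Delta$ on the same open set takes its values in $\Delta$. **Theorem.** The system $\dot x=f(x,u)$ is locally $C^k$ linearizable at $(\bar x,\bar u)$ if and only if there are open neighborhoods $\mathcal X$ of $\bar x$ in $\mathbb R^n$ and $\mathcal U$ of $\bar u$ in $\mathbb R^m$, with $\mathcal X\times\mathcal U\subset\Omega$, such that the following three conditions hold. 1. $D(x,u)$ does not depend on $u$ for $(x,u)\in\mathcal X\times\mathcal U$. 2. The rank of $\dfrac{\partial f}{\partial u}(x,u)$ is constant on $\mathcal X\times\mathcal U$. 3. With $f_{\bar u}(x)=f(x,\bar u)$, $\Delta_0(x)=D(x,\bar u)$ (which is $D(x,u)$ for every $u\in\mathcal U$, by condition 1) and $\Delta_{j+1}=\Delta_j+[f_{\bar u},\Delta_j]$ for $j\ge 0$, each $\Delta_j$ with $0\le j\le n-1$ is integrable on $\mathcal X$, and $\Delta_{n-1}$ has rank $n$ at every point of $\mathcal X$. (If $n=0$, condition 3 is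 void.) -/

import Mathlib

open Set Filter Topology MeasureTheory
open scoped ContDiff

noncomputable section

namespace ControlSys

/-- The state space (or control space) `ℝᵈ` with its Euclidean structure. -/
abbrev Eucl (d : ℕ) : Type := EuclideanSpace ℝ (Fin d)

/-! ### Solutions and conjugacy -/

/-- `γ` restricted to the real interval `I` is a solution of `ẋ = f(x,u)` that remains in `Ω`.
Only the values of `γ` on `I` matter.  `f` need only be meaningful on `Ω`, so the
integrability of `t ↦ f (γ t)`, automatic when `f` is continuous everywhere, is required
together with the integral equation. -/
structure IsSolution {n m : ℕ} (f : Eucl n × Eucl m → Eucl n) (Ω : Set (Eucl n × Eucl m))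
    (I : Set ℝ) (γ : ℝ → Eucl n × Eucl m) : Prop where
  mem : ∀ t ∈ I, γ t ∈ Ω
  /-- Lebesgue measurability on `I`. -/
  measurable : AEMeasurable γ (volume.restrict I)
  locallyBounded : ∀ t ∈ I, ∃ N ∈ 𝓝[I] t, Bornology.IsBounded (γ '' N)
  absolutelyContinuous : ∀ T₁ T₂ : ℝ, T₁ ≤ T₂ → Icc T₁ T₂ ⊆ I →
    AbsolutelyContinuousOnInterval (fun t => (γ t).1) T₁ T₂
  intervalIntegrable : ∀ T₁ T₂ : ℝ, T₁ ≤ T₂ → Icc T₁ T₂ ⊆ I →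
    IntervalIntegrable (fun t => f (γ t)) volume T₁ T₂
  integral_eq : ∀ T₁ T₂ : ℝ, T₁ ≤ T₂ → Icc T₁ T₂ ⊆ I →
    (γ T₂).1 - (γ T₁).1 = ∫ t in T₁..T₂, f (γ t)

/-- The bijection `χ : χ.source → χ.target` conjugates `ẋ = f(x,u)` and `ż = g(z,v)`: a map
`γ : I → χ.source` on a real interval is a solution of the first system that remains in
`χ.source` iff `χ ∘ γ` is a solution of the second one that remains in `χ.target`. -/
def Conjugates {n m : ℕ} (χ : OpenPartialHomeomorph (Eucl n × Eucl m) (Eucl n × Eucl m))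
    (f g : Eucl n × Eucl m → Eucl n) : Prop :=
  ∀ (I : Set ℝ), I.OrdConnected → ∀ γ : ℝ → Eucl n × Eucl m, (∀ t ∈ I, γ t ∈ χ.source) →
    (IsSolution f χ.source I γ ↔ IsSolution g χ.target I (χ ∘ γ))

/-! ### Linear systems and linearizability -/

/-- The right-hand side `(z,v) ↦ A z + B v` of a linear control system. -/
def linearSystem {n m : ℕ} (A : Matrix (Fin n) (Fin n) ℝ) (B : Matrix (Fin n) (Fin m) ℝ) :
    Eucl n × Eucl m → Eucl n :=
  fun p => Matrix.toEuclideanLin A p.1 + Matrix.toEuclideanLin B p.2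

/-- The `n × nm` matrix `(B, AB, …, Aⁿ⁻¹B)`. -/
def kalmanMatrix {n m : ℕ} (A : Matrix (Fin n) (Fin n) ℝ) (B : Matrix (Fin n) (Fin m) ℝ) :
    Matrix (Fin n) (Fin n × Fin m) ℝ :=
  Matrix.of fun i q => (A ^ (q.1 : ℕ) * B) i q.2

/-- Kalman's criterion for controllability. -/
def Controllable {n m : ℕ} (A : Matrix (Fin n) (Fin n) ℝ) (B : Matrix (Fin n) (Fin m) ℝ) :
    Prop :=
  (kalmanMatrix A B).rank = n

/-- The system `ẋ = f(x,u)`, given on the open set `Ω`, is locally `Cᵏ` linearizable at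
`p = (x̄,ū)`: on an open neighbourhood of `p` inside `Ω`, a `Cᵏ` diffeomorphism onto an open
set conjugates it to a controllable linear system. -/
def LocallyLinearizableAt {n m : ℕ} (k : WithTop ℕ∞) (f : Eucl n × Eucl m → Eucl n)
    (Ω : Set (Eucl n × Eucl m)) (p : Eucl n × Eucl m) : Prop :=
  ∃ (A : Matrix (Fin n) (Fin n) ℝ) (B : Matrix (Fin n) (Fin m) ℝ)
    (χ : OpenPartialHomeomorph (Eucl n × Eucl m) (Eucl n × Eucl m)),
    Controllable A B ∧ p ∈ χ.source ∧ χ.source ⊆ Ω ∧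
    ContDiffOn ℝ k χ χ.source ∧ ContDiffOn ℝ k χ.symm χ.target ∧
    Conjugates χ f (linearSystem A B)

/-! ### The subspaces `D(x,u)` -/

/-- The set of limit directions of the lines through `f(x,u)` and `f(x,w_j)`, for sequences
`w_j → u` in `U` with `f(x,w_j) ≠ f(x,u)`, so that the directions are defined. -/
def limitDirections {n m : ℕ} (f : Eucl n × Eucl m → Eucl n) (U : Set (Eucl m))
    (x : Eucl n) (u : Eucl m) : Set (Eucl n) :=
  {y | ∃ w : ℕ → Eucl m, (∀ j, w j ∈ U) ∧ Tendsto w atTop (𝓝 u) ∧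
    (∀ j, f (x, w j) ≠ f (x, u)) ∧
    Tendsto (fun j => ‖f (x, w j) - f (x, u)‖⁻¹ • (f (x, w j) - f (x, u))) atTop (𝓝 y)}

/-- `D(x,u)`, the linear span of the limit directions. -/
def dirSpace {n m : ℕ} (f : Eucl n × Eucl m → Eucl n) (U : Set (Eucl m))
    (x : Eucl n) (u : Eucl m) : Submodule ℝ (Eucl n) :=
  Submodule.span ℝ (limitDirections f U x u)

/-- The partial derivative `∂f/∂u (x,u)`. -/
def partialU {n m : ℕ} (f : Eucl n × Eucl m → Eucl n) (x : Eucl n) (u : Eucl m) :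
    Eucl m →L[ℝ] Eucl n :=
  fderiv ℝ (fun w => f (x, w)) u

/-! ### Distributions -/

/-- A distribution assigns a linear subspace of `ℝⁿ` to each point of an open set `X`; values
outside `X` are irrelevant below. -/
abbrev Distribution (n : ℕ) : Type := Eucl n → Submodule ℝ (Eucl n)

/-- `g` is, on the open set `V ⊆ X`, a vector field of class `Cᵏ` belonging to `Δ`. -/
structure IsSection {n : ℕ} (k : WithTop ℕ∞) (X : Set (Eucl n)) (Δ : Distribution n)
    (V : Set (Eucl n)) (g : Eucl n → Eucl n) : Prop where
  isOpen : IsOpen V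
  subset : V ⊆ X
  contDiffOn : ContDiffOn ℝ k g V
  mem : ∀ x ∈ V, g x ∈ Δ x

/-- The distribution `Δ + [h, Δ]`. -/
def addBracket {n : ℕ} (k : WithTop ℕ∞) (X : Set (Eucl n)) (h : Eucl n → Eucl n)
    (Δ : Distribution n) : Distribution n :=
  fun x => Δ x ⊔ Submodule.span ℝ
    {v | ∃ V g, IsSection k X Δ V g ∧ x ∈ V ∧ v = VectorField.lieBracket ℝ h g x}

/-- The flag `Δ₀, Δ₁, …` with `Δ_{j+1} = Δ_j + [h, Δ_j]`. -/
def flag {n : ℕ} (k : WithTop ℕ∞) (X : Set (Eucl n)) (h : Eucl n → Eucl n)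
    (Δ₀ : Distribution n) : ℕ → Distribution n
  | 0 => Δ₀
  | j + 1 => addBracket k X h (flag k X h Δ₀ j)

/-- `Δ` is integrable on `X`: it has constant dimension and is closed under Lie bracket. -/
def Integrable {n : ℕ} (k : WithTop ℕ∞) (X : Set (Eucl n)) (Δ : Distribution n) : Prop :=
  (∃ r : ℕ, ∀ x ∈ X, Module.finrank ℝ (Δ x) = r) ∧
  ∀ V g h, IsSection k X Δ V g → IsSection k X Δ V h →
    ∀ x ∈ V, VectorField.lieBracket ℝ g h x ∈ Δ x

end ControlSys

end

/-! Necessity. Changing the control of a solution at a single instant gives another solution,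
because the integral equation ignores null sets. A conjugacy must carry it to a solution with the
same later states, which forces `χ(x,u) = (φ(x), ψ(x,u))`. Differentiating along a curve with
constant control gives `dφ·f = A φ + B ψ`. Since `dχ` is invertible, `dφ` is invertible and the
range of `∂f/∂u` is the pullback of `im B` under `dφ`. Hence the rank is constant, and `Δ_j` is the
pullback of the constant subspace `im B + … + Aʲ im B` (`flag_eq_comap_krylov`). This pullback is
integrable, and by Kalman's criterion it is everything for `j = n - 1`.

Sufficiency. `D(x,u)` always contains the range of `∂f/∂u`, with equality where the rank is constant
(`dirSpace_eq_range`). As `D` does not depend on `u`, `f(x,u) - f(x,ū)` lies in `Δ₀(x)` for `u` near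
`ū`. The main construction (`HasLinearQuotient.step`) descends along the flag from `Δ_{n-1} = ⊤`.
Suppose that `h` is a submersion whose fibres are tangent to `Δ_j`, with `dh·f = A h + w`, where `w`
takes values in the constant space `W = dh(Δ_{j+1})`. For a section `g` of `Δ_j` one has `dw(g) =
-dh([f,g])`. So `dw` kills `Δ_{j-1}`, whose brackets with `f` lie in `Δ_j`, and `dw` maps `Δ_j` onto
`W`. Therefore `w` supplies new coordinates, which drive `h` as integrators, and first integrals of
`Δ_{j-1}` complete `(h, w)` to a submersion with fibres tangent to `Δ_{j-1}`. A last step, below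
`Δ₀`, produces full coordinates `φ` with `dφ·f = A φ` modulo the range of `∂f/∂u (x̄,ū)`, and a
feedback `ψ` absorbs this remainder.

The first integrals come from Frobenius' theorem, which is derived from a joint flow of commuting
fields. The flow is obtained by the implicit function theorem in the Banach space `C([0,1], E)`, a
method that treats the smooth and the analytic case together. -/

noncomputable section

namespace ControlSys

/-! ### Superposition operators on spaces of continuous curves -/

section Superposition

variable {K : Type} [TopologicalSpace K] [CompactSpace K]
variable {E G : Type} [NormedAddCommGroup E] [NormedSpace ℝ E]
  [NormedAddCommGroup G] [NormedSpace ℝ G]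

/-- A continuous bilinear map applied pointwise to continuous functions. -/
def pointwiseBilin {E₁ E₂ G : Type} [NormedAddCommGroup E₁] [NormedSpace ℝ E₁]
    [NormedAddCommGroup E₂] [NormedSpace ℝ E₂] [NormedAddCommGroup G] [NormedSpace ℝ G]
    (B : E₁ →L[ℝ] E₂ →L[ℝ] G) : C(K, E₁) →L[ℝ] C(K, E₂) →L[ℝ] C(K, G) :=
  LinearMap.mkContinuous₂
    (LinearMap.mk₂ ℝ (fun a b => ⟨fun t => B (a t) (b t), by fun_prop⟩)
      (fun a a' b => by ext t; simp) (fun c a b => by ext t; simp)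
      (fun a b b' => by ext t; simp) (fun c a b => by ext t; simp)) ‖B‖
    (fun a b => by
      rw [ContinuousMap.norm_le _ (by positivity)]
      intro t
      calc ‖B (a t) (b t)‖ ≤ ‖B‖ * ‖a t‖ * ‖b t‖ := B.le_opNorm₂ _ _
        _ ≤ ‖B‖ * ‖a‖ * ‖b‖ := by
          gcongr
          · exact a.norm_coe_le_norm t
          · exact b.norm_coe_le_norm t)

@[simp] lemma pointwiseBilin_apply {E₁ E₂ G : Type} [NormedAddCommGroup E₁] [NormedSpace ℝ E₁]
    [NormedAddCommGroup E₂] [NormedSpace ℝ E₂] [NormedAddCommGroup G] [NormedSpace ℝ G]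
    (B : E₁ →L[ℝ] E₂ →L[ℝ] G) (a : C(K, E₁)) (b : C(K, E₂)) (t : K) :
    pointwiseBilin B a b t = B (a t) (b t) := rfl

lemma contDiffAt_pointwiseBilin {Z E₁ E₂ G : Type} [NormedAddCommGroup Z] [NormedSpace ℝ Z]
    [NormedAddCommGroup E₁] [NormedSpace ℝ E₁]
    [NormedAddCommGroup E₂] [NormedSpace ℝ E₂] [NormedAddCommGroup G] [NormedSpace ℝ G]
    (B : E₁ →L[ℝ] E₂ →L[ℝ] G) {k : WithTop ℕ∞} {a : Z → C(K, E₁)} {b : Z → C(K, E₂)} {z : Z}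
    (ha : ContDiffAt ℝ k a z) (hb : ContDiffAt ℝ k b z) :
    ContDiffAt ℝ k (fun z => pointwiseBilin B (a z) (b z)) z := by
  have h : ContDiffAt ℝ k (fun z => pointwiseBilin B (a z)) z := by
    refine ContDiffAt.comp (g := fun c => pointwiseBilin B c) z ?_ ha
    exact (ContinuousLinearMap.contDiff _).contDiffAt
  exact h.clm_apply hb

lemma contDiffAt_eval_curve {Z E : Type} [NormedAddCommGroup Z] [NormedSpace ℝ Z]
    [NormedAddCommGroup E] [NormedSpace ℝ E] {k : WithTop ℕ∞} {a : Z → C(K, E)} {z : Z}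
    (ha : ContDiffAt ℝ k a z) (t : K) : ContDiffAt ℝ k (fun z => a z t) z := by
  refine ContDiffAt.comp (g := fun c : C(K, E) => c t) z ?_ ha
  exact (ContinuousLinearMap.contDiff (𝕜 := ℝ) (E := C(K, E)) (F := E)
    (ContinuousMap.evalCLM ℝ t)).contDiffAt

lemma hasFDerivAt_eval_curve {Z E : Type} [NormedAddCommGroup Z] [NormedSpace ℝ Z]
    [NormedAddCommGroup E] [NormedSpace ℝ E] {a : Z → C(K, E)} {z : Z}
    {a' : Z →L[ℝ] C(K, E)} (ha : HasFDerivAt a a' z) (t : K) :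
    ∃ D : Z →L[ℝ] E, HasFDerivAt (fun z => a z t) D z ∧ ∀ v, D v = a' v t := by
  have h : HasFDerivAt (fun c : C(K, E) => c t) (ContinuousMap.evalCLM ℝ t) (a z) :=
    ContinuousLinearMap.hasFDerivAt (𝕜 := ℝ) (E := C(K, E)) (F := E) (ContinuousMap.evalCLM ℝ t)
  exact ⟨_, h.comp z ha, fun _ => rfl⟩

lemma hasFDerivAt_pointwiseBilin {Z E₁ E₂ G : Type} [NormedAddCommGroup Z] [NormedSpace ℝ Z]
    [NormedAddCommGroup E₁] [NormedSpace ℝ E₁]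
    [NormedAddCommGroup E₂] [NormedSpace ℝ E₂] [NormedAddCommGroup G] [NormedSpace ℝ G]
    (B : E₁ →L[ℝ] E₂ →L[ℝ] G) {a : Z → C(K, E₁)} {b : Z → C(K, E₂)} {z : Z}
    {a' : Z →L[ℝ] C(K, E₁)} {b' : Z →L[ℝ] C(K, E₂)}
    (ha : HasFDerivAt a a' z) (hb : HasFDerivAt b b' z) :
    ∃ D : Z →L[ℝ] C(K, G), HasFDerivAt (fun z => pointwiseBilin B (a z) (b z)) D z ∧
      ∀ v, D v = pointwiseBilin B (a z) (b' v) + pointwiseBilin B (a' v) (b z) :=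
  ⟨_, ContinuousLinearMap.hasFDerivAt_of_bilinear (pointwiseBilin B) ha hb, fun _ => rfl⟩

/-- The range of `y` is compact, so `F'` is uniformly continuous around it. The mean value
inequality on a ball about each `y t` then bounds the remainder uniformly in `t`, that is, in the
sup norm. -/
lemma hasFDerivAt_superposition {F : C(E, G)} {F' : C(E, E →L[ℝ] G)}
    (hF : ∀ x, HasFDerivAt F (F' x) x) (y : C(K, E)) :
    HasFDerivAt (fun y : C(K, E) => F.comp y)
      (pointwiseBilin (ContinuousLinearMap.id ℝ (E →L[ℝ] G)) (F'.comp y)) y := by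
  rw [hasFDerivAt_iff_isLittleO_nhds_zero, Asymptotics.isLittleO_iff]
  intro c hc
  have hK : IsCompact (range y) := isCompact_range y.continuous
  have hu := hK.uniformContinuousAt_of_continuousAt F' (fun a _ => F'.continuous.continuousAt)
    (Metric.dist_mem_uniformity hc)
  obtain ⟨δ, hδ, hδ'⟩ := Metric.mem_uniformity_dist.1 hu
  filter_upwards [Metric.ball_mem_nhds (0 : C(K, E)) hδ] with h hh
  rw [ContinuousMap.norm_le _ (by positivity)]
  intro t
  have ht : ‖h t‖ < δ := (h.norm_coe_le_norm t).trans_lt (by simpa using hh)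
  have key : ‖F (y t + h t) - F (y t) - F' (y t) (y t + h t - y t)‖ ≤ c * ‖y t + h t - y t‖ := by
    refine (convex_ball (y t) δ).norm_image_sub_le_of_norm_hasFDerivWithin_le' (f' := F')
      (fun x _ => (hF x).hasFDerivWithinAt) ?_ (Metric.mem_ball_self hδ) (by simpa using ht)
    intro x hx
    have := hδ' (a := y t) (b := x) (by rwa [dist_comm]) (mem_range_self t)
    rw [← dist_eq_norm, dist_comm]
    exact le_of_lt this
  have := key.trans (mul_le_mul_of_nonneg_left (by simpa using h.norm_coe_le_norm t) hc.le)
  simpa using this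

/-- The derivative is superposition by `F'` followed by a fixed continuous linear map, so the order
can be raised by induction. The target `G` is quantified inside because the induction replaces it by
`E →L[ℝ] G`. -/
lemma contDiff_superposition_nat (n : ℕ) :
    ∀ {G : Type} [NormedAddCommGroup G] [NormedSpace ℝ G] {F : C(E, G)},
      ContDiff ℝ ∞ F → ContDiff ℝ n (fun y : C(K, E) => F.comp y) := by
  induction n with
  | zero =>
    intro G _ _ F hF
    exact contDiff_zero.2 (ContinuousMap.continuous_postcomp F)
  | succ n ih =>
    intro G _ _ F hF
    have hF' : ContDiff ℝ ∞ (fderiv ℝ F) := hF.fderiv_right (by simp)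
    let F' : C(E, E →L[ℝ] G) := ⟨fderiv ℝ F, hF'.continuous⟩
    push_cast
    rw [contDiff_succ_iff_hasFDerivAt]
    refine ⟨fun y => pointwiseBilin (ContinuousLinearMap.id ℝ (E →L[ℝ] G)) (F'.comp y), ?_,
      hasFDerivAt_superposition (F' := F') fun x =>
        (hF.differentiable (by simp)).differentiableAt.hasFDerivAt⟩
    exact (ContinuousLinearMap.contDiff _).comp (ih (F := F') hF')

lemma contDiff_superposition {F : C(E, G)} (hF : ContDiff ℝ ∞ F) :
    ContDiff ℝ ∞ (fun y : C(K, E) => F.comp y) :=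
  contDiff_infty.2 fun n => contDiff_superposition_nat n hF

/-- A continuous multilinear map applied pointwise to continuous functions. -/
def pointwiseMultilinear {n : ℕ} (p : ContinuousMultilinearMap ℝ (fun _ : Fin n => E) G) :
    ContinuousMultilinearMap ℝ (fun _ : Fin n => C(K, E)) C(K, G) :=
  MultilinearMap.mkContinuous
    { toFun := fun y => ⟨fun t => p (fun i => y i t), by fun_prop⟩
      map_update_add' := by
        intro _ y i a b
        ext t
        have (c : C(K, E)) : (fun j => (Function.update y i c) j t) =
            Function.update (fun j => y j t) i (c t) := by
          funext j
          rcases eq_or_ne j i with rfl | hj <;> simp [*]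
        simp [this]
      map_update_smul' := by
        intro _ y i a b
        ext t
        have (c : C(K, E)) : (fun j => (Function.update y i c) j t) =
            Function.update (fun j => y j t) i (c t) := by
          funext j
          rcases eq_or_ne j i with rfl | hj <;> simp [*]
        simp [this] } ‖p‖
    (fun y => by
      rw [ContinuousMap.norm_le _ (by positivity)]
      intro t
      refine (p.le_opNorm _).trans ?_
      gcongr with i
      exact (y i).norm_coe_le_norm t)

lemma norm_pointwiseMultilinear_le {n : ℕ}
    (p : ContinuousMultilinearMap ℝ (fun _ : Fin n => E) G) :
    ‖(pointwiseMultilinear p : ContinuousMultilinearMap ℝ (fun _ : Fin n => C(K, E)) C(K, G))‖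
      ≤ ‖p‖ :=
  MultilinearMap.mkContinuous_norm_le _ (norm_nonneg _) _

/-- At a constant curve a single power series serves all `t`: its terms act pointwise without
increase of norm, so the series in `C(K, E)` converges on a ball at least as large. -/
lemma analyticAt_superposition [CompleteSpace G] {F : C(E, G)} {x₀ : E} (hF : AnalyticAt ℝ F x₀) :
    AnalyticAt ℝ (fun y : C(K, E) => F.comp y) (ContinuousMap.const K x₀) := by
  obtain ⟨p, r, hp⟩ := hF
  let q : FormalMultilinearSeries ℝ C(K, E) C(K, G) := fun n => pointwiseMultilinear (p n)
  have hr : r ≤ q.radius := by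
    refine hp.r_le.trans ?_
    refine ENNReal.le_of_forall_nnreal_lt fun s hs => ?_
    obtain ⟨C, _, hC⟩ := p.norm_mul_pow_le_of_lt_radius hs
    exact q.le_radius_of_bound C fun n =>
      (mul_le_mul_of_nonneg_right (norm_pointwiseMultilinear_le (p n)) (by positivity)).trans (hC n)
  refine ⟨q, r, hr, hp.r_pos, fun {y} hy => ?_⟩
  have hs : Summable fun n => q n fun _ => y :=
    q.summable (Metric.eball_subset_eball hr hy)
  refine hs.hasSum_iff.2 ?_
  ext t
  have h1 : HasSum (fun n => (q n fun _ => y) t) ((∑' n, q n fun _ => y) t) :=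
    hs.hasSum.mapL (ContinuousMap.evalCLM ℝ t)
  have h2 : HasSum (fun n => p n fun _ => y t) (F (x₀ + y t)) := by
    refine hp.hasSum ?_
    have : ‖y t‖ₑ ≤ ‖y‖ₑ := by
      rw [enorm_le_iff_norm_le]; exact y.norm_coe_le_norm t
    simp only [Metric.mem_eball, edist_zero_right] at hy ⊢
    exact this.trans_lt hy
  exact h1.unique h2

end Superposition

/-! ### Smoothness classes and the local inverse -/

lemma smoothness_ne_zero {k : WithTop ℕ∞} (hk : k = ∞ ∨ k = ω) : k ≠ 0 := by
  rcases hk with rfl | rfl <;> simp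

lemma one_le_smoothness {k : WithTop ℕ∞} (hk : k = ∞ ∨ k = ω) : 1 ≤ k := by
  rcases hk with rfl | rfl <;> simp

lemma infty_le_smoothness {k : WithTop ℕ∞} (hk : k = ∞ ∨ k = ω) : ∞ ≤ k := by
  rcases hk with rfl | rfl <;> simp

/-- Both classes are stable under differentiation, so brackets and derivatives along fields never
leave the class `Cᵏ`. -/
lemma smoothness_add_one_le {k : WithTop ℕ∞} (hk : k = ∞ ∨ k = ω) : k + 1 ≤ k := by
  rcases hk with rfl | rfl <;> simp

section InverseFunction

variable {E F : Type} [NormedAddCommGroup E] [NormedSpace ℝ E] [CompleteSpace E]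
  [NormedAddCommGroup F] [NormedSpace ℝ F]

/-- The inverse function theorem, with smoothness on a neighbourhood. -/
theorem exists_openPartialHomeomorph {k : WithTop ℕ∞} (hk : k = ∞ ∨ k = ω) {f : E → F} {a : E}
    (hf : ∀ᶠ x in 𝓝 a, ContDiffAt ℝ k f x) (hf' : (fderiv ℝ f a).IsInvertible) :
    ∃ Ψ : OpenPartialHomeomorph E F, (Ψ : E → F) = f ∧ a ∈ Ψ.source ∧
      (∀ x ∈ Ψ.source, ContDiffAt ℝ k f x ∧ (fderiv ℝ f x).IsInvertible) ∧
      ∀ y ∈ Ψ.target, ContDiffAt ℝ k Ψ.symm y := by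
  have hk0 := smoothness_ne_zero hk
  have hfa : ContDiffAt ℝ k f a := hf.self_of_nhds
  obtain ⟨f', hf'⟩ := hf'
  have hder : HasFDerivAt f (f' : E →L[ℝ] F) a := by
    rw [hf']; exact (hfa.differentiableAt hk0).hasFDerivAt
  have hinv : ∀ᶠ x in 𝓝 a, (fderiv ℝ f x).IsInvertible := by
    have hc : ContinuousAt (fderiv ℝ f) a :=
      (hfa.fderiv_right (m := 0) (by simpa using one_le_smoothness hk)).continuousAt
    refine hc.eventually ?_
    have := f'.nhds
    rw [hf'] at this
    filter_upwards [this] with L hL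
    exact hL
  obtain ⟨s, hs, hso, has⟩ := eventually_nhds_iff.1 (hf.and hinv)
  let Ψ₀ := hfa.toOpenPartialHomeomorph f hder hk0
  refine ⟨Ψ₀.restrOpen s hso, rfl, ⟨hfa.mem_toOpenPartialHomeomorph_source hder hk0, has⟩,
    fun x hx => hs x hx.2, fun y hy => ?_⟩
  have hy' := (Ψ₀.restrOpen s hso).map_target hy
  obtain ⟨h1, ⟨L, hL⟩⟩ := hs _ hy'.2
  refine (Ψ₀.restrOpen s hso).contDiffAt_symm (f₀' := L) hy ?_ h1
  rw [hL]
  exact (h1.differentiableAt hk0).hasFDerivAt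

end InverseFunction

/-! ### Cutoff functions -/

section Cutoff

variable {E G : Type} [NormedAddCommGroup E] [NormedSpace ℝ E] [FiniteDimensional ℝ E]
  [NormedAddCommGroup G] [NormedSpace ℝ G]

/-- A map smooth near a point coincides near it with a compactly supported smooth map. -/
lemma exists_compactSupport_eventuallyEq {k : WithTop ℕ∞} (hk : k = ∞ ∨ k = ω) {f : E → G} {a : E}
    (hf : ∀ᶠ x in 𝓝 a, ContDiffAt ℝ k f x) :
    ∃ g : E → G, ContDiff ℝ ∞ g ∧ HasCompactSupport g ∧ g =ᶠ[𝓝 a] f := by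
  obtain ⟨r, hr, hfr⟩ := Metric.eventually_nhds_iff_ball.1 hf
  let b : ContDiffBump a := ⟨r / 4, r / 2, by positivity, by linarith⟩
  have hsupp : tsupport b ⊆ Metric.ball a r := by
    rw [b.tsupport_eq]
    exact Metric.closedBall_subset_ball (by simpa [b] using hr)
  refine ⟨fun x => b x • f x, ?_, ?_, ?_⟩
  · refine contDiff_iff_contDiffAt.2 fun x => ?_
    by_cases hx : x ∈ tsupport b
    · exact b.contDiff.contDiffAt.smul ((hfr x (hsupp hx)).of_le (infty_le_smoothness hk))
    · have h0 : (fun x => b x • f x) =ᶠ[𝓝 x] fun _ => 0 := by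
        filter_upwards [notMem_tsupport_iff_eventuallyEq.1 hx] with y hy
        simp [hy]
      exact contDiffAt_const.congr_of_eventuallyEq h0
  · exact b.hasCompactSupport.smul_right
  · filter_upwards [b.eventuallyEq_one] with x hx
    simp [hx]

end Cutoff

/-! ### Joint flow of commuting vector fields -/

section Flow

open unitInterval

variable {E P : Type} [NormedAddCommGroup E] [NormedSpace ℝ E] [FiniteDimensional ℝ E]
  [NormedAddCommGroup P] [NormedSpace ℝ P]

/-- The primitive of a continuous function on `[0,1]` that vanishes at `0`. -/
def primitive (E : Type) [NormedAddCommGroup E] [NormedSpace ℝ E] [CompleteSpace E] :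
    C(I, E) →L[ℝ] C(I, E) :=
  LinearMap.mkContinuous
    { toFun := fun g => ⟨fun t => ∫ s in (0 : ℝ)..t, g (projIcc 0 1 zero_le_one s), by
        have : Continuous fun t : ℝ => ∫ s in (0 : ℝ)..t, g (projIcc 0 1 zero_le_one s) :=
          intervalIntegral.continuous_primitive
            (fun a b => (g.continuous.comp continuous_projIcc).intervalIntegrable a b) 0
        exact this.comp continuous_subtype_val⟩
      map_add' := fun g h => by
        ext t
        exact intervalIntegral.integral_add
          ((g.continuous.comp continuous_projIcc).intervalIntegrable _ _)
          ((h.continuous.comp continuous_projIcc).intervalIntegrable _ _)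
      map_smul' := fun c g => by
        ext t
        exact intervalIntegral.integral_smul c _ } 1
    (fun g => by
      rw [ContinuousMap.norm_le _ (by positivity)]
      intro t
      refine (intervalIntegral.norm_integral_le_of_norm_le_const
        (fun s _ => g.norm_coe_le_norm (projIcc 0 1 zero_le_one s))).trans ?_
      have h0 := t.2.1
      have h1 := t.2.2
      rw [one_mul, sub_zero, abs_of_nonneg h0]
      exact mul_le_of_le_one_right (norm_nonneg _) h1)

lemma primitive_apply (g : C(I, E)) (t : I) :
    primitive E g t = ∫ s in (0 : ℝ)..t, g (projIcc 0 1 zero_le_one s) := rfl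

lemma norm_primitive_apply_le (g : C(I, E)) : ‖primitive E g‖ ≤ ‖g‖ := by
  have h : ‖primitive E‖ ≤ 1 := LinearMap.mkContinuous_norm_le _ zero_le_one _
  exact ((primitive E).le_opNorm g).trans (mul_le_of_le_one_left (norm_nonneg _) h)

/-- Evaluation bilinear map, pointwise on curves. -/
abbrev evalCurve {G : Type} [NormedAddCommGroup G] [NormedSpace ℝ G] :
    C(I, P →L[ℝ] G) →L[ℝ] C(I, P) →L[ℝ] C(I, G) :=
  pointwiseBilin (ContinuousLinearMap.id ℝ (P →L[ℝ] G))

/-- The curves that solve `x' = e(x) p`, `x(0) = x₀` depend smoothly on `(p, x₀)`. -/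
lemma exists_flow [FiniteDimensional ℝ P] {k : WithTop ℕ∞} (hk : k = ∞ ∨ k = ω) (e : C(E, P →L[ℝ] E))
    (he : ContDiff ℝ ∞ e) {x₀ : E} (hek : ∀ᶠ x in 𝓝 x₀, ContDiffAt ℝ k e x) :
    ∃ S : P × E → C(I, E), S (0, x₀) = ContinuousMap.const I x₀ ∧
      (∀ᶠ z in 𝓝 (0, x₀), ContDiffAt ℝ k S z) ∧
      ∀ᶠ z in 𝓝 (0, x₀), S z = ContinuousMap.const I z.2 +
        primitive E (evalCurve (e.comp (S z)) (ContinuousMap.const I z.1)) := by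
  have hk0 := smoothness_ne_zero hk
  -- In the analytic case `e` is only known to be analytic near `x₀`; the superposition operator is
  -- then analytic at the constant curve, and analyticity is an open condition.
  have hnem : ∀ᶠ y in 𝓝 (ContinuousMap.const I x₀),
      ContDiffAt ℝ k (fun y : C(I, E) => e.comp y) y := by
    rcases hk with rfl | rfl
    · exact Eventually.of_forall fun y => (contDiff_superposition he).contDiffAt
    · have h : AnalyticAt ℝ e x₀ := hek.self_of_nhds.analyticAt
      exact (analyticAt_superposition h).eventually_analyticAt.mono fun y hy => hy.contDiffAt
  -- The zeros of `T` are the solutions of the integral equation on `[0,1]`. Time is scaled into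
  -- `p`, so existence up to time 1 costs only the smallness of `p`.
  let T : (P × E) × C(I, E) → C(I, E) := fun w =>
    w.2 - ContinuousLinearMap.const ℝ I w.1.2 - primitive E (evalCurve (e.comp w.2)
      (ContinuousLinearMap.const ℝ I w.1.1))
  let w₀ : (P × E) × C(I, E) := ((0, x₀), ContinuousMap.const I x₀)
  have hT : ∀ᶠ w in 𝓝 w₀, ContDiffAt ℝ k T w := by
    have : ∀ᶠ w : (P × E) × C(I, E) in 𝓝 w₀,
      ContDiffAt ℝ k (fun y : C(I, E) => e.comp y) w.2 := continuousAt_snd.eventually hnem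
    filter_upwards [this] with w hw
    have h1 : ContDiffAt ℝ k (fun w : (P × E) × C(I, E) => e.comp w.2) w :=
      hw.comp w contDiffAt_snd
    have h2 : ContDiffAt ℝ k (fun w : (P × E) × C(I, E) =>
        ContinuousLinearMap.const ℝ I w.1.1) w := by fun_prop
    have h3 : ContDiffAt ℝ k (fun w : (P × E) × C(I, E) =>
        evalCurve (e.comp w.2) (ContinuousLinearMap.const ℝ I w.1.1)) w :=
      contDiffAt_pointwiseBilin _ h1 h2
    have h4 : ContDiffAt ℝ k (fun w : (P × E) × C(I, E) =>
        primitive E (evalCurve (e.comp w.2) (ContinuousLinearMap.const ℝ I w.1.1))) w :=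
      (primitive E).contDiff.contDiffAt.comp w h3
    have h5 : ContDiffAt ℝ k (fun w : (P × E) × C(I, E) =>
        w.2 - ContinuousLinearMap.const ℝ I w.1.2) w := by fun_prop
    exact h5.sub h4
  -- At `p = 0` the integral term vanishes for every `y`, which leaves `y ↦ y - x₀`.
  have hpart : fderiv ℝ T w₀ ∘L .inr ℝ (P × E) C(I, E) = ContinuousLinearMap.id ℝ C(I, E) := by
    have h1 : HasFDerivAt T (fderiv ℝ T w₀) w₀ :=
      (hT.self_of_nhds.differentiableAt hk0).hasFDerivAt
    have h2 : HasFDerivAt (fun y : C(I, E) => ((0, x₀), y))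
        (.inr ℝ (P × E) C(I, E)) (ContinuousMap.const I x₀) := hasFDerivAt_prodMk_right _ _
    have h3 := HasFDerivAt.comp (ContinuousMap.const I x₀) h1 h2
    refine h3.unique ?_
    have : (T ∘ fun y : C(I, E) => ((0, x₀), y)) = fun y =>
        y - ContinuousLinearMap.const ℝ I x₀ := by
      funext y
      simp [T]
    rw [this]
    exact (hasFDerivAt_id _).sub_const _
  -- The implicit function theorem, through the local inverse of `(z, y) ↦ (z, T(z, y))`. Its
  -- derivative is block triangular with identity diagonal blocks.
  obtain ⟨W, hWT⟩ : ∃ W : (P × E) × C(I, E) → (P × E) × C(I, E), W = fun w => (w.1, T w) :=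
    ⟨_, rfl⟩
  have hW : ∀ᶠ w in 𝓝 w₀, ContDiffAt ℝ k W w := by
    filter_upwards [hT] with w hw
    rw [hWT]
    exact contDiffAt_fst.prodMk hw
  have hW' : (fderiv ℝ W w₀).IsInvertible := by
    have hTd := hT.self_of_nhds.differentiableAt hk0
    have hWd : fderiv ℝ W w₀ = (ContinuousLinearMap.fst ℝ _ _).prod (fderiv ℝ T w₀) := by
      rw [hWT]
      exact (hasFDerivAt_fst.prodMk hTd.hasFDerivAt).fderiv
    have hdec : ∀ a b, fderiv ℝ T w₀ (a, b) = fderiv ℝ T w₀ (a, 0) + b := by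
      intro a b
      have := DFunLike.congr_fun hpart b
      simp only [ContinuousLinearMap.comp_apply, ContinuousLinearMap.inr_apply,
        ContinuousLinearMap.id_apply] at this
      rw [← this, ← map_add]
      simp
      simp [this]
    refine ⟨ContinuousLinearEquiv.equivOfInverse (fderiv ℝ W w₀)
      ((ContinuousLinearMap.fst ℝ _ _).prod (ContinuousLinearMap.snd ℝ _ _ -
        fderiv ℝ T w₀ ∘L .inl ℝ _ _ ∘L ContinuousLinearMap.fst ℝ _ _)) ?_ ?_, ?_⟩
    · rintro ⟨a, b⟩
      rw [hWd]
      ext1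
      · simp
      · simp [hdec a b]
    · rintro ⟨a, b⟩
      rw [hWd]
      ext1
      · simp
      · simp only [ContinuousLinearMap.prod_apply]
        simp [hdec a (_ - _)]
    · ext w <;> rfl
  obtain ⟨Ψ, hΨ, hw₀, -, hsymm⟩ := exists_openPartialHomeomorph hk hW hW'
  have hTw₀ : T w₀ = 0 := by
    simp only [T, w₀, map_zero, sub_zero]
    exact sub_self _
  have hΨw₀ : Ψ w₀ = ((0, x₀), 0) := by
    rw [hΨ, hWT]
    simp only [hTw₀]
    rfl
  have hΨs : Ψ.symm ((0, x₀), 0) = w₀ := by rw [← hΨw₀, Ψ.left_inv hw₀]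
  have htgt : ∀ᶠ z : P × E in 𝓝 (0, x₀), (z, (0 : C(I, E))) ∈ Ψ.target := by
    have h1 : ContinuousAt (fun z : P × E => (z, (0 : C(I, E)))) (0, x₀) := by fun_prop
    exact h1.eventually (Ψ.open_target.mem_nhds (show ((0, x₀), (0 : C(I, E))) ∈ Ψ.target by
      rw [← hΨw₀]; exact Ψ.map_source hw₀))
  refine ⟨fun z => (Ψ.symm (z, 0)).2, by simp [hΨs, w₀], ?_, ?_⟩
  · filter_upwards [htgt] with z hz
    have h1 : ContDiffAt ℝ k (fun z : P × E => (z, (0 : C(I, E)))) z := by fun_prop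
    exact contDiffAt_snd.comp z ((hsymm _ hz).comp z h1)
  · filter_upwards [htgt] with z hz
    have h1 := Ψ.right_inv hz
    rw [hΨ, hWT] at h1
    have h2 : (Ψ.symm (z, 0)).1 = z := congrArg Prod.fst h1
    have h3 : T (Ψ.symm (z, 0)) = 0 := congrArg Prod.snd h1
    simp only [T, h2] at h3
    rw [sub_sub, sub_eq_zero] at h3
    exact h3

/-- Along a solution of `x' = e(x) p`, where the fields `e(·) p` commute, the curve `t e(x(t)) p'`
solves the variational equation. -/
lemma smul_frame_eq_primitive (e : C(E, P →L[ℝ] E)) (he : ContDiff ℝ ∞ e) (e' : C(E, E →L[ℝ] P →L[ℝ] E))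
    (he' : ⇑e' = fderiv ℝ e) (p p' : P) (x₀ : E) (y : C(I, E))
    (hy : y = ContinuousMap.const I x₀ +
        primitive E (evalCurve (e.comp y) (ContinuousMap.const I p))) (t : I) :
    (t : ℝ) • e (y t) p' = ∫ s in (0 : ℝ)..t, (e (y (projIcc 0 1 zero_le_one s)) p' +
      s • e' (y (projIcc 0 1 zero_le_one s)) (e (y (projIcc 0 1 zero_le_one s)) p) p') := by
  let pr : ℝ → I := projIcc 0 1 zero_le_one
  have hpr : Continuous pr := continuous_projIcc
  have hcont : Continuous fun s => e (y (pr s)) p := by fun_prop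
  -- `Y` extends `y` to the whole line, so that two-sided derivatives exist at the endpoints of
  -- `[0,1]` too.
  let Y : ℝ → E := fun t => x₀ + ∫ s in (0 : ℝ)..t, e (y (pr s)) p
  have hY : ∀ t, HasDerivAt Y (e (y (pr t)) p) t := fun t =>
    (intervalIntegral.integral_hasDerivAt_right (hcont.intervalIntegrable _ _)
      (hcont.stronglyMeasurableAtFilter _ _) hcont.continuousAt).const_add x₀
  have hYy : ∀ t : I, Y t = y t := by
    intro t
    conv_rhs => rw [hy]
    rfl
  have hYpr : ∀ t ∈ Icc (0 : ℝ) 1, Y t = y (pr t) := by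
    intro t ht
    have := hYy ⟨t, ht⟩
    simpa [pr, projIcc_of_mem zero_le_one ht] using this
  have hg : ∀ s ∈ uIcc (0 : ℝ) t, HasDerivAt (fun s => s • e (Y s) p')
      (e (y (pr s)) p' + s • e' (y (pr s)) (e (y (pr s)) p) p') s := by
    intro s hs
    have hs' : s ∈ Icc (0 : ℝ) 1 := by
      rw [uIcc_of_le t.2.1] at hs
      exact ⟨hs.1, hs.2.trans t.2.2⟩
    have h1 : HasDerivAt (fun s => e (Y s)) (e' (Y s) (e (y (pr s)) p)) s := by
      rw [he']
      exact ((he.differentiable (by simp)).differentiableAt.hasFDerivAt).comp_hasDerivAt s (hY s)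
    have h2 : HasDerivAt (fun s => e (Y s) p') (e' (Y s) (e (y (pr s)) p) p') s := by
      simpa using h1.clm_apply (hasDerivAt_const s p')
    have h3 : HasDerivAt (fun s => s • e (Y s) p')
        (s • e' (Y s) (e (y (pr s)) p) p' + (1 : ℝ) • e (Y s) p') s := (hasDerivAt_id s).smul h2
    rwa [hYpr s hs', add_comm, one_smul] at h3
  have hint : IntervalIntegrable (fun s => e (y (pr s)) p' +
      s • e' (y (pr s)) (e (y (pr s)) p) p') volume 0 t := by
    apply Continuous.intervalIntegrable
    fun_prop
  have := intervalIntegral.integral_eq_sub_of_hasDerivAt hg hint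
  rw [this, hYy t]
  simp

/-- The variational equation in a parameter direction. -/
lemma fderiv_flow_eq (e : C(E, P →L[ℝ] E)) (e' : C(E, E →L[ℝ] P →L[ℝ] E))
    (he : ∀ x, HasFDerivAt e (e' x) x) {S : P × E → C(I, E)} {S' : P × E →L[ℝ] C(I, E)} {z : P × E}
    (hS' : HasFDerivAt S S' z)
    (hS : ∀ᶠ z in 𝓝 z, S z = ContinuousMap.const I z.2 +
      primitive E (evalCurve (e.comp (S z)) (ContinuousMap.const I z.1))) (p' : P) :
    S' (p', 0) = primitive E (evalCurve (evalCurve (e'.comp (S z)) (S' (p', 0)))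
      (ContinuousMap.const I z.1) + evalCurve (e.comp (S z)) (ContinuousMap.const I p')) := by
  have h1 : HasFDerivAt (fun z => e.comp (S z))
      (evalCurve (e'.comp (S z)) ∘L S') z :=
    (hasFDerivAt_superposition (F := e) (F' := e') he (S z)).comp z hS'
  have h2 : HasFDerivAt (fun z : P × E => ContinuousLinearMap.const ℝ I z.1)
      (ContinuousLinearMap.const ℝ I ∘L ContinuousLinearMap.fst ℝ P E) z :=
    (ContinuousLinearMap.const ℝ I ∘L ContinuousLinearMap.fst ℝ P E).hasFDerivAt
  obtain ⟨D, hD, hDv⟩ := hasFDerivAt_pointwiseBilin (ContinuousLinearMap.id ℝ (P →L[ℝ] E)) h1 h2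
  have h3 := (primitive E).hasFDerivAt.comp z hD
  have h4 : HasFDerivAt (fun z : P × E => ContinuousLinearMap.const ℝ I z.2)
      (ContinuousLinearMap.const ℝ I ∘L ContinuousLinearMap.snd ℝ P E) z :=
    (ContinuousLinearMap.const ℝ I ∘L ContinuousLinearMap.snd ℝ P E).hasFDerivAt
  have h5 := ((h4.add h3).congr_of_eventuallyEq hS).unique hS'
  have h6 := DFunLike.congr_fun h5 (p', (0 : E))
  have h7 : S' (p', 0) = primitive E (D (p', 0)) := by
    rw [← h6]
    simp only [_root_.add_apply, ContinuousLinearMap.comp_apply,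
      ContinuousLinearMap.coe_snd', map_zero, zero_add]
  rw [hDv, add_comm] at h7
  exact h7

/-- A short curve that solves the homogeneous variational equation vanishes. -/
lemma eq_zero_of_eq_primitive (a : C(I, E →L[ℝ] P →L[ℝ] E)) {p : P} {C : ℝ}
    (hC : ∀ t, ‖a t‖ ≤ C) (hp : C * ‖p‖ < 1) {ζ : C(I, E)}
    (hζ : ζ = primitive E (evalCurve (evalCurve a ζ) (ContinuousMap.const I p))) : ζ = 0 := by
  have hC0 : 0 ≤ C := (norm_nonneg (a 0)).trans (hC 0)
  -- The integral operator has norm at most `C‖p‖ < 1`, so its only fixed point is zero.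
  have hb : ‖ζ‖ ≤ C * ‖p‖ * ‖ζ‖ := by
    conv_lhs => rw [hζ]
    refine (norm_primitive_apply_le _).trans ?_
    rw [ContinuousMap.norm_le _ (by positivity)]
    intro t
    change ‖a t (ζ t) p‖ ≤ _
    calc ‖a t (ζ t) p‖ ≤ ‖a t‖ * ‖ζ t‖ * ‖p‖ := ContinuousLinearMap.le_opNorm₂ _ _ _
      _ ≤ C * ‖ζ‖ * ‖p‖ := by
          gcongr
          · exact hC _
          · exact ζ.norm_coe_le_norm t
      _ = C * ‖p‖ * ‖ζ‖ := by ring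
  by_contra h
  have hpos : 0 < ‖ζ‖ := norm_pos_iff.2 h
  nlinarith

/-- Commutation turns the equation satisfied by `t ↦ t e(y t) p'` into the variational equation
satisfied by `η`. The difference solves the homogeneous equation and vanishes because `C‖p‖ < 1`;
the conclusion is the value at `t = 1`. -/
lemma eq_frame_of_variational (e : C(E, P →L[ℝ] E)) (he : ContDiff ℝ ∞ e)
    (e' : C(E, E →L[ℝ] P →L[ℝ] E)) (he' : ⇑e' = fderiv ℝ e) {C : ℝ} (hC : ∀ x, ‖e' x‖ ≤ C)
    {p p' : P} (hp : C * ‖p‖ < 1) {x₀ : E} {y η : C(I, E)}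
    (hy : y = ContinuousMap.const I x₀ +
      primitive E (evalCurve (e.comp y) (ContinuousMap.const I p)))
    (hη : η = primitive E (evalCurve (evalCurve (e'.comp y) η)
      (ContinuousMap.const I p) + evalCurve (e.comp y) (ContinuousMap.const I p')))
    (hcomm : ∀ t, e' (y t) (e (y t) p) p' = e' (y t) (e (y t) p') p) :
    η 1 = e (y 1) p' := by
  let μ : C(I, E) := ⟨fun t : I => (t : ℝ) • e (y t) p', by fun_prop⟩
  have hζ_eq : η - μ = primitive E (evalCurve (evalCurve (e'.comp y) (η - μ))
      (ContinuousMap.const I p)) := by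
    ext t
    have h1 : μ t = _ := smul_frame_eq_primitive e he e' he' p p' x₀ y hy t
    have h2 := DFunLike.congr_fun hη t
    rw [ContinuousMap.sub_apply, h1, h2, primitive_apply, primitive_apply,
      ← intervalIntegral.integral_sub]
    · refine intervalIntegral.integral_congr fun s hs => ?_
      have hs' : s ∈ Icc (0 : ℝ) 1 := by
        rw [uIcc_of_le t.2.1] at hs
        exact ⟨hs.1, hs.2.trans t.2.2⟩
      have hμ : μ (projIcc 0 1 zero_le_one s) = s • e (y (projIcc 0 1 zero_le_one s)) p' := by
        simp only [μ, ContinuousMap.coe_mk, projIcc_of_mem zero_le_one hs']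
      simp only [ContinuousMap.add_apply, pointwiseBilin_apply, ContinuousMap.comp_apply,
        ContinuousMap.const_apply, ContinuousLinearMap.id_apply, map_sub,
        _root_.sub_apply, ContinuousMap.sub_apply, hμ,
        hcomm, map_smul, _root_.smul_apply]
      abel
    · apply Continuous.intervalIntegrable
      have : Continuous (projIcc (0 : ℝ) 1 zero_le_one) := continuous_projIcc
      exact (ContinuousMap.continuous _).comp this
    · apply Continuous.intervalIntegrable
      have : Continuous (projIcc (0 : ℝ) 1 zero_le_one) := continuous_projIcc
      fun_prop
  have h0 := eq_zero_of_eq_primitive (e'.comp y) (fun t => hC (y t)) hp hζ_eq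
  have h1 := DFunLike.congr_fun h0 1
  have h2 : η 1 = μ 1 := sub_eq_zero.1 h1
  rw [h2]
  exact one_smul ℝ _

/-- The joint flow of commuting vector fields `e(·) p`. -/
theorem exists_commuting_flow [FiniteDimensional ℝ P] {k : WithTop ℕ∞} (hk : k = ∞ ∨ k = ω) {e : E → P →L[ℝ] E} {x₀ : E}
    (he : ∀ᶠ x in 𝓝 x₀, ContDiffAt ℝ k e x)
    (hcomm : ∀ᶠ x in 𝓝 x₀, ∀ p p', fderiv ℝ e x (e x p) p' = fderiv ℝ e x (e x p') p) :
    ∃ Φ : P × E → E, (∀ᶠ z in 𝓝 (0, x₀), ContDiffAt ℝ k Φ z) ∧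
      (∀ᶠ x in 𝓝 x₀, Φ (0, x) = x) ∧
      ∀ᶠ z in 𝓝 (0, x₀), ∀ p', fderiv ℝ Φ z (p', 0) = e (Φ z) p' := by
  have hk0 := smoothness_ne_zero hk
  -- The cutoff makes the superposition operator globally defined and the derivative bounded. It
  -- destroys analyticity away from `x₀`, but the class `Cᵏ` is only needed near `x₀`.
  obtain ⟨g, hg', hgs, hge'⟩ := exists_compactSupport_eventuallyEq hk he
  obtain ⟨ec, rfl⟩ : ∃ ec : C(E, P →L[ℝ] E), ec = g := ⟨⟨g, hg'.continuous⟩, rfl⟩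
  have hg : ContDiff ℝ ∞ ec := hg'
  have hge : ec =ᶠ[𝓝 x₀] e := hge'
  obtain ⟨ec', hec'⟩ : ∃ ec' : C(E, E →L[ℝ] P →L[ℝ] E), ec' = fderiv ℝ ec :=
    ⟨⟨fderiv ℝ ec, hg.continuous_fderiv (by simp)⟩, rfl⟩
  have hgk : ∀ᶠ x in 𝓝 x₀, ContDiffAt ℝ k ec x := by
    filter_upwards [he, hge.eventually_nhds] with x h1 h2
    exact h1.congr_of_eventuallyEq h2
  have hgcomm : ∀ᶠ x in 𝓝 x₀, ec x = e x ∧ ∀ p p', ec' x (ec x p) p' = ec' x (ec x p') p := by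
    filter_upwards [hcomm, hge, hge.eventually_nhds] with x h1 h2 h3
    refine ⟨h2, fun p p' => ?_⟩
    rw [hec', EventuallyEq.fderiv_eq (f₁ := ec) (f := e) h3, h2]
    exact h1 p p'
  obtain ⟨C, hC⟩ : ∃ C, ∀ x, ‖ec' x‖ ≤ C := by
    have h1 : HasCompactSupport (fderiv ℝ ec) := hgs.fderiv (𝕜 := ℝ)
    rw [← hec'] at h1
    exact HasCompactSupport.exists_bound_of_continuous (E := E →L[ℝ] P →L[ℝ] E) h1 ec'.continuous
  obtain ⟨S, hS₀, hSk, hS⟩ := exists_flow hk ec hg hgk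
  have hS1 : ∀ᶠ z in 𝓝 (0, x₀), ContDiffAt ℝ k (fun z => S z 1) z := by
    filter_upwards [hSk] with z hz
    exact contDiffAt_eval_curve hz 1
  refine ⟨fun z => S z 1, hS1, ?_, ?_⟩
  · have h1 : ContinuousAt (fun x : E => ((0 : P), x)) x₀ := by fun_prop
    filter_upwards [h1.eventually hS] with x hx
    rw [hx]
    simp
  -- `S` is continuous in the sup norm and its value at `(0, x₀)` is constant, so the whole curve `S
  -- z` stays where the cutoff changes nothing and the fields commute.
  · have hnear : ∀ᶠ z in 𝓝 (0, x₀), ∀ t, ec (S z t) = e (S z t) ∧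
        ∀ p p', ec' (S z t) (ec (S z t) p) p' = ec' (S z t) (ec (S z t) p') p := by
      obtain ⟨r, hr, hball⟩ := Metric.eventually_nhds_iff_ball.1 hgcomm
      have hc : ContinuousAt S (0, x₀) := hSk.self_of_nhds.continuousAt
      filter_upwards [hc.eventually (Metric.ball_mem_nhds _ hr)] with z hz t
      refine hball _ ?_
      rw [hS₀] at hz
      exact (ContinuousMap.dist_apply_le_dist t).trans_lt hz
    have hsmall : ∀ᶠ z : P × E in 𝓝 (0, x₀), C * ‖z.1‖ < 1 := by
      have h1 : ContinuousAt (fun z : P × E => C * ‖z.1‖) (0, x₀) := by fun_prop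
      refine h1.eventually (gt_mem_nhds ?_)
      simp
    filter_upwards [hSk, hS.eventually_nhds, hnear, hsmall] with z hzk hz hzn hzs p'
    have hzd := (hzk.differentiableAt hk0).hasFDerivAt
    obtain ⟨D, hD, hDv⟩ := hasFDerivAt_eval_curve hzd 1
    rw [hD.fderiv, hDv]
    rw [← (hzn 1).1]
    exact eq_frame_of_variational ec hg ec' hec' hC hzs hz.self_of_nhds
      (fderiv_flow_eq ec ec' (fun x => hec' ▸ (hg.differentiable (by simp)).differentiableAt.hasFDerivAt)
        hzd hz p') fun t => (hzn t).2 z.1 p'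

end Flow

/-! ### Frobenius' theorem -/

section Frobenius

variable {n : ℕ} {k : WithTop ℕ∞} {X : Set (Eucl n)} {Δ : Distribution n}

/-- Every vector of the distribution is the value of a local section. -/
def HasSections (k : WithTop ℕ∞) (X : Set (Eucl n)) (Δ : Distribution n) : Prop :=
  ∀ x ∈ X, ∀ v ∈ Δ x, ∃ V g, IsSection k X Δ V g ∧ x ∈ V ∧ g x = v

lemma HasSections.of_le_span (hX : IsOpen X)
    (h : ∀ x ∈ X, Δ x ≤ Submodule.span ℝ {v | ∃ V g, IsSection k X Δ V g ∧ x ∈ V ∧ g x = v}) :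
    HasSections k X Δ := by
  intro x hx v hv
  refine Submodule.span_induction (p := fun v _ => ∃ V g, IsSection k X Δ V g ∧ x ∈ V ∧ g x = v)
    (fun v hv => hv) ?_ ?_ ?_ (h x hx hv)
  · exact ⟨X, fun _ => 0, ⟨hX, Subset.rfl, contDiffOn_const, fun y _ => (Δ y).zero_mem⟩, hx, rfl⟩
  · rintro v w - - ⟨V, g, hg, hxV, rfl⟩ ⟨V', g', hg', hxV', rfl⟩
    exact ⟨V ∩ V', fun x => g x + g' x, ⟨hg.isOpen.inter hg'.isOpen,
      inter_subset_left.trans hg.subset, (hg.contDiffOn.mono inter_subset_left).add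
        (hg'.contDiffOn.mono inter_subset_right),
      fun y hy => (Δ y).add_mem (hg.mem y hy.1) (hg'.mem y hy.2)⟩, ⟨hxV, hxV'⟩, rfl⟩
  · rintro c v - ⟨V, g, hg, hxV, rfl⟩
    exact ⟨V, fun x => c • g x, ⟨hg.isOpen, hg.subset, hg.contDiffOn.const_smul c,
      fun y hy => (Δ y).smul_mem c (hg.mem y hy)⟩, hxV, rfl⟩

lemma IsSection.contDiffAt {V : Set (Eucl n)} {g : Eucl n → Eucl n} (hg : IsSection k X Δ V g)
    {x : Eucl n} (hx : x ∈ V) : ContDiffAt ℝ k g x :=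
  hg.contDiffOn.contDiffAt (hg.isOpen.mem_nhds hx)

/-- A distribution of constant rank with sections is, near a point, the graph of a smooth family
of linear maps over its value at that point. -/
lemma exists_frame (hX : IsOpen X) (hsec : HasSections k X Δ) {r : ℕ}
    (hr : ∀ x ∈ X, Module.finrank ℝ (Δ x) = r) {x₀ : Eucl n} (hx₀ : x₀ ∈ X)
    (π : Eucl n →L[ℝ] Δ x₀) (hπ : ∀ p : Δ x₀, π p = p) :
    ∃ e : Eucl n → Δ x₀ →L[ℝ] Eucl n, ∀ᶠ x in 𝓝 x₀, ContDiffAt ℝ k e x ∧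
      (∀ p, π (e x p) = p) ∧ LinearMap.range (e x : Δ x₀ →ₗ[ℝ] Eucl n) = Δ x := by
  let b := Module.finBasis ℝ (Δ x₀)
  choose V g hg hxV hgb using fun i => hsec x₀ hx₀ (b i) (b i).2
  let c : ∀ i, Δ x₀ →L[ℝ] ℝ := fun i => LinearMap.toContinuousLinearMap (b.coord i)
  let G : Eucl n → Δ x₀ →L[ℝ] Eucl n := fun x => ∑ i, (c i).smulRight (g i x)
  have hVn : ∀ᶠ x in 𝓝 x₀, ∀ i, x ∈ V i :=
    eventually_all.2 fun i => (hg i).isOpen.mem_nhds (hxV i)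
  have hG : ∀ᶠ x in 𝓝 x₀, ContDiffAt ℝ k G x := by
    filter_upwards [hVn] with x hx
    refine ContDiffAt.sum fun i _ => ?_
    exact contDiffAt_const.smulRight ((hg i).contDiffAt (hx i))
  have hG₀ : ∀ p, G x₀ p = p := by
    intro p
    have := congrArg (Submodule.subtype (Δ x₀)) (b.sum_repr p)
    simp only [map_sum, map_smul, Submodule.subtype_apply] at this
    simp only [G, _root_.sum_apply, ContinuousLinearMap.smulRight_apply, hgb]
    exact this
  -- Dividing by `N` normalises the frame so that `π ∘ e(x) = id`; it is this normalisation that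
  -- makes the fields `e(·) p` commute.
  let N : Eucl n → Δ x₀ →L[ℝ] Δ x₀ := fun x => π ∘L G x
  have hN : ∀ᶠ x in 𝓝 x₀, ContDiffAt ℝ k N x := by
    filter_upwards [hG] with x hx
    exact contDiffAt_const.clm_comp hx
  have hN₀ : N x₀ = ContinuousLinearMap.id ℝ _ := by
    ext p
    simp [N, hG₀, hπ]
  have hNinv : ∀ᶠ x in 𝓝 x₀, (N x).IsInvertible := by
    have hc : Tendsto N (𝓝 x₀) (𝓝 (ContinuousLinearEquiv.refl ℝ (Δ x₀) : Δ x₀ →L[ℝ] Δ x₀)) := by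
      have := hN.self_of_nhds.continuousAt
      rw [ContinuousAt, hN₀] at this
      exact this
    filter_upwards [hc.eventually (ContinuousLinearEquiv.nhds _)] with x hx
    exact hx
  refine ⟨fun x => G x ∘L (N x).inverse, ?_⟩
  filter_upwards [hG, hN, hNinv, hVn, hX.mem_nhds hx₀] with x h1 h2 h3 h4 h5
  have hid : ∀ p, π (G x ((N x).inverse p)) = p := fun p => by
    have := h3.self_apply_inverse p
    exact this
  refine ⟨h1.clm_comp (h3.contDiffAt_map_inverse.comp x h2), hid, ?_⟩
  refine Submodule.eq_of_le_of_finrank_eq ?_ ?_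
  · rintro _ ⟨p, rfl⟩
    change G x ((N x).inverse p) ∈ Δ x
    simp only [G, _root_.sum_apply, ContinuousLinearMap.smulRight_apply]
    exact Submodule.sum_mem _ fun i _ => (Δ x).smul_mem _ ((hg i).mem x (h4 i))
  · rw [LinearMap.finrank_range_of_inj, hr x h5, hr x₀ hx₀]
    exact Function.LeftInverse.injective (g := π) hid

/-- **Frobenius' theorem**: an integrable distribution is locally the kernel of the derivative of
a smooth map. -/
theorem exists_ker_fderiv_eq (hk : k = ∞ ∨ k = ω) (hX : IsOpen X) (hsec : HasSections k X Δ)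
    (hint : Integrable k X Δ) {x₀ : Eucl n} (hx₀ : x₀ ∈ X) :
    ∃ θ : Eucl n → Eucl n, ∀ᶠ x in 𝓝 x₀, ContDiffAt ℝ k θ x ∧
      LinearMap.ker (fderiv ℝ θ x : Eucl n →ₗ[ℝ] Eucl n) = Δ x := by
  have hk0 := smoothness_ne_zero hk
  obtain ⟨⟨r, hr⟩, hinv⟩ := hint
  obtain ⟨π, hπ⟩ := Submodule.ClosedComplemented.of_finiteDimensional (Δ x₀)
  obtain ⟨e, he⟩ := exists_frame hX hsec hr hx₀ π hπ
  -- Since `π (e x p) = p` is constant in `x`, `π` kills the derivatives of the fields and hence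
  -- their brackets. But a bracket lies in `Δ x`, the range of `e x`, on which `π` is injective; so
  -- it is zero.
  have hcomm : ∀ᶠ x in 𝓝 x₀, ∀ p p', fderiv ℝ e x (e x p) p' = fderiv ℝ e x (e x p') p := by
    obtain ⟨V, hV, hVo, hxV⟩ := eventually_nhds_iff.1 (he.and (hX.mem_nhds hx₀))
    filter_upwards [hVo.mem_nhds hxV] with x hx p p'
    have hs : ∀ p, IsSection k X Δ V fun x => e x p := fun p =>
      ⟨hVo, fun y hy => (hV y hy).2,
        fun y hy => ((hV y hy).1.1.clm_apply contDiffAt_const).contDiffWithinAt,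
        fun y hy => (hV y hy).1.2.2 ▸ ⟨p, rfl⟩⟩
    have hd : ∀ p w, fderiv ℝ (fun x => e x p) x w = fderiv ℝ e x w p := fun p w => by
      have h1 := ((hV x hx).1.1.differentiableAt hk0).hasFDerivAt.clm_apply
        (hasFDerivAt_const p x)
      rw [h1.fderiv]
      simp
    have hdπ : ∀ p w, π (fderiv ℝ (fun x => e x p) x w) = 0 := fun p w => by
      have h1 : HasFDerivAt (fun x => π (e x p)) (π ∘L fderiv ℝ (fun x => e x p) x) x :=
        π.hasFDerivAt.comp x (((hs p).contDiffAt hx).differentiableAt hk0).hasFDerivAt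
      have h2 : (fun x => π (e x p)) =ᶠ[𝓝 x] fun _ => p := by
        filter_upwards [hVo.mem_nhds hx] with y hy using (hV y hy).1.2.1 p
      have h3 := h1.unique ((hasFDerivAt_const p x).congr_of_eventuallyEq h2)
      exact DFunLike.congr_fun h3 w
    have hb := hinv V _ _ (hs p) (hs p') x hx
    rw [← (hV x hx).1.2.2] at hb
    obtain ⟨q, hq⟩ := hb
    have hq' : e x q = VectorField.lieBracket ℝ (fun x => e x p) (fun x => e x p') x := hq
    have hq0 : q = 0 := by
      rw [← (hV x hx).1.2.1 q, hq', VectorField.lieBracket, map_sub, hdπ, hdπ, sub_zero]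
    rw [hq0, map_zero, VectorField.lieBracket, hd, hd] at hq'
    exact sub_eq_zero.1 hq'.symm
  obtain ⟨Φ, hΦk, hΦ0, hΦ⟩ := exists_commuting_flow hk (he.mono fun x h => h.1) hcomm
  -- `ι` splits `v` into the flow parameter `π v` and a transverse displacement `v - π v`. Thus `Λ`
  -- starts at a point of a transversal through `x₀` and flows along `Δ`, with derivative the
  -- identity at `0`.
  let ι : Eucl n →L[ℝ] Δ x₀ × Eucl n :=
    π.prod (ContinuousLinearMap.id ℝ _ - (Δ x₀).subtypeL ∘L π)
  let j : Eucl n → Δ x₀ × Eucl n := fun v => (0, x₀) + ι v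
  have hjk : ∀ v, ContDiffAt ℝ k j v := fun v => contDiffAt_const.add ι.contDiff.contDiffAt
  have hj0 : j 0 = (0, x₀) := by simp [j]
  have hjd : ∀ v, HasFDerivAt j ι v := fun v => ι.hasFDerivAt.const_add _
  have hjc : Tendsto j (𝓝 0) (𝓝 (0, x₀)) := by
    have := (hjd 0).continuousAt
    rwa [ContinuousAt, hj0] at this
  let Λ : Eucl n → Eucl n := fun v => Φ (j v)
  have hΛk : ∀ᶠ v in 𝓝 0, ContDiffAt ℝ k Λ v := by
    filter_upwards [hjc.eventually hΦk] with v hv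
    exact hv.comp v (hjk v)
  have hΛ0 : Λ 0 = x₀ := by
    simp only [Λ, hj0]
    exact hΦ0.self_of_nhds
  have hι : ∀ p : Δ x₀, ι p = (p, 0) := fun p => by simp [ι, hπ]
  have hΛd : ∀ᶠ v in 𝓝 0, ∀ p : Δ x₀, fderiv ℝ Λ v p = e (Λ v) p := by
    filter_upwards [hjc.eventually hΦk, hjc.eventually hΦ] with v h1 h2 p
    have := (h1.differentiableAt hk0).hasFDerivAt.comp v (hjd v)
    rw [show fderiv ℝ Λ v = _ from this.fderiv, ContinuousLinearMap.comp_apply, hι, h2]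
  have he₀ : ∀ p, e x₀ p = p := fun p => by
    obtain ⟨-, h1, h2⟩ := he.self_of_nhds
    have h3 : e x₀ p ∈ Δ x₀ := h2.le ⟨p, rfl⟩
    have h4 := hπ ⟨_, h3⟩
    exact congrArg Subtype.val (h4.symm.trans (h1 p))
  have hΛid : fderiv ℝ Λ 0 = ContinuousLinearMap.id ℝ _ := by
    have h1 : ∀ w, fderiv ℝ Φ (0, x₀) (0, w) = w := fun w => by
      have hd : HasFDerivAt Φ (fderiv ℝ Φ (0, x₀)) (0, x₀) :=
        (hΦk.self_of_nhds.differentiableAt hk0).hasFDerivAt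
      have hc := hd.comp x₀ (hasFDerivAt_prodMk_right (𝕜 := ℝ) (0 : Δ x₀) x₀)
      have := hc.unique ((hasFDerivAt_id x₀).congr_of_eventuallyEq hΦ0)
      exact DFunLike.congr_fun this w
    have h2 := (hΦk.self_of_nhds.differentiableAt hk0).hasFDerivAt
    rw [← hj0] at h2
    have h3 := h2.comp 0 (hjd 0)
    rw [show fderiv ℝ Λ 0 = _ from h3.fderiv, hj0]
    ext1 v
    have h4 : ι v = (π v, 0) + (0, v - π v) := by simp [ι]
    rw [ContinuousLinearMap.comp_apply, h4, map_add, h1, hΦ.self_of_nhds, hΦ0.self_of_nhds, he₀]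
    simp
  obtain ⟨Ψ, hΨ, h0, hsrc, htgt⟩ := exists_openPartialHomeomorph hk hΛk
    (by rw [hΛid]; exact ⟨ContinuousLinearEquiv.refl ℝ _, rfl⟩)
  have hΨ0 : Ψ 0 = x₀ := by rw [hΨ, hΛ0]
  have hxt : x₀ ∈ Ψ.target := by rw [← hΨ0]; exact Ψ.map_source h0
  have hΨc : Tendsto Ψ.symm (𝓝 x₀) (𝓝 0) := by
    have := Ψ.continuousAt_symm hxt
    rwa [ContinuousAt, ← hΨ0, Ψ.left_inv h0, hΨ0] at this
  let ρ : Eucl n →L[ℝ] Eucl n := ContinuousLinearMap.id ℝ _ - (Δ x₀).subtypeL ∘L π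
  -- The first integral is the transverse coordinate of the straightened chart: only motion along
  -- `Δ` leaves it fixed.
  refine ⟨fun x => ρ (Ψ.symm x), ?_⟩
  filter_upwards [Ψ.open_target.mem_nhds hxt, hΨc.eventually hΛd, he] with x hx h1 h2
  have hks := htgt x hx
  have hdsymm := (hks.differentiableAt hk0).hasFDerivAt
  have hdΛ : HasFDerivAt Λ (fderiv ℝ Λ (Ψ.symm x)) (Ψ.symm x) :=
    ((hsrc _ (Ψ.map_target hx)).1.differentiableAt hk0).hasFDerivAt
  have hright : ∀ w, fderiv ℝ Λ (Ψ.symm x) (fderiv ℝ Ψ.symm x w) = w := fun w => by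
    have h3 := hdΛ.comp x hdsymm
    have h4 : (Λ ∘ Ψ.symm) =ᶠ[𝓝 x] id := by
      filter_upwards [Ψ.open_target.mem_nhds hx] with y hy
      rw [← hΨ]
      exact Ψ.right_inv hy
    exact DFunLike.congr_fun (h3.unique ((hasFDerivAt_id x).congr_of_eventuallyEq h4)) w
  have hleft : ∀ w, fderiv ℝ Ψ.symm x (fderiv ℝ Λ (Ψ.symm x) w) = w := fun w => by
    obtain ⟨L, hL⟩ := (hsrc _ (Ψ.map_target hx)).2
    have h3 := hright (fderiv ℝ Λ (Ψ.symm x) w)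
    rw [← hL] at h3 ⊢
    exact L.injective h3
  have hΛx : Λ (Ψ.symm x) = x := by rw [← hΨ]; exact Ψ.right_inv hx
  rw [hΛx] at h1
  refine ⟨ρ.contDiff.contDiffAt.comp x hks, ?_⟩
  have hθ : fderiv ℝ (fun x => ρ (Ψ.symm x)) x = ρ ∘L fderiv ℝ Ψ.symm x :=
    (ρ.hasFDerivAt.comp x hdsymm).fderiv
  rw [hθ, ← h2.2.2]
  ext w
  simp only [LinearMap.mem_ker, LinearMap.mem_range]
  constructor
  · intro hw
    refine ⟨π (fderiv ℝ Ψ.symm x w), ?_⟩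
    have h3 : fderiv ℝ Ψ.symm x w = π (fderiv ℝ Ψ.symm x w) := sub_eq_zero.1 hw
    change e x _ = w
    rw [← h1, ← h3, hright]
  · rintro ⟨p, rfl⟩
    change ρ (fderiv ℝ Ψ.symm x (e x p)) = 0
    rw [← h1, hleft]
    simp [ρ, hπ]

end Frobenius

/-! ### Linear quotients and descent along the flag -/

section LinearQuotient

variable {n : ℕ} {k : WithTop ℕ∞} {X : Set (Eucl n)} {Δ : Distribution n}

/-- If `R` is a right inverse of `L₀`, then `L ∘ R` is close to the identity for `L` close to `L₀`,
hence invertible. -/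
lemma eventually_range_eq_top {E F : Type} [NormedAddCommGroup E] [NormedSpace ℝ E]
    [NormedAddCommGroup F] [NormedSpace ℝ F] [FiniteDimensional ℝ F] {L₀ : E →L[ℝ] F}
    (h : LinearMap.range (L₀ : E →ₗ[ℝ] F) = ⊤) :
    ∀ᶠ L : E →L[ℝ] F in 𝓝 L₀, LinearMap.range (L : E →ₗ[ℝ] F) = ⊤ := by
  obtain ⟨R, hR⟩ := ContinuousLinearMap.exists_rightInverse_of_surjective L₀ h
  have hc : Tendsto (fun L : E →L[ℝ] F => L ∘L R) (𝓝 L₀)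
      (𝓝 (ContinuousLinearEquiv.refl ℝ F : F →L[ℝ] F)) := by
    have h1 : Continuous fun L : E →L[ℝ] F => L ∘L R := by fun_prop
    have := h1.tendsto L₀
    rwa [hR] at this
  filter_upwards [hc.eventually (ContinuousLinearEquiv.nhds _)] with L hL
  obtain ⟨e, he⟩ := hL
  refine LinearMap.range_eq_top.2 fun y => ⟨R (e.symm y), ?_⟩
  have := DFunLike.congr_fun he (e.symm y)
  simpa using this.symm

lemma contDiffAt_fderiv_apply {E F : Type} [NormedAddCommGroup E] [NormedSpace ℝ E]
    [NormedAddCommGroup F] [NormedSpace ℝ F] (hk : k = ∞ ∨ k = ω) {h : E → F} {f : E → E} {x : E}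
    (hh : ContDiffAt ℝ k h x) (hf : ContDiffAt ℝ k f x) :
    ContDiffAt ℝ k (fun x => fderiv ℝ h x (f x)) x :=
  (hh.fderiv_right (smoothness_add_one_le hk)).clm_apply hf

lemma two_le_smoothness (hk : k = ∞ ∨ k = ω) : minSmoothness ℝ 2 ≤ k := by
  rw [minSmoothness_of_isRCLikeNormedField]
  rcases hk with rfl | rfl
  · exact WithTop.coe_le_coe.2 le_top
  · exact le_top

/-- Decides whether a bracket is tangent to the fibres of `h` using only the derivatives of `dh(f)`
and `dh(g)`. -/
lemma fderiv_lieBracket {F : Type} [NormedAddCommGroup F] [NormedSpace ℝ F]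
    (hk : k = ∞ ∨ k = ω) {h : Eucl n → F} {f g : Eucl n → Eucl n} {x : Eucl n}
    (hh : ContDiffAt ℝ k h x) (hf : ContDiffAt ℝ k f x) (hg : ContDiffAt ℝ k g x) :
    fderiv ℝ h x (VectorField.lieBracket ℝ f g x) =
      fderiv ℝ (fun x => fderiv ℝ h x (g x)) x (f x) -
        fderiv ℝ (fun x => fderiv ℝ h x (f x)) x (g x) :=
  VectorField.fderiv_apply_lieBracket hh (two_le_smoothness hk)
    (hg.differentiableAt (smoothness_ne_zero hk)) (hf.differentiableAt (smoothness_ne_zero hk))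

/-- Near `x₀` there is a submersion `h` whose fibres are tangent to `Δ` such that the derivative of
`h` along `f` is `A h` modulo a subspace `W`, the image of `Δ'`, with `(A, W)` controllable. -/
def HasLinearQuotient (k : WithTop ℕ∞) (f : Eucl n → Eucl n) (Δ Δ' : Distribution n)
    (x₀ : Eucl n) : Prop :=
  ∃ (F : Type) (_ : NormedAddCommGroup F) (_ : NormedSpace ℝ F) (_ : FiniteDimensional ℝ F)
    (h : Eucl n → F) (A : F →L[ℝ] F) (W : Submodule ℝ F),
    (∀ᶠ x in 𝓝 x₀, ContDiffAt ℝ k h x ∧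
      LinearMap.range (fderiv ℝ h x : Eucl n →ₗ[ℝ] F) = ⊤ ∧
      LinearMap.ker (fderiv ℝ h x : Eucl n →ₗ[ℝ] F) = Δ x ∧
      fderiv ℝ h x (f x) - A (h x) ∈ W ∧
      Submodule.map (fderiv ℝ h x : Eucl n →ₗ[ℝ] F) (Δ' x) = W) ∧
    ∀ S : Submodule ℝ F, W ≤ S → (∀ v ∈ S, A v ∈ S) → S = ⊤

/-- The start of the descent: the quotient by the full tangent space is a point. -/
lemma HasLinearQuotient.of_eq_top {f : Eucl n → Eucl n} {Δ Δ' : Distribution n} {x₀ : Eucl n}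
    (h : ∀ᶠ x in 𝓝 x₀, Δ x = ⊤) : HasLinearQuotient k f Δ Δ' x₀ := by
  refine ⟨Fin 0 → ℝ, inferInstance, inferInstance, inferInstance, fun _ => 0, 0, ⊥, ?_, ?_⟩
  · filter_upwards [h] with x hx
    rw [hx]
    exact ⟨contDiffAt_const, Subsingleton.elim _ _, by ext; simp, by simp, Subsingleton.elim _ _⟩
  · exact fun S _ _ => Subsingleton.elim _ _

/-- The extension of `A` by new integrator states that feed into `W`. -/
def prolong {F : Type} [NormedAddCommGroup F] [NormedSpace ℝ F] (A : F →L[ℝ] F)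
    (W : Submodule ℝ F) (C : Type) [NormedAddCommGroup C] [NormedSpace ℝ C] :
    F × W × C →L[ℝ] F × W × C :=
  (A ∘L .fst ℝ F (W × C) + W.subtypeL ∘L .fst ℝ W C ∘L .snd ℝ F (W × C)).prod 0

lemma prolong_apply {F : Type} [NormedAddCommGroup F] [NormedSpace ℝ F] (A : F →L[ℝ] F)
    (W : Submodule ℝ F) (C : Type) [NormedAddCommGroup C] [NormedSpace ℝ C] (a : F) (w : W) (c : C) :
    prolong A W C (a, w, c) = (A a + w, 0) := rfl

/-- One application of the prolonged map sends `(0, w, 0)` to `(w, 0, 0)`. So the slice of `S` along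
`F` contains `W`; it is also `A`-invariant, hence all of `F` by controllability of `(A, W)`. -/
lemma prolong_controllable {F : Type} [NormedAddCommGroup F] [NormedSpace ℝ F] (A : F →L[ℝ] F)
    (W : Submodule ℝ F) (C : Type) [NormedAddCommGroup C] [NormedSpace ℝ C]
    (h : ∀ S : Submodule ℝ F, W ≤ S → (∀ v ∈ S, A v ∈ S) → S = ⊤) (S : Submodule ℝ (F × W × C))
    (hW : Submodule.prod ⊥ ⊤ ≤ S) (hS : ∀ v ∈ S, prolong A W C v ∈ S) : S = ⊤ := by
  have h1 : Submodule.comap (LinearMap.inl ℝ F (W × C)) S = ⊤ := by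
    refine h _ (fun b hb => ?_) fun a ha => ?_
    · have := hS (0, ⟨b, hb⟩, 0) (hW (by simp))
      simpa [prolong_apply] using this
    · have := hS (a, 0, 0) ha
      simpa [prolong_apply] using this
  refine (Submodule.eq_top_iff').2 fun ⟨a, b⟩ => ?_
  have h2 : (a, 0) ∈ S := (Submodule.eq_top_iff'.1 h1) a
  have h3 : ((0 : F), b) ∈ S := hW (by simp)
  simpa using S.add_mem h2 h3

/-- Enlarging a linear quotient to the quotient by a smaller distribution `Δm`. -/
lemma HasLinearQuotient.step (hk : k = ∞ ∨ k = ω) (hX : IsOpen X) {x₀ : Eucl n} (hx₀ : x₀ ∈ X)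
    {f : Eucl n → Eucl n} (hf : ContDiffOn ℝ k f X) {Δm Δ Δ' : Distribution n}
    (hq : HasLinearQuotient k f Δ Δ' x₀) (hle : ∀ x ∈ X, Δm x ≤ Δ x) {r : ℕ}
    (hr : ∀ x ∈ X, Module.finrank ℝ (Δm x) = r) (hsec : HasSections k X Δm)
    (hbr : ∀ V g, IsSection k X Δm V g → ∀ x ∈ V, VectorField.lieBracket ℝ f g x ∈ Δ x)
    (hgen : ∀ x ∈ X, Δ' x ≤ addBracket k X f Δ x) {θ : Eucl n → Eucl n}
    (hθ : ∀ᶠ x in 𝓝 x₀, ContDiffAt ℝ k θ x ∧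
      LinearMap.ker (fderiv ℝ θ x : Eucl n →ₗ[ℝ] Eucl n) = Δm x) :
    HasLinearQuotient k f Δm Δ x₀ := by
  obtain ⟨F, _, _, _, h, A, W, hh, hctr⟩ := hq
  have hk0 := smoothness_ne_zero hk
  obtain ⟨prW, hprW⟩ := Submodule.ClosedComplemented.of_finiteDimensional W
  -- `w` is the defect of linearity of `h`; near `x₀` it lies in `W` and the projection changes
  -- nothing.
  let w : Eucl n → W := fun x => prW (fderiv ℝ h x (f x) - A (h x))
  obtain ⟨V₀, hV₀, hV₀o, hxV₀⟩ := eventually_nhds_iff.1 (hh.and (hX.mem_nhds hx₀))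
  have hfk : ∀ x ∈ V₀, ContDiffAt ℝ k f x := fun x hx => hf.contDiffAt (hX.mem_nhds (hV₀ x hx).2)
  have hwk : ∀ x ∈ V₀, ContDiffAt ℝ k w x := fun x hx =>
    prW.contDiff.contDiffAt.comp x ((contDiffAt_fderiv_apply hk (hV₀ x hx).1.1 (hfk x hx)).sub
      (A.contDiff.contDiffAt.comp x (hV₀ x hx).1.1))
  have hwval : ∀ x ∈ V₀, (w x : F) = fderiv ℝ h x (f x) - A (h x) := fun x hx =>
    congrArg Subtype.val (hprW ⟨_, (hV₀ x hx).1.2.2.2.1⟩)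
  have hker : ∀ x ∈ V₀, ∀ v, v ∈ Δ x ↔ fderiv ℝ h x v = 0 := fun x hx v => by
    rw [← (hV₀ x hx).1.2.2.1]; rfl
  -- the derivative of `w` along sections of `Δ`
  have hwg : ∀ V g, IsSection k X Δ V g → ∀ x ∈ V, x ∈ V₀ →
      (fderiv ℝ w x (g x) : F) = - fderiv ℝ h x (VectorField.lieBracket ℝ f g x) := by
    intro V g hg x hxV hx
    have hhk := (hV₀ x hx).1.1
    -- `g` is tangent to the fibres of `h`, so in the bracket formula only the derivative of `dh(f)`
    -- along `g` survives, and it equals `dw(g)` because `A (dh g) = 0`.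
    have h0 : (fun y => fderiv ℝ h y (g y)) =ᶠ[𝓝 x] fun _ => 0 := by
      filter_upwards [hV₀o.mem_nhds hx, hg.isOpen.mem_nhds hxV] with y hy hyV
      exact (hker y hy _).1 (hg.mem y hyV)
    rw [fderiv_lieBracket hk hhk (hfk x hx) (hg.contDiffAt hxV), h0.fderiv_eq]
    have h1 : HasFDerivAt (fun y => (w y : F)) (W.subtypeL ∘L fderiv ℝ w x) x :=
      W.subtypeL.hasFDerivAt.comp x ((hwk x hx).differentiableAt hk0).hasFDerivAt
    have h2 : HasFDerivAt (fun y => fderiv ℝ h y (f y) - A (h y))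
        (fderiv ℝ (fun y => fderiv ℝ h y (f y)) x - A ∘L fderiv ℝ h x) x :=
      ((contDiffAt_fderiv_apply hk hhk (hfk x hx)).differentiableAt hk0).hasFDerivAt.sub
        (A.hasFDerivAt.comp x (hhk.differentiableAt hk0).hasFDerivAt)
    have h3 : (fun y => (w y : F)) =ᶠ[𝓝 x] fun y => fderiv ℝ h y (f y) - A (h y) := by
      filter_upwards [hV₀o.mem_nhds hx] with y hy using hwval y hy
    have h4 := DFunLike.congr_fun (h1.unique (h2.congr_of_eventuallyEq h3)) (g x)
    have h5 : fderiv ℝ h x (g x) = 0 := (hker x hx _).1 (hg.mem x hxV)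
    simpa [h5] using h4
  have hw0 : ∀ x ∈ V₀, ∀ v ∈ Δm x, fderiv ℝ w x v = 0 := by
    intro x hx v hv
    obtain ⟨V, g, hg, hxV, rfl⟩ := hsec x (hV₀ x hx).2 v hv
    have h1 := hwg V g ⟨hg.isOpen, hg.subset, hg.contDiffOn,
      fun y hy => hle y (hg.subset hy) (hg.mem y hy)⟩ x hxV hx
    rw [(hker x hx _).1 (hbr V g hg x hxV), neg_zero] at h1
    exact Subtype.ext h1
  -- `dh` kills `Δ`, so modulo signs `dw(Δ)` is the image under `dh` of the brackets, which generate
  -- all of `W = dh(Δ')`.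
  have hwsurj : ∀ x ∈ V₀, ∀ b : W, ∃ v ∈ Δ x, fderiv ℝ w x v = b := by
    intro x hx b
    have h1 : addBracket k X f Δ x ≤ Submodule.comap (fderiv ℝ h x : Eucl n →ₗ[ℝ] F)
        (Submodule.map (W.subtype ∘ₗ (fderiv ℝ w x : Eucl n →ₗ[ℝ] W)) (Δ x)) := by
      refine sup_le (fun d hd => ?_) (Submodule.span_le.2 ?_)
      · rw [Submodule.mem_comap, show (fderiv ℝ h x : Eucl n →ₗ[ℝ] F) d = 0 from (hker x hx d).1 hd]
        exact Submodule.zero_mem _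
      · rintro _ ⟨V, g, hg, hxV, rfl⟩
        refine ⟨-g x, (Δ x).neg_mem (hg.mem x hxV), ?_⟩
        have := hwg V g hg x hxV hx
        simp [this]
    have h2 : (b : F) ∈ Submodule.map (fderiv ℝ h x : Eucl n →ₗ[ℝ] F) (Δ' x) := by
      rw [(hV₀ x hx).1.2.2.2.2]; exact b.2
    obtain ⟨d, hd, hdb⟩ := h2
    obtain ⟨v, hv, hvb⟩ := h1 (hgen x (hV₀ x hx).2 hd)
    exact ⟨v, hv, Subtype.ext (hvb.trans hdb)⟩
  -- The directions missed by `(h, w)` are `Δ ∩ ker dw`, modulo `Δm`. The first integral `θ` of `Δm`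
  -- embeds this quotient as `C`, so `prC ∘ θ` supplies exactly the missing coordinates.
  let C : Submodule ℝ (Eucl n) := Submodule.map (fderiv ℝ θ x₀ : Eucl n →ₗ[ℝ] Eucl n)
    (Δ x₀ ⊓ LinearMap.ker (fderiv ℝ w x₀ : Eucl n →ₗ[ℝ] W))
  obtain ⟨prC, hprC⟩ := Submodule.ClosedComplemented.of_finiteDimensional C
  let h' : Eucl n → F × W × C := fun x => (h x, w x, prC (θ x))
  have hh'k : ∀ᶠ x in 𝓝 x₀, ContDiffAt ℝ k h' x ∧ ∀ v, fderiv ℝ h' x v =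
      (fderiv ℝ h x v, fderiv ℝ w x v, prC (fderiv ℝ θ x v)) := by
    filter_upwards [hV₀o.mem_nhds hxV₀, hθ] with x hx hθx
    have h1 := hθx.1
    refine ⟨(hV₀ x hx).1.1.prodMk ((hwk x hx).prodMk (prC.contDiff.contDiffAt.comp x h1)), ?_⟩
    have h2 : HasFDerivAt h' _ x :=
      ((hV₀ x hx).1.1.differentiableAt hk0).hasFDerivAt.prodMk
        (((hwk x hx).differentiableAt hk0).hasFDerivAt.prodMk
          (prC.hasFDerivAt.comp x (h1.differentiableAt hk0).hasFDerivAt))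
    intro v
    rw [h2.fderiv]
    rfl
  have hsurj₀ : LinearMap.range (fderiv ℝ h' x₀ : Eucl n →ₗ[ℝ] F × W × C) = ⊤ := by
    refine LinearMap.range_eq_top.2 fun ⟨a, b, c⟩ => ?_
    obtain ⟨v₁, hv₁⟩ := LinearMap.range_eq_top.1 (hV₀ x₀ hxV₀).1.2.1 a
    obtain ⟨v₂, hv₂, hv₂b⟩ := hwsurj x₀ hxV₀ (b - fderiv ℝ w x₀ v₁)
    obtain ⟨v₃, ⟨hv₃, hv₃w⟩, hv₃c⟩ : ((c - prC (fderiv ℝ θ x₀ (v₁ + v₂)) : C) : Eucl n) ∈ C :=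
      Subtype.prop _
    refine ⟨v₁ + v₂ + v₃, ?_⟩
    have e1 : fderiv ℝ h x₀ v₁ = a := hv₁
    have e2 := (hker x₀ hxV₀ _).1 hv₂
    have e3 := (hker x₀ hxV₀ _).1 hv₃
    have e4 : fderiv ℝ w x₀ v₃ = 0 := hv₃w
    have e5 : fderiv ℝ θ x₀ v₃ = ((c - prC (fderiv ℝ θ x₀ (v₁ + v₂)) : C) : Eucl n) := hv₃c
    change fderiv ℝ h' x₀ _ = _
    rw [hh'k.self_of_nhds.2, map_add _ (v₁ + v₂) v₃, map_add _ (v₁ + v₂) v₃,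
      map_add _ (v₁ + v₂) v₃, e3, e4, e5, map_add prC, hprC, map_add _ v₁, e1, e2,
      map_add (fderiv ℝ w x₀) v₁, hv₂b]
    simp
  have hker₀ : LinearMap.ker (fderiv ℝ h' x₀ : Eucl n →ₗ[ℝ] F × W × C) = Δm x₀ := by
    ext v
    rw [LinearMap.mem_ker, ContinuousLinearMap.coe_coe, hh'k.self_of_nhds.2, Prod.mk_eq_zero,
      Prod.mk_eq_zero, ← hθ.self_of_nhds.2]
    constructor
    · rintro ⟨h1, h2, h3⟩
      have h4 : fderiv ℝ θ x₀ v ∈ C := ⟨v, ⟨(hker x₀ hxV₀ v).2 h1, h2⟩, rfl⟩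
      have h5 := hprC ⟨_, h4⟩
      exact (congrArg Subtype.val (h5.symm.trans h3) :)
    · intro h1
      have h2 : v ∈ Δm x₀ := hθ.self_of_nhds.2 ▸ h1
      have h3 : fderiv ℝ θ x₀ v = 0 := h1
      exact ⟨(hker x₀ hxV₀ v).1 (hle x₀ hx₀ h2), hw0 x₀ hxV₀ v h2, by rw [h3, map_zero]⟩
  -- The kernel is computed at `x₀` only. Nearby, `dh'` is still onto and its kernel still contains
  -- `Δm`; constant rank and this count give equality.
  have hdim : Module.finrank ℝ (F × W × C) + r = n := by
    have := LinearMap.finrank_range_add_finrank_ker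
      (fderiv ℝ h' x₀ : Eucl n →ₗ[ℝ] F × W × C)
    rwa [hsurj₀, hker₀, hr x₀ hx₀, finrank_top, finrank_euclideanSpace_fin] at this
  have hsurj : ∀ᶠ x in 𝓝 x₀, LinearMap.range (fderiv ℝ h' x : Eucl n →ₗ[ℝ] F × W × C) = ⊤ := by
    have hc : ContinuousAt (fderiv ℝ h') x₀ := (hh'k.self_of_nhds.1.fderiv_right (m := 0)
      (by simpa using one_le_smoothness hk)).continuousAt
    exact hc.eventually (eventually_range_eq_top hsurj₀)
  refine ⟨F × W × C, inferInstance, inferInstance, inferInstance, h', prolong A W C,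
    Submodule.prod ⊥ ⊤, ?_, prolong_controllable A W C hctr⟩
  filter_upwards [hh'k, hsurj, hθ, hV₀o.mem_nhds hxV₀] with x ⟨h1, h2⟩ h3 h4 h5
  have hxX := (hV₀ x h5).2
  refine ⟨h1, h3, ?_, ?_, ?_⟩
  · symm
    refine Submodule.eq_of_le_of_finrank_eq (fun v hv => ?_) ?_
    · have e1 : fderiv ℝ θ x v = 0 := by
        rw [← h4.2] at hv; exact hv
      rw [LinearMap.mem_ker, ContinuousLinearMap.coe_coe, h2, e1, hw0 x h5 v hv,
        (hker x h5 v).1 (hle x hxX hv), map_zero]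
      rfl
    · have := LinearMap.finrank_range_add_finrank_ker
        (fderiv ℝ h' x : Eucl n →ₗ[ℝ] F × W × C)
      rw [h3, finrank_top, finrank_euclideanSpace_fin] at this
      rw [hr x hxX]
      omega
  · rw [h2]
    simp [h', prolong_apply, hwval x h5]
  · apply le_antisymm
    · rintro _ ⟨v, hv, rfl⟩
      rw [ContinuousLinearMap.coe_coe, h2]
      exact ⟨(hker x h5 v).1 hv, trivial⟩
    · rintro ⟨a, b⟩ ⟨ha, -⟩
      obtain rfl : a = 0 := ha
      obtain ⟨v, hv⟩ := LinearMap.range_eq_top.1 h3 (0, b)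
      refine ⟨v, (hker x h5 v).2 ?_, hv⟩
      rw [ContinuousLinearMap.coe_coe, h2] at hv
      exact congrArg Prod.fst hv

/-- The bracket of `f` with a section is itself a section of the enlarged distribution, because `Cᵏ`
fields are closed under brackets. -/
lemma HasSections.addBracket (hk : k = ∞ ∨ k = ω) (hX : IsOpen X) {f : Eucl n → Eucl n}
    (hf : ContDiffOn ℝ k f X) (h : HasSections k X Δ) :
    HasSections k X (addBracket k X f Δ) := by
  refine HasSections.of_le_span hX fun x hx => sup_le (fun v hv => ?_) (Submodule.span_mono ?_)
  · obtain ⟨V, g, hg, hxV, rfl⟩ := h x hx v hv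
    exact Submodule.subset_span ⟨V, g, ⟨hg.isOpen, hg.subset, hg.contDiffOn,
      fun y hy => le_sup_left (α := Submodule ℝ (Eucl n)) (hg.mem y hy)⟩, hxV, rfl⟩
  · rintro _ ⟨V, g, hg, hxV, rfl⟩
    refine ⟨V, VectorField.lieBracket ℝ f g, ⟨hg.isOpen, hg.subset, fun y hy => ?_, fun y hy => ?_⟩,
      hxV, rfl⟩
    · exact ((hf.contDiffAt (hX.mem_nhds (hg.subset hy))).lieBracket_vectorField
        (hg.contDiffAt hy) (smoothness_add_one_le hk)).contDiffWithinAt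
    · exact le_sup_right (α := Submodule ℝ (Eucl n)) (Submodule.subset_span ⟨V, g, hg, hy, rfl⟩)

/-- An integrable controllable flag yields linearizing coordinates modulo `Δ₀`. -/
theorem hasLinearQuotient_bot (hk : k = ∞ ∨ k = ω) (hX : IsOpen X) {x₀ : Eucl n} (hx₀ : x₀ ∈ X)
    {f : Eucl n → Eucl n} (hf : ContDiffOn ℝ k f X) {Δ₀ : Distribution n}
    (hsec : HasSections k X Δ₀) {N : ℕ} (hint : ∀ j < N, Integrable k X (flag k X f Δ₀ j))
    (htop : ∀ x ∈ X, flag k X f Δ₀ N x = ⊤) :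
    HasLinearQuotient k f (fun _ => ⊥) Δ₀ x₀ := by
  have hsecs : ∀ j, HasSections k X (flag k X f Δ₀ j) := by
    intro j
    induction j with
    | zero => exact hsec
    | succ j ih => exact ih.addBracket hk hX hf
  -- Descending induction on `j`, run as induction on `i = N - j`.
  have hstep : ∀ i j, i + j = N →
      HasLinearQuotient k f (flag k X f Δ₀ j) (flag k X f Δ₀ (j + 1)) x₀ := by
    intro i
    induction i with
    | zero =>
      intro j hj
      obtain rfl : j = N := by omega
      exact .of_eq_top (by filter_upwards [hX.mem_nhds hx₀] with x hx using htop x hx)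
    | succ i ih =>
      intro j hj
      obtain ⟨θ, hθ⟩ := exists_ker_fderiv_eq hk hX (hsecs j) (hint j (by omega)) hx₀
      obtain ⟨r, hr⟩ := (hint j (by omega)).1
      exact (ih (j + 1) (by omega)).step hk hX hx₀ hf (fun x _ => le_sup_left) hr (hsecs j)
        (fun V g hg x hx => le_sup_right (α := Submodule ℝ (Eucl n))
          (Submodule.subset_span ⟨V, g, hg, hx, rfl⟩)) (fun x _ => le_rfl) hθ
  -- One more step takes the zero distribution as `Δm`, with the identity as its first integral.
  refine (hstep N 0 rfl).step (r := 0) (θ := id) hk hX hx₀ hf (fun x _ => bot_le) (by simp) ?_ ?_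
    (fun x _ => le_rfl) ?_
  · rintro x hx v rfl
    exact ⟨X, fun _ => 0, ⟨hX, Subset.rfl, contDiffOn_const, fun y _ => rfl⟩, hx, rfl⟩
  · intro V g hg x hx
    have h0 : g =ᶠ[𝓝 x] fun _ => 0 := by
      filter_upwards [hg.isOpen.mem_nhds hx] with y hy using hg.mem y hy
    have : VectorField.lieBracket ℝ f g x = 0 := by
      rw [VectorField.lieBracket, h0.fderiv_eq, h0.self_of_nhds]
      simp
    rw [this]
    exact Submodule.zero_mem _
  · exact Eventually.of_forall fun x => ⟨contDiffAt_id, by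
      rw [fderiv_id]
      exact LinearMap.ker_id⟩

end LinearQuotient

/-! ### Limit directions and the constant rank theorem -/

section Directions

variable {n m : ℕ} {k : WithTop ℕ∞}

lemma eq_of_fderiv_eq_zero_on_ball {E G : Type} [NormedAddCommGroup E] [NormedSpace ℝ E]
    [NormedAddCommGroup G] [NormedSpace ℝ G] {f : E → G} {f' : E → E →L[ℝ] G} {c : E} {δ : ℝ}
    (hf : ∀ z ∈ Metric.ball c δ, HasFDerivAt f (f' z) z)
    (hf' : ∀ z ∈ Metric.ball c δ, ∀ v, f' z v = 0) {x y : E}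
    (hx : x ∈ Metric.ball c δ) (hy : y ∈ Metric.ball c δ) : f x = f y := by
  have h := Convex.norm_image_sub_le_of_norm_hasFDerivWithin_le (C := 0)
    (fun z hz => (hf z hz).hasFDerivWithinAt)
    (fun z hz => by rw [ContinuousLinearMap.ext (g := 0) (hf' z hz), norm_zero])
    (convex_ball c δ) hy hx
  rw [zero_mul] at h
  exact sub_eq_zero.1 (norm_le_zero_iff.1 h)

/-- Approach `u` along `u + v/c`: the normalised differences converge to the direction of `∂f/∂u ·
v` when this vector is nonzero. No assumption on the rank enters. -/
lemma range_le_dirSpace {f : Eucl n × Eucl m → Eucl n} {U : Set (Eucl m)} (hU : IsOpen U)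
    {x : Eucl n} {u : Eucl m} (hu : u ∈ U) (hf : DifferentiableAt ℝ (fun w => f (x, w)) u) :
    LinearMap.range (partialU f x u : Eucl m →ₗ[ℝ] Eucl n) ≤ dirSpace f U x u := by
  rintro _ ⟨v, rfl⟩
  change partialU f x u v ∈ _
  by_cases hv : partialU f x u v = 0
  · rw [hv]; exact Submodule.zero_mem _
  let w : ℝ → Eucl m := fun c => u + c⁻¹ • v
  have hw : Tendsto w atTop (𝓝 u) := by
    simpa using ((tendsto_inv_atTop_zero (𝕜 := ℝ)).smul_const v).const_add u
  have hlim : Tendsto (fun c => c • (f (x, w c) - f (x, u))) atTop (𝓝 (partialU f x u v)) :=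
    hf.hasFDerivAt.lim_real v
  have hdir : Tendsto (fun c => ‖f (x, w c) - f (x, u)‖⁻¹ • (f (x, w c) - f (x, u))) atTop
      (𝓝 (‖partialU f x u v‖⁻¹ • partialU f x u v)) := by
    refine ((hlim.norm.inv₀ (norm_ne_zero_iff.2 hv)).smul hlim).congr' ?_
    filter_upwards [eventually_gt_atTop 0] with c hc
    rw [norm_smul, Real.norm_of_nonneg hc.le, smul_smul, mul_inv, mul_right_comm,
      inv_mul_cancel₀ hc.ne', one_mul]
  have hev : ∀ᶠ c in atTop, w c ∈ U ∧ f (x, w c) ≠ f (x, u) := by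
    filter_upwards [hw.eventually (hU.mem_nhds hu), hlim.eventually_ne hv] with c h1 h2
    refine ⟨h1, fun h => h2 ?_⟩
    rw [h, sub_self, smul_zero]
  obtain ⟨N, hN⟩ := eventually_atTop.1 hev
  have hseq : Tendsto (fun j : ℕ => N + (j : ℝ)) atTop atTop :=
    tendsto_atTop_add_const_left _ _ tendsto_natCast_atTop_atTop
  have hmem : ‖partialU f x u v‖⁻¹ • partialU f x u v ∈ dirSpace f U x u :=
    Submodule.subset_span ⟨fun j => w (N + j), fun j => (hN _ (by simp)).1, hw.comp hseq,
      fun j => (hN _ (by simp)).2, hdir.comp hseq⟩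
  have := (dirSpace f U x u).smul_mem ‖partialU f x u v‖ hmem
  rwa [smul_smul, mul_inv_cancel₀ (norm_ne_zero_iff.2 hv), one_smul] at this

/-- A smooth map of constant rank factors locally, with first-order accuracy at the base point:
`g w = h (q w)` where `q` is a projection of `g`, and `h` has derivative in the range of `Dg`. -/
lemma exists_factor_of_constant_rank (hk : k = ∞ ∨ k = ω) {g : Eucl m → Eucl n} {u : Eucl m}
    {r : ℕ} (hg : ∀ᶠ w in 𝓝 u, ContDiffAt ℝ k g w)
    (hr : ∀ᶠ w in 𝓝 u, Module.finrank ℝ (LinearMap.range (fderiv ℝ g w : Eucl m →ₗ[ℝ] Eucl n)) = r) :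
    ∃ (R : Submodule ℝ (Eucl n)) (π : Eucl n →L[ℝ] R) (h : R → Eucl n) (h' : R →L[ℝ] Eucl n),
      HasFDerivAt h h' (π (g u)) ∧ (∀ a, h' a ∈ LinearMap.range (fderiv ℝ g u : Eucl m →ₗ[ℝ] Eucl n)) ∧
      ∀ᶠ w in 𝓝 u, g w = h (π (g w)) := by
  have hk0 := smoothness_ne_zero hk
  let L := fderiv ℝ g u
  let R : Submodule ℝ (Eucl n) := LinearMap.range (L : Eucl m →ₗ[ℝ] Eucl n)
  let K : Submodule ℝ (Eucl m) := LinearMap.ker (L : Eucl m →ₗ[ℝ] Eucl n)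
  obtain ⟨π, hπ⟩ := Submodule.ClosedComplemented.of_finiteDimensional R
  obtain ⟨κ, hκ⟩ := Submodule.ClosedComplemented.of_finiteDimensional K
  -- The rank theorem chart: `π ∘ g` as coordinates on the image side, completed by the kernel of
  -- `Dg(u)`.
  let Ψf : Eucl m → R × K := fun w => (π (g w), κ w)
  have hΨk : ∀ᶠ w in 𝓝 u, ContDiffAt ℝ k Ψf w := by
    filter_upwards [hg] with w hw
    exact (π.contDiff.contDiffAt.comp w hw).prodMk κ.contDiff.contDiffAt
  have hΨd : ∀ᶠ w in 𝓝 u, HasFDerivAt Ψf ((π ∘L fderiv ℝ g w).prod κ) w := by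
    filter_upwards [hg] with w hw
    exact (π.hasFDerivAt.comp w (hw.differentiableAt hk0).hasFDerivAt).prodMk κ.hasFDerivAt
  have hLR : ∀ v, L v ∈ R := fun v => ⟨v, rfl⟩
  have hπL : ∀ v, (π (L v) : Eucl n) = L v := fun v => congrArg Subtype.val (hπ ⟨L v, hLR v⟩)
  have hsurjπ : LinearMap.range ((π ∘L L : Eucl m →L[ℝ] R) : Eucl m →ₗ[ℝ] R) = ⊤ := by
    refine LinearMap.range_eq_top.2 fun ⟨_, v, rfl⟩ => ⟨v, Subtype.ext (hπL v)⟩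
  have hinv : (fderiv ℝ Ψf u).IsInvertible := by
    rw [hΨd.self_of_nhds.fderiv]
    have hinj : Function.Injective ((π ∘L L).prod κ) := by
      rw [injective_iff_map_eq_zero]
      intro v hv
      have h1 : π (L v) = 0 := congrArg Prod.fst hv
      have h2 : κ v = 0 := congrArg Prod.snd hv
      have h3 : L v = 0 := by rw [← hπL, h1]; rfl
      have h4 := hκ ⟨v, h3⟩
      exact (congrArg Subtype.val (h4.symm.trans h2) :)
    have hfin : Module.finrank ℝ (Eucl m) = Module.finrank ℝ (R × K) := by
      rw [Module.finrank_prod]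
      exact (LinearMap.finrank_range_add_finrank_ker (L : Eucl m →ₗ[ℝ] Eucl n)).symm
    let e := LinearEquiv.ofInjectiveOfFinrankEq
      (((π ∘L L).prod κ : Eucl m →L[ℝ] R × K) : Eucl m →ₗ[ℝ] R × K) hinj hfin
    exact ⟨e.toContinuousLinearEquiv, by ext v <;> rfl⟩
  obtain ⟨Ψ, hΨ, hu, hsrc, htgt⟩ := exists_openPartialHomeomorph hk hΨk hinv
  have hgood : ∀ᶠ w in 𝓝 u, ContDiffAt ℝ k g w ∧
      HasFDerivAt Ψf ((π ∘L fderiv ℝ g w).prod κ) w ∧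
      ∀ t, π (fderiv ℝ g w t) = 0 → fderiv ℝ g w t = 0 := by
    have hc : ContinuousAt (fun w => π ∘L fderiv ℝ g w) u := by
      have h1 : ContinuousAt (fderiv ℝ g) u := (hg.self_of_nhds.fderiv_right (m := 0)
        (by simpa using one_le_smoothness hk)).continuousAt
      exact continuousAt_const.clm_comp h1
    filter_upwards [hg, hΨd, hr, hc.eventually (eventually_range_eq_top hsurjπ)] with w h1 h2 h3 h4
    refine ⟨h1, h2, ?_⟩
    -- `π` maps the range of `Dg(w)` onto `R`. The ranks agree, so it is injective there, and `π
    -- Dg(w) t = 0` forces `Dg(w) t = 0`.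
    let πw : LinearMap.range (fderiv ℝ g w : Eucl m →ₗ[ℝ] Eucl n) →ₗ[ℝ] R :=
      (π : Eucl n →ₗ[ℝ] R).domRestrict _
    have hsurj : Function.Surjective πw := by
      intro y
      obtain ⟨t, ht⟩ := LinearMap.range_eq_top.1 h4 y
      exact ⟨⟨fderiv ℝ g w t, t, rfl⟩, ht⟩
    have hinj : Function.Injective πw :=
      (LinearMap.injective_iff_surjective_of_finrank_eq_finrank
        (h3.trans hr.self_of_nhds.symm)).2 hsurj
    intro t ht
    have := @hinj ⟨fderiv ℝ g w t, t, rfl⟩ 0 (by rw [map_zero]; exact ht)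
    exact congrArg Subtype.val this
  have hΨu : Ψ u = (π (g u), κ u) := by rw [hΨ]
  have hut : (π (g u), κ u) ∈ Ψ.target := by rw [← hΨu]; exact Ψ.map_source hu
  have hsu : Ψ.symm (π (g u), κ u) = u := by rw [← hΨu, Ψ.left_inv hu]
  have hgood' : ∀ᶠ z in 𝓝 (π (g u), κ u), z ∈ Ψ.target ∧ ContDiffAt ℝ k g (Ψ.symm z) ∧
      HasFDerivAt Ψf ((π ∘L fderiv ℝ g (Ψ.symm z)).prod κ) (Ψ.symm z) ∧
      ∀ t, π (fderiv ℝ g (Ψ.symm z) t) = 0 → fderiv ℝ g (Ψ.symm z) t = 0 := by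
    have hc := Ψ.continuousAt_symm hut
    rw [ContinuousAt, hsu] at hc
    filter_upwards [Ψ.open_target.mem_nhds hut, hc.eventually hgood] with z h1 h2 using ⟨h1, h2⟩
  obtain ⟨δ, hδ, hball⟩ := Metric.eventually_nhds_iff_ball.1 hgood'
  let H : R × K → Eucl n := fun z => g (Ψ.symm z)
  have hHd : ∀ z ∈ Metric.ball (π (g u), κ u) δ,
      HasFDerivAt H (fderiv ℝ g (Ψ.symm z) ∘L fderiv ℝ Ψ.symm z) z := fun z hz =>
    ((hball z hz).2.1.differentiableAt hk0).hasFDerivAt.comp z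
      ((htgt z (hball z hz).1).differentiableAt hk0).hasFDerivAt
  -- Moving the `K`-coordinate alone keeps `π ∘ g` fixed, hence by the previous remark keeps `g`
  -- fixed to first order; so `H` depends on the first coordinate only.
  have hH0 : ∀ z ∈ Metric.ball (π (g u), κ u) δ, ∀ b : K,
      fderiv ℝ g (Ψ.symm z) (fderiv ℝ Ψ.symm z (0, b)) = 0 := by
    intro z hz b
    obtain ⟨h1, h2, h3, h4⟩ := hball z hz
    refine h4 _ ?_
    have h5 := h3.comp z ((htgt z h1).differentiableAt hk0).hasFDerivAt
    have h6 : (Ψf ∘ Ψ.symm) =ᶠ[𝓝 z] id := by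
      filter_upwards [Ψ.open_target.mem_nhds h1] with y hy
      rw [← hΨ]; exact Ψ.right_inv hy
    have h7 := DFunLike.congr_fun (h5.unique ((hasFDerivAt_id z).congr_of_eventuallyEq h6)) (0, b)
    exact congrArg Prod.fst h7
  have hHconst : ∀ a b, (a, b) ∈ Metric.ball (π (g u), κ u) δ → H (a, b) = H (a, κ u) := by
    intro a b hab
    have hab' : a ∈ Metric.ball (π (g u)) δ ∧ b ∈ Metric.ball (κ u) δ := by
      rwa [← ball_prod_same, mem_prod] at hab
    have hin : ∀ b' ∈ Metric.ball (κ u) δ, (a, b') ∈ Metric.ball (π (g u), κ u) δ := by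
      intro b' hb'
      rw [← ball_prod_same]
      exact ⟨hab'.1, hb'⟩
    exact eq_of_fderiv_eq_zero_on_ball (f := fun b' => H (a, b'))
      (f' := fun b' => (fderiv ℝ g (Ψ.symm (a, b')) ∘L fderiv ℝ Ψ.symm (a, b')) ∘L .inr ℝ R K)
      (fun b' hb' => HasFDerivAt.comp (g := H) b' (hHd _ (hin b' hb'))
        (hasFDerivAt_prodMk_right (𝕜 := ℝ) a b'))
      (fun b' hb' c => hH0 _ (hin b' hb') c) hab'.2 (Metric.mem_ball_self hδ)
  have hh : HasFDerivAt (fun a => H (a, κ u)) _ (π (g u)) :=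
    HasFDerivAt.comp (g := H) (π (g u)) (hHd _ (Metric.mem_ball_self hδ))
      (hasFDerivAt_prodMk_left (𝕜 := ℝ) (π (g u)) (κ u))
  refine ⟨R, π, fun a => H (a, κ u), _, hh, fun a => ?_, ?_⟩
  · rw [hsu]
    exact ⟨_, rfl⟩
  · have hc : Tendsto Ψf (𝓝 u) (𝓝 (π (g u), κ u)) := hΨk.self_of_nhds.continuousAt
    filter_upwards [Ψ.open_source.mem_nhds hu, hc.eventually (Metric.ball_mem_nhds _ hδ)]
      with w hw hwb
    have h1 : g (Ψ.symm (Ψf w)) = g w := by rw [← hΨ, Ψ.left_inv hw]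
    exact h1.symm.trans (hHconst _ _ hwb)

/-- Where `∂f/∂u` has constant rank, the limit directions span its range. -/
theorem dirSpace_eq_range (hk : k = ∞ ∨ k = ω) {f : Eucl n × Eucl m → Eucl n} {U : Set (Eucl m)}
    (hU : IsOpen U) {x : Eucl n} {u : Eucl m} (hu : u ∈ U)
    (hf : ∀ w ∈ U, ContDiffAt ℝ k (fun w => f (x, w)) w) {r : ℕ}
    (hr : ∀ w ∈ U, Module.finrank ℝ (LinearMap.range (partialU f x w : Eucl m →ₗ[ℝ] Eucl n)) = r) :
    dirSpace f U x u = LinearMap.range (partialU f x u : Eucl m →ₗ[ℝ] Eucl n) := by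
  refine le_antisymm (Submodule.span_le.2 ?_) (range_le_dirSpace hU hu
    ((hf u hu).differentiableAt (smoothness_ne_zero hk)))
  rintro y ⟨w, -, hwu, hne, hlim⟩
  obtain ⟨R, π, h, h', hh, hmem, hfac⟩ := exists_factor_of_constant_rank (g := fun w => f (x, w))
    (u := u) (r := r) hk (by filter_upwards [hU.mem_nhds hu] with w hw using hf w hw)
    (by filter_upwards [hU.mem_nhds hu] with w hw using hr w hw)
  let d : ℕ → Eucl n := fun j => f (x, w j) - f (x, u)
  have hcont : Tendsto (fun j => f (x, w j)) atTop (𝓝 (f (x, u))) :=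
    ((hf u hu).continuousAt.tendsto.comp hwu :)
  have ha : Tendsto (fun j => π (f (x, w j))) atTop (𝓝 (π (f (x, u)))) :=
    (π.continuous.tendsto _).comp hcont
  -- By the factorisation the differences agree with vectors of the range of `∂f/∂u` up to `o(‖d
  -- j‖)`. After normalisation the limit lies in that range, which is closed.
  have hsmall : (fun j => d j - h' (π (d j))) =o[atTop] d := by
    have h1 := (hasFDerivAt_iff_isLittleO.1 hh).comp_tendsto ha
    have h2 : (fun j => d j - h' (π (d j))) =o[atTop] fun j => π (d j) := by
      refine h1.congr' ?_ ?_
      · filter_upwards [hwu.eventually hfac] with j hj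
        simp only [Function.comp_apply, d, map_sub]
        rw [← hj, ← hfac.self_of_nhds]
      · exact Eventually.of_forall fun j => by simp [d]
    exact h2.trans_isBigO (π.isBigO_comp _ _)
  have hzero : Tendsto (fun j => ‖d j‖⁻¹ • d j - ‖d j‖⁻¹ • h' (π (d j))) atTop (𝓝 0) := by
    rw [tendsto_zero_iff_norm_tendsto_zero]
    have := hsmall.norm_right.tendsto_inv_smul_nhds_zero
    rw [tendsto_zero_iff_norm_tendsto_zero] at this
    refine this.congr fun j => ?_
    rw [← smul_sub]
  have hlim' : Tendsto (fun j => ‖d j‖⁻¹ • h' (π (d j))) atTop (𝓝 y) := by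
    refine (sub_zero y ▸ hlim.sub hzero).congr fun j => ?_
    exact sub_sub_cancel _ _
  have hclosed : IsClosed
      (LinearMap.range (partialU f x u : Eucl m →ₗ[ℝ] Eucl n) : Set (Eucl n)) :=
    Submodule.closed_of_finiteDimensional _
  exact hclosed.mem_of_tendsto hlim' (Eventually.of_forall fun j =>
    Submodule.smul_mem _ _ (hmem _))

lemma hasFDerivAt_partialU (hk : k = ∞ ∨ k = ω) {f : Eucl n × Eucl m → Eucl n} {x : Eucl n}
    {u : Eucl m} (hf : ContDiffAt ℝ k f (x, u)) :
    HasFDerivAt (fun w => f (x, w)) (partialU f x u) u ∧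
      partialU f x u = fderiv ℝ f (x, u) ∘L .inr ℝ (Eucl n) (Eucl m) := by
  have h1 : HasFDerivAt (fun w => f (x, w)) (fderiv ℝ f (x, u) ∘L .inr ℝ (Eucl n) (Eucl m)) u :=
    (hf.differentiableAt (smoothness_ne_zero hk)).hasFDerivAt.comp u
      (hasFDerivAt_prodMk_right (𝕜 := ℝ) x u)
  have h2 : partialU f x u = _ := h1.fderiv
  exact ⟨h2 ▸ h1, h2⟩

/-- The values of `f(x,·)` on a ball differ by elements of a subspace that contains the ranges of
the partial derivatives. -/
lemma sub_mem_of_range_le {g : Eucl m → Eucl n} {D : Submodule ℝ (Eucl n)} {u : Eucl m} {ε : ℝ}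
    (hε : 0 < ε) (hg : ∀ w ∈ Metric.ball u ε, DifferentiableAt ℝ g w)
    (hD : ∀ w ∈ Metric.ball u ε, ∀ v, fderiv ℝ g w v ∈ D) {w : Eucl m}
    (hw : w ∈ Metric.ball u ε) : g w - g u ∈ D := by
  obtain ⟨π, hπ⟩ := Submodule.ClosedComplemented.of_finiteDimensional D
  -- `ρ` has kernel `D`, so `ρ ∘ g` has zero derivative on the ball and is constant.
  let ρ : Eucl n →L[ℝ] Eucl n := ContinuousLinearMap.id ℝ _ - D.subtypeL ∘L π
  have hρ : ∀ d ∈ D, ρ d = 0 := fun d hd => by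
    simp [ρ, hπ ⟨d, hd⟩]
  have h1 : ρ (g w) = ρ (g u) := eq_of_fderiv_eq_zero_on_ball (f := fun w => ρ (g w))
    (fun z hz => ρ.hasFDerivAt.comp z (hg z hz).hasFDerivAt) (fun z hz v => hρ _ (hD z hz v)) hw
    (Metric.mem_ball_self hε)
  rw [← sub_eq_zero, ← map_sub] at h1
  have h2 : g w - g u = π (g w - g u) := sub_eq_zero.1 h1
  rw [h2]
  exact Subtype.prop _

end Directions

/-! ### Transport of solutions by a change of coordinates -/

section Transport

variable {n m : ℕ}

lemma aemeasurable_comp_of_continuousOn {α G : Type} [MeasurableSpace α] [TopologicalSpace α]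
    [BorelSpace α] [NormedAddCommGroup G] [MeasurableSpace G] [BorelSpace G] {Ω : Set α}
    (hΩ : IsOpen Ω) {F : α → G} (hF : ContinuousOn F Ω) {I : Set ℝ} (hI : MeasurableSet I)
    {γ : ℝ → α} (hγ : AEMeasurable γ (volume.restrict I)) (hmem : ∀ t ∈ I, γ t ∈ Ω) {δ : ℝ → G}
    (hδ : ∀ t ∈ I, δ t = F (γ t)) : AEMeasurable δ (volume.restrict I) := by
  classical
  have h1 : Measurable (Ω.piecewise F fun _ => 0) :=
    hF.measurable_piecewise continuousOn_const hΩ.measurableSet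
  refine (h1.comp_aemeasurable hγ).congr ?_
  filter_upwards [ae_restrict_mem hI] with t ht
  rw [Function.comp_apply, piecewise_eq_of_mem _ _ _ (hmem t ht), hδ t ht]

lemma lipschitzOnWith_of_sub_eq_integral {E : Type} [NormedAddCommGroup E] [NormedSpace ℝ E]
    {x v : ℝ → E} {a b : ℝ} {M : NNReal}
    (hx : ∀ s ∈ Icc a b, ∀ t ∈ Icc a b, s ≤ t → x t - x s = ∫ τ in s..t, v τ)
    (hv : ∀ t ∈ Icc a b, ‖v t‖ ≤ M) : LipschitzOnWith M x (Icc a b) := by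
  have key : ∀ s ∈ Icc a b, ∀ t ∈ Icc a b, s ≤ t → dist (x s) (x t) ≤ M * dist s t := by
    intro s hs t ht hst
    rw [dist_comm, dist_eq_norm, hx s hs t ht hst, dist_comm s t, Real.dist_eq]
    refine intervalIntegral.norm_integral_le_of_norm_le_const fun τ hτ => hv τ ?_
    rw [uIoc_of_le hst] at hτ
    exact ⟨hs.1.trans hτ.1.le, hτ.2.trans ht.2⟩
  refine LipschitzOnWith.of_dist_le_mul fun s hs t ht => ?_
  rcases le_total s t with hst | hst
  · exact key s hs t ht hst
  · rw [dist_comm, dist_comm s t]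
    exact key t ht s hs hst

/-- A Lipschitz change of state coordinates together with a feedback maps solutions to
solutions. -/
theorem IsSolution.map {f g : Eucl n × Eucl m → Eucl n} {Ω₁ Ω₂ : Set (Eucl n × Eucl m)}
    {χ : Eucl n × Eucl m → Eucl n × Eucl m} {φ : Eucl n → Eucl n}
    {φ' : Eucl n → Eucl n →L[ℝ] Eucl n} {K Mf Mg : NNReal} (hΩ₁ : IsOpen Ω₁)
    (hmaps : MapsTo χ Ω₁ Ω₂) (hχ : ContinuousOn χ Ω₁) (hfst : ∀ p ∈ Ω₁, (χ p).1 = φ p.1)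
    (hlip : LipschitzOnWith K φ (Prod.fst '' Ω₁)) (hφ : ∀ p ∈ Ω₁, HasFDerivAt φ (φ' p.1) p.1)
    (hfg : ∀ p ∈ Ω₁, φ' p.1 (f p) = g (χ p)) (hΩ₂ : Bornology.IsBounded Ω₂)
    (hf : ∀ p ∈ Ω₁, ‖f p‖ ≤ Mf) (hg : ∀ p ∈ Ω₂, ‖g p‖ ≤ Mg) (hgc : ContinuousOn g Ω₂)
    {I : Set ℝ} (hI : I.OrdConnected) {γ δ : ℝ → Eucl n × Eucl m} (hγ : IsSolution f Ω₁ I γ)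
    (hδ : ∀ t ∈ I, δ t = χ (γ t)) : IsSolution g Ω₂ I δ := by
  have hIm : MeasurableSet I := hI.measurableSet
  have hmem : ∀ t ∈ I, δ t ∈ Ω₂ := fun t ht => hδ t ht ▸ hmaps (hγ.mem t ht)
  have hxlip : ∀ T₁ T₂, Icc T₁ T₂ ⊆ I →
      LipschitzOnWith Mf (fun t => (γ t).1) (Icc T₁ T₂) := fun T₁ T₂ hT =>
    lipschitzOnWith_of_sub_eq_integral (v := fun t => f (γ t)) (fun s hs t ht hst =>
      hγ.integral_eq s t hst ((Icc_subset_Icc hs.1 ht.2).trans hT)) fun t ht => hf _ (hγ.mem t (hT ht))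
  have hzlip : ∀ T₁ T₂, Icc T₁ T₂ ⊆ I →
      LipschitzOnWith (K * Mf) (fun t => (δ t).1) (Icc T₁ T₂) := fun T₁ T₂ hT => by
    have h1 : LipschitzOnWith (K * Mf) (φ ∘ fun t => (γ t).1) (Icc T₁ T₂) :=
      hlip.comp (hxlip T₁ T₂ hT) fun t ht => ⟨_, hγ.mem t (hT ht), rfl⟩
    intro s hs t ht
    have h2 := h1 hs ht
    simp only [Function.comp_apply] at h2
    rwa [← hfst _ (hγ.mem s (hT hs)), ← hfst _ (hγ.mem t (hT ht)), ← hδ s (hT hs),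
      ← hδ t (hT ht)] at h2
  have hint : ∀ T₁ T₂, T₁ ≤ T₂ → Icc T₁ T₂ ⊆ I →
      IntervalIntegrable (fun t => g (δ t)) volume T₁ T₂ := fun T₁ T₂ h12 hT => by
    have h1 : AEMeasurable (fun t => g (δ t)) (volume.restrict I) :=
      aemeasurable_comp_of_continuousOn (F := fun p => g (χ p)) hΩ₁ (hgc.comp hχ hmaps) hIm
        hγ.measurable hγ.mem fun t ht => by rw [hδ t ht]
    rw [intervalIntegrable_iff_integrableOn_Icc_of_le h12]
    refine IntegrableOn.of_bound (by simp) (h1.mono_measure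
      (Measure.restrict_mono hT le_rfl)).aestronglyMeasurable Mg ?_
    filter_upwards [ae_restrict_mem measurableSet_Icc] with t ht using hg _ (hmem t (hT ht))
  refine ⟨hmem, ?_, fun t _ => ⟨I, self_mem_nhdsWithin, hΩ₂.subset ?_⟩, ?_, hint, ?_⟩
  · exact aemeasurable_comp_of_continuousOn hΩ₁ hχ hIm hγ.measurable hγ.mem hδ
  · rintro _ ⟨t, ht, rfl⟩
    exact hmem t ht
  · intro T₁ T₂ h12 hT
    have h1 := hzlip T₁ T₂ hT
    rw [← uIcc_of_le h12] at h1
    exact h1.absolutelyContinuousOnInterval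
  · intro T₁ T₂ h12 hT
    have hv := hint T₁ T₂ h12 hT
    have hsub : ∀ s ∈ Icc T₁ T₂, ∀ t ∈ Icc T₁ T₂, IntervalIntegrable (fun t => g (δ t)) volume s t :=
      fun s hs t ht => hv.mono_set (by rw [uIcc_of_le h12]; exact (ordConnected_Icc).uIcc_subset hs ht)
    have hplip : LipschitzOnWith Mg (fun t => ∫ s in T₁..t, g (δ s)) (Icc T₁ T₂) := by
      refine lipschitzOnWith_of_sub_eq_integral (v := fun t => g (δ t)) (fun s hs t ht hst => ?_)
        fun t ht => hg _ (hmem t (hT ht))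
      exact intervalIntegral.integral_interval_sub_left
        (hsub _ (left_mem_Icc.2 h12) _ ht) (hsub _ (left_mem_Icc.2 h12) _ hs)
    have hac1 : AbsolutelyContinuousOnInterval (fun t => (δ t).1) T₁ T₂ := by
      have h1 := hzlip T₁ T₂ hT
      rw [← uIcc_of_le h12] at h1
      exact h1.absolutelyContinuousOnInterval
    have hac2 : AbsolutelyContinuousOnInterval (fun t => ∫ s in T₁..t, g (δ s)) T₁ T₂ := by
      rw [← uIcc_of_le h12] at hplip
      exact hplip.absolutelyContinuousOnInterval
    -- At almost every time the integral equation can be differentiated and the chain rule applies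
    -- to `φ`. The difference to be shown constant is absolutely continuous with derivative zero
    -- almost everywhere.
    have hder : ∀ᵐ t, t ∈ uIcc T₁ T₂ →
        HasDerivAt (fun t => (δ t).1 - ∫ s in T₁..t, g (δ s)) 0 t := by
      -- Endpoints are discarded because the integral identity is known on `[T₁, T₂]` only, while
      -- the derivative is two-sided.
      have hne1 : ∀ᵐ t : ℝ, t ≠ T₁ := by simp [ae_iff, measure_singleton]
      have hne2 : ∀ᵐ t : ℝ, t ≠ T₂ := by simp [ae_iff, measure_singleton]
      filter_upwards [hv.ae_hasDerivAt_integral,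
        (hγ.intervalIntegrable T₁ T₂ h12 hT).ae_hasDerivAt_integral, hne1, hne2]
        with t h1 h2 h3 h4 ht
      have h5 := h1 ht T₁ left_mem_uIcc
      have h6 := h2 ht T₁ left_mem_uIcc
      rw [uIcc_of_le h12] at ht
      have hnhds : ∀ᶠ s in 𝓝 t, s ∈ Icc T₁ T₂ :=
        Icc_mem_nhds (lt_of_le_of_ne ht.1 h3.symm) (lt_of_le_of_ne ht.2 h4)
      have h7 : HasDerivAt (fun t => (γ t).1) (f (γ t)) t := by
        refine (h6.const_add (γ T₁).1).congr_of_eventuallyEq ?_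
        filter_upwards [hnhds] with s hs
        rw [← hγ.integral_eq T₁ s hs.1 ((Icc_subset_Icc_right hs.2).trans hT)]
        abel
      have htI := hT ht
      have h8 : HasDerivAt (fun t => (δ t).1) (g (δ t)) t := by
        have := (hφ _ (hγ.mem t htI)).comp_hasDerivAt t h7
        rw [hfg _ (hγ.mem t htI), ← hδ t htI] at this
        refine this.congr_of_eventuallyEq ?_
        filter_upwards [hnhds] with s hs
        rw [hδ s (hT hs), hfst _ (hγ.mem s (hT hs))]
        rfl
      have h9 := h8.sub h5
      rw [sub_self] at h9
      exact h9
    obtain ⟨C, hC⟩ := (hac1.sub hac2).const_of_ae_hasDerivAt_zero hder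
    have e1 := hC T₁ left_mem_uIcc
    have e2 := hC T₂ right_mem_uIcc
    simp only [Pi.sub_apply, intervalIntegral.integral_same, sub_zero] at e1 e2
    rw [e1, ← e2]
    abel

end Transport

/-! ### Kalman's criterion and invariant subspaces -/

section Kalman

variable {n m : ℕ}

lemma kalmanMatrix_mulVec (A : Matrix (Fin n) (Fin n) ℝ) (B : Matrix (Fin n) (Fin m) ℝ)
    (c : Fin n × Fin m → ℝ) :
    (kalmanMatrix A B).mulVec c = ∑ i : Fin n, (A ^ (i : ℕ) * B).mulVec fun j => c (i, j) := by
  funext l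
  simp [Matrix.mulVec, dotProduct, kalmanMatrix, Fintype.sum_prod_type]

/-- Cayley–Hamilton: `Aʲ` is a polynomial in `A` of degree below `n`. For `n = 0` the characteristic
polynomial is `1` and leaves no such degree, whence the separate case. -/
lemma mulVec_mem_range_kalmanMatrix (A : Matrix (Fin n) (Fin n) ℝ) (B : Matrix (Fin n) (Fin m) ℝ)
    (j : ℕ) (v : Fin m → ℝ) :
    (A ^ j * B).mulVec v ∈ LinearMap.range (kalmanMatrix A B).mulVecLin := by
  classical
  have hlt : ∀ i : Fin n, (A ^ (i : ℕ) * B).mulVec v ∈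
      LinearMap.range (kalmanMatrix A B).mulVecLin := by
    intro i
    refine ⟨fun q => if q.1 = i then v q.2 else 0, ?_⟩
    rw [Matrix.mulVecLin_apply, kalmanMatrix_mulVec, Finset.sum_eq_single i]
    · simp
    · intro l _ hl
      simp only [hl, if_false]
      exact Matrix.mulVec_zero _
    · simp
  rcases Nat.eq_zero_or_pos n with rfl | hn
  · have : (A ^ j * B).mulVec v = 0 := Subsingleton.elim _ _
    rw [this]
    exact Submodule.zero_mem _
  have hdeg : (Polynomial.X ^ j %ₘ A.charpoly).natDegree < n := by
    have h1 := Polynomial.natDegree_modByMonic_lt (Polynomial.X ^ j) A.charpoly_monic (by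
      intro h
      have := A.charpoly_natDegree_eq_dim
      rw [h] at this
      simp at this
      omega)
    rwa [A.charpoly_natDegree_eq_dim, Fintype.card_fin] at h1
  rw [Matrix.pow_eq_aeval_mod_charpoly A j, Polynomial.aeval_eq_sum_range' hdeg,
    Finset.sum_range, Matrix.sum_mul, Matrix.sum_mulVec]
  refine Submodule.sum_mem _ fun i _ => ?_
  rw [Matrix.smul_mul, Matrix.smul_mulVec]
  exact Submodule.smul_mem _ _ (hlt i)

/-- The column space of the Kalman matrix is itself `A`-invariant and contains the range of `B`. -/
lemma controllable_of_forall_invariant {A : Matrix (Fin n) (Fin n) ℝ}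
    {B : Matrix (Fin n) (Fin m) ℝ}
    (h : ∀ S : Submodule ℝ (Eucl n), LinearMap.range (Matrix.toEuclideanLin B) ≤ S →
      (∀ v ∈ S, Matrix.toEuclideanLin A v ∈ S) → S = ⊤) : Controllable A B := by
  let S₀ := LinearMap.range (kalmanMatrix A B).mulVecLin
  have h1 : Submodule.comap (WithLp.linearEquiv 2 ℝ (Fin n → ℝ)).toLinearMap S₀ = ⊤ := by
    refine h _ ?_ ?_
    · rintro _ ⟨v, rfl⟩
      have := mulVec_mem_range_kalmanMatrix A B 0 (WithLp.ofLp v)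
      rw [pow_zero, Matrix.one_mul] at this
      exact this
    · rintro v ⟨c, hc⟩
      rw [Matrix.mulVecLin_apply, kalmanMatrix_mulVec] at hc
      change A.mulVec (WithLp.ofLp v) ∈ S₀
      have hc' : ∑ i : Fin n, (A ^ (i : ℕ) * B).mulVec (fun j => c (i, j)) = WithLp.ofLp v := hc
      rw [← hc', Matrix.mulVec_sum]
      refine Submodule.sum_mem _ fun i _ => ?_
      rw [Matrix.mulVec_mulVec, ← Matrix.mul_assoc, ← pow_succ']
      exact mulVec_mem_range_kalmanMatrix A B _ _
  have h2 : S₀ = ⊤ := by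
    refine (Submodule.eq_top_iff').2 fun v => ?_
    exact (Submodule.eq_top_iff'.1 h1) (WithLp.toLp 2 v)
  rw [Controllable, Matrix.rank, show LinearMap.range (kalmanMatrix A B).mulVecLin = ⊤ from h2,
    finrank_top, Module.finrank_fin_fun]

end Kalman

/-! ### Sufficiency: coordinates, feedback and conjugacy -/

section Sufficiency

variable {n m : ℕ} {k : WithTop ℕ∞}

lemma locallyLinearizableAt_of_dim_zero {m : ℕ} (f : Eucl 0 × Eucl m → Eucl 0)
    {Ω : Set (Eucl 0 × Eucl m)} (hΩ : IsOpen Ω) {p : Eucl 0 × Eucl m} (hp : p ∈ Ω) :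
    LocallyLinearizableAt k f Ω p := by
  refine ⟨0, 0, OpenPartialHomeomorph.ofSet Ω hΩ, ?_, hp, Subset.rfl, contDiffOn_id,
    contDiffOn_id, fun I _ γ _ => ?_⟩
  · exact controllable_of_forall_invariant fun S _ _ =>
      Submodule.eq_top_iff'.2 fun v => by rw [Subsingleton.elim v 0]; exact S.zero_mem
  · have h1 : f = linearSystem (0 : Matrix (Fin 0) (Fin 0) ℝ) (0 : Matrix (Fin 0) (Fin m) ℝ) :=
      funext fun p => Subsingleton.elim _ _
    rw [← h1]
    exact Iff.rfl

/-- A linear quotient with trivial kernel gives coordinates. -/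
lemma HasLinearQuotient.exists_coordinates (hk : k = ∞ ∨ k = ω) {f : Eucl n → Eucl n}
    {Δ : Distribution n} {x₀ : Eucl n} (h : HasLinearQuotient k f (fun _ => ⊥) Δ x₀) :
    ∃ (φ : Eucl n → Eucl n) (A : Eucl n →L[ℝ] Eucl n),
      (∀ᶠ x in 𝓝 x₀, ContDiffAt ℝ k φ x ∧ fderiv ℝ φ x (f x) - A (φ x) ∈ Δ x₀ ∧
        ∀ v ∈ Δ x, fderiv ℝ φ x v ∈ Δ x₀) ∧
      fderiv ℝ φ x₀ = ContinuousLinearMap.id ℝ _ ∧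
      ∀ S : Submodule ℝ (Eucl n), Δ x₀ ≤ S → (∀ v ∈ S, A v ∈ S) → S = ⊤ := by
  obtain ⟨F, _, _, _, h, A, W, hh, hctr⟩ := h
  have hk0 := smoothness_ne_zero hk
  -- The identification of `F` with the state space is `dh(x₀)` itself. Then `φ = e⁻¹ ∘ h` has
  -- derivative the identity at `x₀`, and `W` becomes `Δ x₀`.
  let e : Eucl n ≃L[ℝ] F := (LinearEquiv.ofBijective (fderiv ℝ h x₀ : Eucl n →ₗ[ℝ] F)
    ⟨LinearMap.ker_eq_bot.1 hh.self_of_nhds.2.2.1,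
      LinearMap.range_eq_top.1 hh.self_of_nhds.2.1⟩).toContinuousLinearEquiv
  have he : ∀ v, e v = fderiv ℝ h x₀ v := fun v => rfl
  have hW : ∀ b, b ∈ W ↔ e.symm b ∈ Δ x₀ := by
    intro b
    rw [← hh.self_of_nhds.2.2.2.2]
    constructor
    · rintro ⟨v, hv, rfl⟩
      change e.symm (e v) ∈ _
      rwa [e.symm_apply_apply]
    · intro hb
      exact ⟨_, hb, e.apply_symm_apply b⟩
  have hd : ∀ x, ContDiffAt ℝ k h x →
      fderiv ℝ (fun x => e.symm (h x)) x = (e.symm : F →L[ℝ] Eucl n) ∘L fderiv ℝ h x :=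
    fun x hx => ((e.symm : F →L[ℝ] Eucl n).hasFDerivAt.comp x
      (hx.differentiableAt hk0).hasFDerivAt).fderiv
  refine ⟨fun x => e.symm (h x), (e.symm : F →L[ℝ] Eucl n) ∘L A ∘L (e : Eucl n →L[ℝ] F), ?_, ?_, ?_⟩
  · filter_upwards [hh] with x ⟨h1, _, _, h2, h3⟩
    refine ⟨e.symm.contDiff.contDiffAt.comp x h1, ?_, fun v hv => ?_⟩
    · rw [hd x h1]
      rw [hW, map_sub] at h2
      simpa using h2
    · rw [hd x h1]
      exact (hW _).1 (h3.le ⟨v, hv, rfl⟩)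
  · rw [hd x₀ hh.self_of_nhds.1]
    ext1 v
    exact e.symm_apply_apply v
  · intro S hS hA
    have h1 : Submodule.comap (e.symm : F →ₗ[ℝ] Eucl n) S = ⊤ := by
      refine hctr _ (fun b hb => hS ((hW b).1 hb)) fun a ha => ?_
      have := hA _ ha
      simpa using this
    refine (Submodule.eq_top_iff').2 fun v => ?_
    have := (Submodule.eq_top_iff'.1 h1) (e v)
    simpa using this

/-- Linearizing state coordinates, together with the control distribution, yield a linearizing
feedback. -/
lemma exists_feedback (hk : k = ∞ ∨ k = ω) {f : Eucl n × Eucl m → Eucl n} {x₀ : Eucl n}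
    {u₀ : Eucl m} (hf : ∀ᶠ p in 𝓝 (x₀, u₀), ContDiffAt ℝ k f p)
    {φ : Eucl n → Eucl n} (hφ : ∀ᶠ x in 𝓝 x₀, ContDiffAt ℝ k φ x)
    (hφ₀ : fderiv ℝ φ x₀ = ContinuousLinearMap.id ℝ _) (A : Eucl n →L[ℝ] Eucl n)
    (hmem : ∀ᶠ p in 𝓝 (x₀, u₀), fderiv ℝ φ p.1 (f p) - A (φ p.1) ∈
      LinearMap.range (partialU f x₀ u₀ : Eucl m →ₗ[ℝ] Eucl n)) :
    ∃ ψ : Eucl n × Eucl m → Eucl m, (∀ᶠ p in 𝓝 (x₀, u₀), ContDiffAt ℝ k ψ p ∧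
      fderiv ℝ φ p.1 (f p) = A (φ p.1) + partialU f x₀ u₀ (ψ p)) ∧
      (fderiv ℝ (fun p => (φ p.1, ψ p)) (x₀, u₀)).IsInvertible := by
  have hk0 := smoothness_ne_zero hk
  let B := partialU f x₀ u₀
  let W := LinearMap.range (B : Eucl m →ₗ[ℝ] Eucl n)
  obtain ⟨R, hR⟩ : ∃ R : Eucl n →L[ℝ] Eucl m, ∀ w ∈ W, B (R w) = w := by
    obtain ⟨π, hπ⟩ := Submodule.ClosedComplemented.of_finiteDimensional W
    obtain ⟨s, hs⟩ := LinearMap.exists_rightInverse_of_surjective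
      (B : Eucl m →ₗ[ℝ] Eucl n).rangeRestrict (LinearMap.range_rangeRestrict _)
    refine ⟨LinearMap.toContinuousLinearMap (s ∘ₗ (π : Eucl n →ₗ[ℝ] W)), fun w hw => ?_⟩
    have h1 := LinearMap.congr_fun hs ⟨w, hw⟩
    have h2 : π w = ⟨w, hw⟩ := hπ ⟨w, hw⟩
    have h3 := congrArg Subtype.val h1
    change B (s (π w)) = w
    rw [h2]
    exact h3
  let wv : Eucl n × Eucl m → Eucl n := fun p => fderiv ℝ φ p.1 (f p) - A (φ p.1)
  have hφ' : ∀ᶠ p : Eucl n × Eucl m in 𝓝 (x₀, u₀), ContDiffAt ℝ k φ p.1 :=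
    continuousAt_fst.eventually hφ
  have hwv : ∀ᶠ p in 𝓝 (x₀, u₀), ContDiffAt ℝ k wv p := by
    filter_upwards [hf, hφ'] with p h1 h2
    have h3 : ContDiffAt ℝ k (fun p : Eucl n × Eucl m => fderiv ℝ φ p.1) p :=
      (h2.fderiv_right (smoothness_add_one_le hk)).comp p contDiffAt_fst
    have h4 : ContDiffAt ℝ k (fun p : Eucl n × Eucl m => A (φ p.1)) p :=
      A.contDiff.contDiffAt.comp p (h2.comp p contDiffAt_fst)
    exact (h3.clm_apply h1).sub h4
  -- The first term is a control whose image under `B` is the defect `wv`. The second is the part of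
  -- `u` in the kernel of `B`; it makes `∂ψ/∂u = R B + (1 - R B) = 1` at the base point, where `dφ =
  -- id`.
  let ψ : Eucl n × Eucl m → Eucl m := fun p => R (wv p) + (p.2 - R (B p.2))
  have hψ : ∀ᶠ p in 𝓝 (x₀, u₀), ContDiffAt ℝ k ψ p := by
    filter_upwards [hwv] with p hp
    have h1 : ContDiffAt ℝ k (fun p => R (wv p)) p := R.contDiff.contDiffAt.comp p hp
    have h2 : ContDiffAt ℝ k (fun p : Eucl n × Eucl m => p.2 - R (B p.2)) p := by fun_prop
    exact h1.add h2
  refine ⟨ψ, ?_, ?_⟩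
  · filter_upwards [hψ, hmem] with p h1 h2
    refine ⟨h1, ?_⟩
    change _ = _ + B (ψ p)
    simp only [ψ, map_add, map_sub]
    have h3 : B (R (B p.2)) = B p.2 := hR _ ⟨p.2, rfl⟩
    have h4 : B (R (wv p)) = wv p := hR _ h2
    rw [h3, h4, sub_self, add_zero]
    simp [wv]
  · have hφd : HasFDerivAt (fun p : Eucl n × Eucl m => φ p.1)
        (fderiv ℝ φ x₀ ∘L .fst ℝ (Eucl n) (Eucl m)) (x₀, u₀) :=
      HasFDerivAt.comp (g := φ) (x₀, u₀)
        (hφ.self_of_nhds.differentiableAt hk0).hasFDerivAt hasFDerivAt_fst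
    have hψd := (hψ.self_of_nhds.differentiableAt hk0).hasFDerivAt
    have hψu : ∀ v, fderiv ℝ ψ (x₀, u₀) (0, v) = v := by
      intro v
      have h1 := hψd.comp u₀ (hasFDerivAt_prodMk_right (𝕜 := ℝ) x₀ u₀)
      have h2 := (hasFDerivAt_partialU hk hf.self_of_nhds).1
      have h3 : HasFDerivAt (fun u : Eucl m => R (f (x₀, u) - A (φ x₀)) + (u - R (B u)))
          (R ∘L B + (ContinuousLinearMap.id ℝ _ - R ∘L B)) u₀ :=
        (R.hasFDerivAt.comp u₀ (h2.sub_const _)).add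
          ((hasFDerivAt_id u₀).sub (R.hasFDerivAt.comp u₀ B.hasFDerivAt))
      have h4 : (ψ ∘ fun u => (x₀, u)) = fun u : Eucl m =>
          R (f (x₀, u) - A (φ x₀)) + (u - R (B u)) := by
        funext u
        simp [ψ, wv, hφ₀]
      rw [h4] at h1
      have h5 := DFunLike.congr_fun (h1.unique h3) v
      simpa using h5
    have hd : fderiv ℝ (fun p => (φ p.1, ψ p)) (x₀, u₀) =
        (fderiv ℝ φ x₀ ∘L .fst ℝ (Eucl n) (Eucl m)).prod (fderiv ℝ ψ (x₀, u₀)) :=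
      (hφd.prodMk hψd).fderiv
    have hinj : Function.Injective (fderiv ℝ (fun p => (φ p.1, ψ p)) (x₀, u₀)) := by
      rw [injective_iff_map_eq_zero, hd, hφ₀]
      rintro ⟨ξ, v⟩ h
      obtain rfl : ξ = 0 := congrArg Prod.fst h
      have h1 : fderiv ℝ ψ (x₀, u₀) (0, v) = 0 := congrArg Prod.snd h
      rw [hψu] at h1
      rw [h1]
      rfl
    let L := LinearEquiv.ofInjectiveEndo
      (fderiv ℝ (fun p => (φ p.1, ψ p)) (x₀, u₀) : Eucl n × Eucl m →ₗ[ℝ] Eucl n × Eucl m) hinj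
    exact ⟨L.toContinuousLinearEquiv, by ext v <;> rfl⟩

/-- A local diffeomorphism `(φ(x), ψ(x,u))` relating `f` to `g` conjugates the two systems near
the base point. -/
theorem exists_conjugates (hk : k = ∞ ∨ k = ω) {f g : Eucl n × Eucl m → Eucl n}
    {Ω : Set (Eucl n × Eucl m)} (hΩ : IsOpen Ω) {p : Eucl n × Eucl m} (hp : p ∈ Ω)
    (hf : ContDiffOn ℝ k f Ω) (hg : Continuous g) {φ : Eucl n → Eucl n}
    {ψ : Eucl n × Eucl m → Eucl m} (hφ : ∀ᶠ x in 𝓝 p.1, ContDiffAt ℝ k φ x)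
    (hψ : ∀ᶠ q in 𝓝 p, ContDiffAt ℝ k ψ q) (hφ₀ : (fderiv ℝ φ p.1).IsInvertible)
    (hinv : (fderiv ℝ (fun q => (φ q.1, ψ q)) p).IsInvertible)
    (hfg : ∀ᶠ q in 𝓝 p, fderiv ℝ φ q.1 (f q) = g (φ q.1, ψ q)) :
    ∃ χ : OpenPartialHomeomorph (Eucl n × Eucl m) (Eucl n × Eucl m),
      p ∈ χ.source ∧ χ.source ⊆ Ω ∧ ContDiffOn ℝ k χ χ.source ∧
      ContDiffOn ℝ k χ.symm χ.target ∧ Conjugates χ f g := by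
  have hk0 := smoothness_ne_zero hk
  have hk1 := one_le_smoothness hk
  have hfst : ∀ {P : Eucl n → Prop}, (∀ᶠ x in 𝓝 p.1, P x) → ∀ᶠ q in 𝓝 p, P q.1 :=
    fun h => continuousAt_fst.eventually h
  have hΨk : ∀ᶠ q in 𝓝 p, ContDiffAt ℝ k (fun q : Eucl n × Eucl m => (φ q.1, ψ q)) q := by
    filter_upwards [hfst hφ, hψ] with q h1 h2
    exact (h1.comp q contDiffAt_fst).prodMk h2
  obtain ⟨Ψ, hΨ, hpΨ, hΨ1, hΨ2⟩ := exists_openPartialHomeomorph hk hΨk hinv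
  obtain ⟨Φ, hΦ, hpΦ, hΦ1, hΦ2⟩ := exists_openPartialHomeomorph hk hφ hφ₀
  obtain ⟨K₁, t₁, ht₁, hK₁⟩ := (hφ.self_of_nhds.of_le hk1).exists_lipschitzOnWith
  obtain ⟨K₂, t₂, ht₂, hK₂⟩ := ((hΦ2 (φ p.1) (hΦ ▸ Φ.map_source hpΦ)).of_le hk1).exists_lipschitzOnWith
  have hfc : ContinuousAt f p := hf.continuousOn.continuousAt (hΩ.mem_nhds hp)
  have hΨc : ContinuousAt Ψ p := Ψ.continuousAt hpΨ
  -- The domain is shrunk until the state map and its inverse are Lipschitz and the domain, its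
  -- image and both right-hand sides are bounded, as transport of solutions requires in both
  -- directions.
  have hev : ∀ᶠ q in 𝓝 p, q ∈ Ω ∧ q.1 ∈ Φ.source ∧ q.1 ∈ t₁ ∧ φ q.1 ∈ t₂ ∧
      fderiv ℝ φ q.1 (f q) = g (φ q.1, ψ q) ∧ ‖f q‖ < ‖f p‖ + 1 ∧ q ∈ Metric.ball p 1 ∧
      Ψ q ∈ Metric.ball (Ψ p) 1 := by
    filter_upwards [hΩ.mem_nhds hp, hfst (Φ.open_source.mem_nhds hpΦ), hfst ht₁,
      hfst (hφ.self_of_nhds.continuousAt.eventually ht₂), hfg,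
      hfc.norm.eventually_lt_const (lt_add_one _), Metric.ball_mem_nhds p one_pos,
      hΨc.eventually (Metric.ball_mem_nhds (Ψ p) one_pos)] with q h1 h2 h3 h4 h5 h6 h7 h8
    exact ⟨h1, h2, h3, h4, h5, h6, h7, h8⟩
  obtain ⟨O, hO, hOo, hpO⟩ := eventually_nhds_iff.1 hev
  let χ := Ψ.restrOpen O hOo
  have hsrc : χ.source = Ψ.source ∩ O := Ψ.restrOpen_source O hOo
  have hχ : ∀ q, χ q = (φ q.1, ψ q) := fun q => congrFun hΨ q
  have hχO : ∀ q ∈ χ.source, q ∈ O := fun q hq => (hsrc ▸ hq).2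
  have htgt : ∀ q ∈ χ.target, ∃ q' ∈ χ.source, χ.symm q = q' ∧ q = (φ q'.1, ψ q') := fun q hq =>
    ⟨χ.symm q, χ.map_target hq, rfl, by rw [← hχ, χ.right_inv hq]⟩
  have hΦ' : ∀ x, Φ x = φ x := fun x => congrFun hΦ x
  have hleft : ∀ x ∈ Φ.source, Φ.symm (φ x) = x := fun x hx => by
    rw [← hΦ', Φ.left_inv hx]
  have hdΦ : ∀ x ∈ Φ.source, HasFDerivAt Φ.symm (fderiv ℝ Φ.symm (φ x)) (φ x) := fun x hx =>
    ((hΦ2 _ (hΦ' x ▸ Φ.map_source hx)).differentiableAt hk0).hasFDerivAt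
  have hdφ : ∀ x ∈ Φ.source, HasFDerivAt φ (fderiv ℝ φ x) x := fun x hx =>
    ((hΦ1 x hx).1.differentiableAt hk0).hasFDerivAt
  have hfb : ∀ q ∈ χ.source, ‖f q‖ ≤ (⟨‖f p‖ + 1, by positivity⟩ : NNReal) := fun q hq =>
    (hO q (hχO q hq)).2.2.2.2.2.1.le
  have hbs : Bornology.IsBounded χ.source := Metric.isBounded_ball.subset fun q hq =>
    (hO q (hχO q hq)).2.2.2.2.2.2.1
  have htb : χ.target ⊆ Metric.ball (Ψ p) 1 := fun q hq => by
    have := (hO _ (hχO _ (χ.map_target hq))).2.2.2.2.2.2.2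
    rwa [show Ψ (χ.symm q) = q from χ.right_inv hq] at this
  have hbt : Bornology.IsBounded χ.target := Metric.isBounded_ball.subset htb
  obtain ⟨C, hC⟩ := (isCompact_closedBall (Ψ p) 1).exists_bound_of_continuousOn hg.continuousOn
  have hgb : ∀ q ∈ χ.target, ‖g q‖ ≤ (⟨max C 0, le_max_right _ _⟩ : NNReal) := fun q hq =>
    (hC q (Metric.ball_subset_closedBall (htb hq))).trans (le_max_left _ _)
  refine ⟨χ, hsrc ▸ ⟨hpΨ, hpO⟩, fun q hq => (hO q (hχO q hq)).1, fun q hq => ?_, fun q hq => ?_,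
    fun I hI γ hγ => ⟨fun h => ?_, fun h => ?_⟩⟩
  · exact (hΨ ▸ (hΨ1 q (hsrc ▸ hq).1).1 : ContDiffAt ℝ k Ψ q).contDiffWithinAt
  · have : q ∈ Ψ.target := by
      rw [← χ.right_inv hq]
      exact Ψ.map_source (hsrc ▸ χ.map_target hq).1
    exact (hΨ2 q this).contDiffWithinAt
  · refine IsSolution.map (K := K₁) χ.open_source χ.mapsTo χ.continuousOn
      (fun q _ => congrArg Prod.fst (hχ q)) (hK₁.mono ?_)
      (fun q hq => hdφ _ (hO q (hχO q hq)).2.1) (fun q hq => ?_) hbt hfb hgb hg.continuousOn hI h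
      (fun _ _ => rfl)
    · rintro _ ⟨q, hq, rfl⟩
      exact (hO q (hχO q hq)).2.2.1
    · rw [hχ]
      exact (hO q (hχO q hq)).2.2.2.2.1
  -- The converse is transport by the inverse. Its state component is the local inverse of `φ`
  -- alone, so it too does not depend on the control.
  · refine IsSolution.map (K := K₂) (χ := χ.symm) (φ := Φ.symm)
      (φ' := fun y => fderiv ℝ Φ.symm y) χ.open_target χ.symm.mapsTo χ.symm.continuousOn
      (fun q hq => ?_) (hK₂.mono ?_) (fun q hq => ?_) (fun q hq => ?_) hbs hgb hfb
      (hf.continuousOn.mono fun q hq => (hO q (hχO q hq)).1) hI h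
      (fun t ht => (χ.left_inv (hγ t ht)).symm)
    · obtain ⟨q', hq', h1, rfl⟩ := htgt q hq
      rw [h1, hleft _ (hO q' (hχO q' hq')).2.1]
    · rintro _ ⟨q, hq, rfl⟩
      obtain ⟨q', hq', h1, rfl⟩ := htgt q hq
      exact (hO q' (hχO q' hq')).2.2.2.1
    · obtain ⟨q', hq', h1, rfl⟩ := htgt q hq
      exact hdΦ _ (hO q' (hχO q' hq')).2.1
    · obtain ⟨q', hq', h1, rfl⟩ := htgt q hq
      rw [h1]
      have h2 := (hO q' (hχO q' hq')).2.1
      rw [← (hO q' (hχO q' hq')).2.2.2.2.1]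
      have h3 := (hdΦ _ h2).comp q'.1 (hdφ _ h2)
      have h4 : HasFDerivAt (Φ.symm ∘ φ) (ContinuousLinearMap.id ℝ _) q'.1 :=
        (hasFDerivAt_id _).congr_of_eventuallyEq
          (Filter.eventually_of_mem (Φ.open_source.mem_nhds h2) hleft)
      exact DFunLike.congr_fun (h3.unique h4) (f q')

/-- The conditions on `D` and the flag of distributions imply local linearizability. -/
theorem locallyLinearizableAt_of_flag (hk : k = ∞ ∨ k = ω) (hn : 0 < n)
    {f : Eucl n × Eucl m → Eucl n} {Ω : Set (Eucl n × Eucl m)} (hΩ : IsOpen Ω)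
    (hf : ContDiffOn ℝ k f Ω) {x₀ : Eucl n} {u₀ : Eucl m} {X : Set (Eucl n)} {U : Set (Eucl m)}
    (hX : IsOpen X) (hU : IsOpen U) (hx₀ : x₀ ∈ X) (hu₀ : u₀ ∈ U) (hXU : X ×ˢ U ⊆ Ω)
    (hD : ∀ x ∈ X, ∀ u ∈ U, ∀ u' ∈ U, dirSpace f U x u = dirSpace f U x u') {r : ℕ}
    (hr : ∀ x ∈ X, ∀ u ∈ U, Module.finrank ℝ
      (LinearMap.range (partialU f x u : Eucl m →ₗ[ℝ] Eucl n)) = r)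
    (hint : ∀ j < n, Integrable k X
      (flag k X (fun x => f (x, u₀)) (fun x => dirSpace f U x u₀) j))
    (htop : ∀ x ∈ X, Module.finrank ℝ
      (flag k X (fun x => f (x, u₀)) (fun x => dirSpace f U x u₀) (n - 1) x) = n) :
    LocallyLinearizableAt k f Ω (x₀, u₀) := by
  have hk0 := smoothness_ne_zero hk
  have hfA : ∀ x ∈ X, ∀ u ∈ U, ContDiffAt ℝ k f (x, u) := fun x hx u hu =>
    hf.contDiffAt (hΩ.mem_nhds (hXU ⟨hx, hu⟩))
  have hfu : ∀ x ∈ X, ∀ u ∈ U, ContDiffAt ℝ k (fun w => f (x, w)) u := fun x hx u hu =>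
    (hfA x hx u hu).comp u (contDiffAt_const.prodMk contDiffAt_id)
  have hf₀ : ContDiffOn ℝ k (fun x => f (x, u₀)) X := fun x hx =>
    ((hfA x hx u₀ hu₀).comp (f := fun x => (x, u₀)) x
      (contDiffAt_id.prodMk contDiffAt_const)).contDiffWithinAt
  have hDr : ∀ x ∈ X, dirSpace f U x u₀ =
      LinearMap.range (partialU f x u₀ : Eucl m →ₗ[ℝ] Eucl n) := fun x hx =>
    dirSpace_eq_range hk hU hu₀ (hfu x hx) (hr x hx)
  have hsec : HasSections k X fun x => dirSpace f U x u₀ := by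
    intro x hx v hv
    obtain ⟨a, rfl⟩ := (hDr x hx).le hv
    refine ⟨X, fun y => fderiv ℝ f (y, u₀) (0, a), ⟨hX, Subset.rfl, fun y hy => ?_, fun y hy => ?_⟩,
      hx, ?_⟩
    · have h1 : ContDiffAt ℝ k (fun y : Eucl n => fderiv ℝ f (y, u₀)) y :=
        ((hfA y hy u₀ hu₀).fderiv_right (smoothness_add_one_le hk)).comp (f := fun y => (y, u₀)) y
          (contDiffAt_id.prodMk contDiffAt_const)
      exact (h1.clm_apply contDiffAt_const).contDiffWithinAt
    · refine (hDr y hy).ge ⟨a, ?_⟩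
      change partialU f y u₀ a = _
      rw [(hasFDerivAt_partialU hk (hfA y hy u₀ hu₀)).2]
      rfl
    · change _ = partialU f x u₀ a
      rw [(hasFDerivAt_partialU hk (hfA x hx u₀ hu₀)).2]
      rfl
  have hq := hasLinearQuotient_bot hk hX hx₀ hf₀ hsec (N := n - 1)
    (fun j hj => hint j (by omega)) fun x hx =>
      Submodule.eq_top_of_finrank_eq (by rw [htop x hx, finrank_euclideanSpace_fin])
  obtain ⟨φ, A, hφ, hφ₀, hctr⟩ := hq.exists_coordinates hk
  simp only [hDr x₀ hx₀] at hφ hctr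
  obtain ⟨ε, hε, hball⟩ := Metric.isOpen_iff.1 hU u₀ hu₀
  have hmem : ∀ᶠ p : Eucl n × Eucl m in 𝓝 (x₀, u₀), fderiv ℝ φ p.1 (f p) - A (φ p.1) ∈
      LinearMap.range (partialU f x₀ u₀ : Eucl m →ₗ[ℝ] Eucl n) := by
    have h1 : ∀ᶠ p : Eucl n × Eucl m in 𝓝 (x₀, u₀), p.1 ∈ X :=
      continuousAt_fst.eventually (hX.mem_nhds hx₀)
    have h2 : ∀ᶠ p : Eucl n × Eucl m in 𝓝 (x₀, u₀), p.2 ∈ Metric.ball u₀ ε :=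
      continuousAt_snd.eventually (Metric.ball_mem_nhds u₀ hε)
    filter_upwards [h1, h2, continuousAt_fst.eventually hφ]
    rintro ⟨x, u⟩ hx hu ⟨-, h3, h4⟩
    -- Each `∂f/∂u (x,w)` has range in `D(x,w) = D(x,u₀)`, so `f(x,·)` moves inside one fixed
    -- subspace. `dφ` carries that subspace into the range of `∂f/∂u (x₀,u₀)`.
    have h5 : f (x, u) - f (x, u₀) ∈ dirSpace f U x u₀ := by
      refine sub_mem_of_range_le (g := fun w => f (x, w)) hε
        (fun w hw => (hfu x hx w (hball hw)).differentiableAt hk0) (fun w hw v => ?_) hu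
      rw [hD x hx u₀ hu₀ w (hball hw)]
      exact range_le_dirSpace hU (hball hw) ((hfu x hx w (hball hw)).differentiableAt hk0) ⟨v, rfl⟩
    have h6 := Submodule.add_mem _ h3 (h4 _ h5)
    rw [map_sub] at h6
    convert h6 using 1
    abel
  obtain ⟨ψ, hψ, hinv⟩ := exists_feedback hk
    (by filter_upwards [(hX.prod hU).mem_nhds (show (x₀, u₀) ∈ X ×ˢ U from ⟨hx₀, hu₀⟩)]
          with p hp using hfA p.1 hp.1 p.2 hp.2)
    (hφ.mono fun x hx => hx.1) hφ₀ A hmem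
  let MA : Matrix (Fin n) (Fin n) ℝ := Matrix.toEuclideanLin.symm (A : Eucl n →ₗ[ℝ] Eucl n)
  let MB : Matrix (Fin n) (Fin m) ℝ :=
    Matrix.toEuclideanLin.symm (partialU f x₀ u₀ : Eucl m →ₗ[ℝ] Eucl n)
  have hMA : Matrix.toEuclideanLin MA = (A : Eucl n →ₗ[ℝ] Eucl n) :=
    Matrix.toEuclideanLin.apply_symm_apply _
  have hMB : Matrix.toEuclideanLin MB = (partialU f x₀ u₀ : Eucl m →ₗ[ℝ] Eucl n) :=
    Matrix.toEuclideanLin.apply_symm_apply _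
  have hlin : ∀ q, linearSystem MA MB q = A q.1 + partialU f x₀ u₀ q.2 := fun q => by
    rw [linearSystem, hMA, hMB]
    rfl
  obtain ⟨χ, h1, h2, h3, h4, h5⟩ := exists_conjugates hk hΩ (hXU ⟨hx₀, hu₀⟩) hf
    (g := linearSystem MA MB) (by rw [funext hlin]; fun_prop) (hφ.mono fun x hx => hx.1)
    (hψ.mono fun q hq => hq.1) (by rw [hφ₀]; exact ⟨.refl ℝ _, rfl⟩) hinv
    (hψ.mono fun q hq => by rw [hq.2, hlin])
  refine ⟨MA, MB, χ, controllable_of_forall_invariant fun S hS hAS => ?_, h1, h2, h3, h4, h5⟩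
  rw [hMB] at hS
  rw [hMA] at hAS
  exact hctr S hS hAS

end Sufficiency

/-! ### Krylov subspaces -/

section Krylov

variable {n m : ℕ}

/-- `V + A V + … + Aʲ V`. -/
def krylov (A : Eucl n →ₗ[ℝ] Eucl n) (V : Submodule ℝ (Eucl n)) : ℕ → Submodule ℝ (Eucl n)
  | 0 => V
  | j + 1 => krylov A V j ⊔ Submodule.map A (krylov A V j)

lemma krylov_mono (A : Eucl n →ₗ[ℝ] Eucl n) (V : Submodule ℝ (Eucl n)) : Monotone (krylov A V) :=
  monotone_nat_of_le_succ fun _ => le_sup_left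

lemma toLp_pow_mul_mulVec_mem_krylov (A : Matrix (Fin n) (Fin n) ℝ) (B : Matrix (Fin n) (Fin m) ℝ)
    (j : ℕ) (v : Fin m → ℝ) : WithLp.toLp 2 ((A ^ j * B).mulVec v) ∈
      krylov (Matrix.toEuclideanLin A) (LinearMap.range (Matrix.toEuclideanLin B)) j := by
  induction j with
  | zero =>
    rw [pow_zero, Matrix.one_mul]
    exact ⟨WithLp.toLp 2 v, rfl⟩
  | succ j ih =>
    rw [pow_succ', Matrix.mul_assoc, ← Matrix.mulVec_mulVec]
    exact Submodule.mem_sup_right ⟨_, ih, rfl⟩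

/-- The columns of `AⁱB` with `i ≤ n - 1` span the space and all lie in the Krylov subspace of index
`n - 1`. -/
lemma Controllable.krylov_eq_top {A : Matrix (Fin n) (Fin n) ℝ} {B : Matrix (Fin n) (Fin m) ℝ}
    (h : Controllable A B) : krylov (Matrix.toEuclideanLin A)
      (LinearMap.range (Matrix.toEuclideanLin B)) (n - 1) = ⊤ := by
  have h1 : LinearMap.range (kalmanMatrix A B).mulVecLin = ⊤ :=
    Submodule.eq_top_of_finrank_eq (by rw [Module.finrank_fin_fun]; exact h)
  refine Submodule.eq_top_iff'.2 fun w => ?_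
  obtain ⟨c, hc⟩ := Submodule.eq_top_iff'.1 h1 (WithLp.ofLp w)
  rw [Matrix.mulVecLin_apply, kalmanMatrix_mulVec] at hc
  have h2 : w = ∑ i : Fin n, WithLp.toLp 2 ((A ^ (i : ℕ) * B).mulVec fun j => c (i, j)) := by
    rw [← WithLp.toLp_sum, hc]
  rw [h2]
  exact Submodule.sum_mem _ fun i _ =>
    krylov_mono _ _ (by omega) (toLp_pow_mul_mulVec_mem_krylov A B i _)

end Krylov

/-! ### Necessity: triangular form of a conjugacy, and pullback of the flag -/

section Necessity

variable {n m : ℕ} {k : WithTop ℕ∞}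

/-- Through every point there is a solution with constant control, on a short interval. -/
lemma exists_constant_control_curve {f : Eucl n × Eucl m → Eucl n} {S : Set (Eucl n × Eucl m)}
    (hS : IsOpen S) {x : Eucl n} {u : Eucl m} (hxu : (x, u) ∈ S)
    (hf : ContDiffAt ℝ 1 f (x, u)) :
    ∃ ε > 0, ∃ c : ℝ → Eucl n, c 0 = x ∧ ∀ t ∈ Ioo (-ε) ε,
      HasDerivAt c (f (c t, u)) t ∧ (c t, u) ∈ S ∧ c t ∈ Metric.ball x 1 := by
  have h1 : ContDiffAt ℝ 1 (fun y => f (y, u)) x :=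
    hf.comp (f := fun y => (y, u)) x (contDiffAt_id.prodMk contDiffAt_const)
  obtain ⟨c, hc0, ε, hε, hc⟩ :=
    ContDiffAt.exists_forall_mem_closedBall_exists_eq_forall_mem_Ioo_hasDerivAt₀ h1 0
  rw [zero_sub, zero_add] at hc
  have hcc : ContinuousAt c 0 := (hc 0 ⟨by linarith, hε⟩).continuousAt
  have h2 : ∀ᶠ t in 𝓝 (0 : ℝ), (c t, u) ∈ S ∧ c t ∈ Metric.ball x 1 :=
    ((hcc.prodMk continuousAt_const).eventually (hS.mem_nhds (by simpa [hc0] using hxu))).and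
      (hcc.eventually (by rw [hc0]; exact Metric.ball_mem_nhds x one_pos))
  obtain ⟨δ, hδ, h3⟩ := Metric.eventually_nhds_iff.1 h2
  refine ⟨min ε δ, lt_min hε hδ, c, hc0, fun t ht => ?_⟩
  have ht' := abs_lt.2 ht
  rw [lt_min_iff] at ht'
  refine ⟨hc t (abs_lt.1 ht'.1), h3 ?_⟩
  rw [Real.dist_eq, sub_zero]
  exact ht'.2

/-- A trajectory with constant control `u` remains a solution when the control is changed at one
instant. -/
lemma isSolution_update {f : Eucl n × Eucl m → Eucl n} {S : Set (Eucl n × Eucl m)}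
    (hf : ContinuousOn f S) {c : ℝ → Eucl n} {u u' : Eucl m} {ε : ℝ} {x : Eucl n}
    (hc : ∀ t ∈ Ioo (-ε) ε, HasDerivAt c (f (c t, u)) t ∧ (c t, u) ∈ S ∧ c t ∈ Metric.ball x 1)
    (hu' : (c 0, u') ∈ S) :
    IsSolution f S (Ioo (-ε) ε) fun t => (c t, Function.update (fun _ => u) 0 u' t) := by
  have hae : ∀ᵐ t : ℝ, Function.update (fun _ => u) 0 u' t = u := by
    filter_upwards [compl_mem_ae_iff.2 (measure_singleton (μ := volume) (0 : ℝ))] with t ht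
    exact Function.update_of_ne ht _ _
  have hcc : ContinuousOn c (Ioo (-ε) ε) := fun t ht => (hc t ht).1.continuousAt.continuousWithinAt
  have hfc : ContinuousOn (fun t => f (c t, u)) (Ioo (-ε) ε) :=
    hf.comp (hcc.prodMk continuousOn_const) fun t ht => (hc t ht).2.1
  have hint : ∀ T₁ T₂ : ℝ, T₁ ≤ T₂ → Icc T₁ T₂ ⊆ Ioo (-ε) ε →
      IntervalIntegrable (fun t => f (c t, u)) volume T₁ T₂ := fun T₁ T₂ h12 hT =>
    (hfc.mono (by rwa [uIcc_of_le h12])).intervalIntegrable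
  have hfae : ∀ᵐ t : ℝ, f (c t, u) = f (c t, Function.update (fun _ => u) 0 u' t) := by
    filter_upwards [hae] with t ht
    rw [ht]
  refine ⟨fun t ht => ?_, ?_, fun t _ => ⟨_, self_mem_nhdsWithin, ?_⟩, fun T₁ T₂ h12 hT => ?_,
    fun T₁ T₂ h12 hT => (hint T₁ T₂ h12 hT).congr_ae (ae_restrict_of_ae hfae),
    fun T₁ T₂ h12 hT => ?_⟩
  · rcases eq_or_ne t 0 with rfl | h0
    · simpa using hu'
    · rw [Function.update_of_ne h0]
      exact (hc t ht).2.1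
  · refine ((hcc.prodMk continuousOn_const).aemeasurable (f := fun t => (c t, u))
      measurableSet_Ioo).congr (ae_restrict_of_ae ?_)
    filter_upwards [hae] with t ht
    rw [ht]
  · have hb : Bornology.IsBounded (Metric.ball x 1 ×ˢ ({u, u'} : Set (Eucl m))) :=
      Metric.isBounded_ball.prod (Set.toFinite _).isBounded
    refine hb.subset ?_
    rintro _ ⟨t, ht, rfl⟩
    refine ⟨(hc t ht).2.2, ?_⟩
    rcases eq_or_ne t 0 with rfl | h0
    · simp
    · simp [Function.update_of_ne h0]
  · obtain ⟨M, hM⟩ := isCompact_Icc.exists_bound_of_continuousOn (hfc.mono hT)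
    have h1 : LipschitzOnWith M.toNNReal c (Icc T₁ T₂) :=
      (convex_Icc T₁ T₂).lipschitzOnWith_of_nnnorm_hasDerivWithin_le
        (fun t ht => (hc t (hT ht)).1.hasDerivWithinAt)
        fun t ht => NNReal.coe_le_coe.1 ((hM t ht).trans (Real.le_coe_toNNReal M))
    rw [← uIcc_of_le h12] at h1
    exact h1.absolutelyContinuousOnInterval
  · rw [← intervalIntegral.integral_congr_ae (hfae.mono fun t ht _ => ht)]
    refine (intervalIntegral.integral_eq_sub_of_hasDerivAt (fun t ht => ?_)
      (hint T₁ T₂ h12 hT)).symm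
    rw [uIcc_of_le h12] at ht
    exact (hc t (hT ht)).1

/-- A conjugacy maps the state by a map that does not depend on the control, and transports the
dynamics. -/
theorem Conjugates.fst_eq_and_fderiv {χ : OpenPartialHomeomorph (Eucl n × Eucl m) (Eucl n × Eucl m)}
    {f g : Eucl n × Eucl m → Eucl n} (hχ : Conjugates χ f g) (hg : Continuous g)
    (hf : ContinuousOn f χ.source) {x : Eucl n} {u : Eucl m} (hxu : (x, u) ∈ χ.source)
    (hfx : ContDiffAt ℝ 1 f (x, u)) (hχx : DifferentiableAt ℝ χ (x, u)) :
    (∀ u', (x, u') ∈ χ.source → (χ (x, u')).1 = (χ (x, u)).1) ∧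
      (fderiv ℝ χ (x, u) (f (x, u), 0)).1 = g (χ (x, u)) := by
  obtain ⟨ε, hε, c, hc0, hc⟩ := exists_constant_control_curve χ.open_source hxu hfx
  have hcc : ContinuousOn c (Ioo (-ε) ε) := fun t ht => (hc t ht).1.continuousAt.continuousWithinAt
  have hgc : ContinuousOn (fun t => g (χ (c t, u))) (Ioo (-ε) ε) :=
    hg.comp_continuousOn (χ.continuousOn.comp (hcc.prodMk continuousOn_const)
      fun t ht => (hc t ht).2.1)
  -- With the control set to `u'` at time `0` only, the image starts at the state of `χ(x,u')`,
  -- while its later values and the integral are unchanged. Comparing `u'` with `u` identifies the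
  -- two starting states.
  have key : ∀ u', (x, u') ∈ χ.source → ∀ t ∈ Ioo 0 ε,
      (χ (c t, u)).1 - (χ (x, u')).1 = ∫ s in (0 : ℝ)..t, g (χ (c s, u)) := by
    intro u' hu' t ht
    have hsol := isSolution_update hf hc (hc0.symm ▸ hu')
    have h1 := ((hχ _ ordConnected_Ioo _ hsol.mem).1 hsol).integral_eq 0 t ht.1.le
      fun s hs => ⟨by linarith [hs.1], hs.2.trans_lt ht.2⟩
    simp only [Function.comp_apply, Function.update_self, Function.update_of_ne ht.1.ne', hc0] at h1
    rw [h1]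
    refine intervalIntegral.integral_congr_ae ?_
    filter_upwards with s hs
    rw [uIoc_of_le ht.1.le] at hs
    rw [Function.update_of_ne hs.1.ne']
  refine ⟨fun u' hu' => ?_, ?_⟩
  · have h1 := key u' hu' (ε / 2) ⟨by linarith, by linarith⟩
    rw [← key u hxu (ε / 2) ⟨by linarith, by linarith⟩] at h1
    exact sub_right_injective h1
  · have h0 : (0 : ℝ) ∈ Ioo (-ε) ε := ⟨by linarith, hε⟩
    have hd1 : HasDerivAt (fun t => (χ (c t, u)).1) (fderiv ℝ χ (x, u) (f (x, u), 0)).1 0 := by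
      have h1 : HasDerivAt (fun t => (c t, u)) (f (x, u), 0) 0 := by
        have := (hc 0 h0).1
        rw [hc0] at this
        exact this.prodMk (hasDerivAt_const _ _)
      have h2 : HasFDerivAt χ (fderiv ℝ χ (x, u)) (c 0, u) := hc0.symm ▸ hχx.hasFDerivAt
      exact (ContinuousLinearMap.fst ℝ (Eucl n) (Eucl m)).hasFDerivAt.comp_hasDerivAt 0
        (h2.comp_hasDerivAt 0 h1)
    have hd2 : HasDerivAt (fun t => ∫ s in (0 : ℝ)..t, g (χ (c s, u))) (g (χ (x, u))) 0 := by
      have h1 := intervalIntegral.integral_hasDerivAt_right (a := (0 : ℝ)) (b := 0)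
        (f := fun s => g (χ (c s, u))) IntervalIntegrable.refl
        (hgc.stronglyMeasurableAtFilter isOpen_Ioo 0 h0)
        (hgc.continuousAt (isOpen_Ioo.mem_nhds h0))
      simpa only [hc0] using h1
    -- The identity holds for `t > 0` only; a right derivative suffices to identify the derivative
    -- at `0`.
    have h3 : HasDerivWithinAt (fun t => (χ (c t, u)).1) (g (χ (x, u))) (Ioi 0) 0 := by
      refine ((hd2.const_add (χ (x, u)).1).hasDerivWithinAt (s := Ioi 0)).congr_of_eventuallyEq
        ?_ (by simp [hc0])
      filter_upwards [Ioo_mem_nhdsGT hε] with t ht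
      rw [← key u hxu t ht]
      abel
    exact (uniqueDiffWithinAt_Ioi 0).eq_deriv _ hd1.hasDerivWithinAt h3

/-- A projection onto `V` fixes `G` near `x`, hence fixes its derivative. -/
lemma fderiv_mem_of_eventually_mem {E F : Type} [NormedAddCommGroup E] [NormedSpace ℝ E]
    [NormedAddCommGroup F] [NormedSpace ℝ F] [FiniteDimensional ℝ F] {V : Submodule ℝ F}
    {G : E → F} {x : E} (hG : DifferentiableAt ℝ G x) (h : ∀ᶠ y in 𝓝 x, G y ∈ V) (v : E) :
    fderiv ℝ G x v ∈ V := by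
  obtain ⟨π, hπ⟩ := Submodule.ClosedComplemented.of_finiteDimensional V
  have h1 : HasFDerivAt (fun y => V.subtypeL (π (G y))) (V.subtypeL ∘L π ∘L fderiv ℝ G x) x :=
    (V.subtypeL ∘L π).hasFDerivAt.comp x hG.hasFDerivAt
  have h2 : (fun y => V.subtypeL (π (G y))) =ᶠ[𝓝 x] G := by
    filter_upwards [h] with y hy
    exact congrArg Subtype.val (hπ ⟨_, hy⟩)
  rw [(h1.congr_of_eventuallyEq h2.symm).fderiv]
  exact (π (fderiv ℝ G x v)).2

lemma finrank_comap_of_isInvertible {L : Eucl n →L[ℝ] Eucl n} (hL : L.IsInvertible)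
    (V : Submodule ℝ (Eucl n)) :
    Module.finrank ℝ (Submodule.comap (L : Eucl n →ₗ[ℝ] Eucl n) V) = Module.finrank ℝ V := by
  obtain ⟨e, rfl⟩ := hL
  have h1 : Submodule.comap ((e : Eucl n →L[ℝ] Eucl n) : Eucl n →ₗ[ℝ] Eucl n) V =
      Submodule.map (e.symm.toLinearEquiv : Eucl n →ₗ[ℝ] Eucl n) V :=
    (Submodule.map_equiv_eq_comap_symm e.symm.toLinearEquiv V).symm
  rw [h1, LinearEquiv.finrank_map_eq]

variable {X : Set (Eucl n)} {φ : Eucl n → Eucl n}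

/-- The pullback of a constant distribution by a local diffeomorphism is integrable. -/
lemma integrable_of_eq_comap (hk : k = ∞ ∨ k = ω) (hφ : ∀ x ∈ X, ContDiffAt ℝ k φ x)
    (hinv : ∀ x ∈ X, (fderiv ℝ φ x).IsInvertible) {Δ : Distribution n} {V : Submodule ℝ (Eucl n)}
    (hΔ : ∀ x ∈ X, Δ x = Submodule.comap (fderiv ℝ φ x : Eucl n →ₗ[ℝ] Eucl n) V) :
    Integrable k X Δ := by
  have hk0 := smoothness_ne_zero hk
  refine ⟨⟨Module.finrank ℝ V, fun x hx => ?_⟩, fun O g h hg hh x hx => ?_⟩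
  · rw [hΔ x hx, finrank_comap_of_isInvertible (hinv x hx)]
  have hmem : ∀ g, IsSection k X Δ O g → ∀ v, fderiv ℝ (fun y => fderiv ℝ φ y (g y)) x v ∈ V := by
    intro g hg v
    refine fderiv_mem_of_eventually_mem ((contDiffAt_fderiv_apply hk (hφ x (hg.subset hx))
      (hg.contDiffAt hx)).differentiableAt hk0) ?_ v
    filter_upwards [hg.isOpen.mem_nhds hx] with y hy
    exact (hΔ y (hg.subset hy)).le (hg.mem y hy)
  rw [hΔ x (hg.subset hx)]
  change fderiv ℝ φ x _ ∈ V
  rw [fderiv_lieBracket hk (hφ x (hg.subset hx)) (hg.contDiffAt hx) (hh.contDiffAt hx)]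
  exact V.sub_mem (hmem h hh _) (hmem g hg _)

/-- In coordinates `φ` in which `F` is `A` modulo `V`, the flag generated by the pullback of `V`
is the pullback of `V + A V + … + Aʲ V`. -/
theorem flag_eq_comap_krylov (hk : k = ∞ ∨ k = ω) (hX : IsOpen X)
    (hφ : ∀ x ∈ X, ContDiffAt ℝ k φ x) (hinv : ∀ x ∈ X, (fderiv ℝ φ x).IsInvertible)
    {F : Eucl n → Eucl n} (hF : ∀ x ∈ X, ContDiffAt ℝ k F x) {A : Eucl n →ₗ[ℝ] Eucl n}
    {V : Submodule ℝ (Eucl n)} (hA : ∀ x ∈ X, fderiv ℝ φ x (F x) - A (φ x) ∈ V)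
    {Δ₀ : Distribution n}
    (hΔ : ∀ x ∈ X, Δ₀ x = Submodule.comap (fderiv ℝ φ x : Eucl n →ₗ[ℝ] Eucl n) V) (j : ℕ) :
    ∀ x ∈ X, flag k X F Δ₀ j x =
      Submodule.comap (fderiv ℝ φ x : Eucl n →ₗ[ℝ] Eucl n) (krylov A V j) := by
  have hk0 := smoothness_ne_zero hk
  induction j with
  | zero => exact hΔ
  | succ j ih =>
    have hVj : V ≤ krylov A V j := krylov_mono A V (Nat.zero_le j)
    have hφd : ∀ x ∈ X, HasFDerivAt φ (fderiv ℝ φ x) x := fun x hx =>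
      ((hφ x hx).differentiableAt hk0).hasFDerivAt
    have hFd : ∀ x ∈ X, ∀ v, fderiv ℝ (fun y => fderiv ℝ φ y (F y)) x v -
        A (fderiv ℝ φ x v) ∈ V := by
      intro x hx v
      have h1 : HasFDerivAt (fun y => fderiv ℝ φ y (F y) - A.toContinuousLinearMap (φ y))
          (fderiv ℝ (fun y => fderiv ℝ φ y (F y)) x - A.toContinuousLinearMap ∘L fderiv ℝ φ x) x :=
        ((contDiffAt_fderiv_apply hk (hφ x hx) (hF x hx)).differentiableAt hk0).hasFDerivAt.sub
          (A.toContinuousLinearMap.hasFDerivAt.comp x (hφd x hx))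
      have h2 := fderiv_mem_of_eventually_mem h1.differentiableAt
        (Filter.eventually_of_mem (hX.mem_nhds hx) hA) v
      rw [h1.fderiv] at h2
      exact h2
    intro x hx
    apply le_antisymm
    · refine sup_le ((ih x hx).le.trans (Submodule.comap_mono le_sup_left)) (Submodule.span_le.2 ?_)
      rintro _ ⟨O, g, hg, hxO, rfl⟩
      change fderiv ℝ φ x _ ∈ krylov A V j ⊔ Submodule.map A (krylov A V j)
      rw [fderiv_lieBracket hk (hφ x hx) (hF x hx) (hg.contDiffAt hxO)]
      have h1 : ∀ v, fderiv ℝ (fun y => fderiv ℝ φ y (g y)) x v ∈ krylov A V j := by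
        refine fderiv_mem_of_eventually_mem ((contDiffAt_fderiv_apply hk (hφ x hx)
          (hg.contDiffAt hxO)).differentiableAt hk0) ?_
        filter_upwards [hg.isOpen.mem_nhds hxO] with y hy
        exact (ih y (hg.subset hy)).le (hg.mem y hy)
      have h2 : A (fderiv ℝ φ x (g x)) ∈ Submodule.map A (krylov A V j) :=
        ⟨_, (ih x hx).le (hg.mem x hxO), rfl⟩
      have h3 := Submodule.sub_mem _ (Submodule.mem_sup_left (T := Submodule.map A (krylov A V j))
        (Submodule.sub_mem _ (h1 (F x)) (hVj (hFd x hx (g x))))) (Submodule.mem_sup_right h2)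
      convert h3 using 1
      abel
    · intro ξ hξ
      -- Write `dφ ξ = a + A b` and let `g` be the section that is constantly `b` in the coordinates
      -- `φ`. Then `dφ[F, g] = -A b` modulo `V`, so adding `[F, g]` to `ξ` brings it back into the
      -- previous member of the flag.
      obtain ⟨a, ha, _, ⟨b, hb, rfl⟩, hab⟩ := Submodule.mem_sup.1 hξ
      let g : Eucl n → Eucl n := fun y => (fderiv ℝ φ y).inverse b
      have hgv : ∀ y ∈ X, fderiv ℝ φ y (g y) = b := by
        intro y hy
        obtain ⟨e, he⟩ := hinv y hy
        simp [g, ← he]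
      have hg : IsSection k X (flag k X F Δ₀ j) X g := by
        refine ⟨hX, Subset.rfl, fun y hy => ?_, fun y hy => ?_⟩
        · have h1 : ContDiffAt ℝ k (fun y => (fderiv ℝ φ y).inverse) y :=
            (hinv y hy).contDiffAt_map_inverse.comp y
              ((hφ y hy).fderiv_right (smoothness_add_one_le hk))
          exact (h1.clm_apply contDiffAt_const).contDiffWithinAt
        · rw [ih y hy]
          change fderiv ℝ φ y (g y) ∈ krylov A V j
          rwa [hgv y hy]
      have h1 : fderiv ℝ (fun y => fderiv ℝ φ y (g y)) x = 0 := by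
        have h2 : (fun y => fderiv ℝ φ y (g y)) =ᶠ[𝓝 x] fun _ => b :=
          Filter.eventually_of_mem (hX.mem_nhds hx) hgv
        rw [h2.fderiv_eq, fderiv_fun_const]
        rfl
      have h2 : fderiv ℝ φ x (ξ + VectorField.lieBracket ℝ F g x) ∈ krylov A V j := by
        rw [map_add, fderiv_lieBracket hk (hφ x hx) (hF x hx) (hg.contDiffAt hx), h1]
        have h3 := hFd x hx (g x)
        rw [hgv x hx] at h3
        have h4 := Submodule.sub_mem _ ha (hVj h3)
        have h5 : fderiv ℝ φ x ξ = a + A b := hab.symm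
        rw [h5]
        convert h4 using 1
        simp only [_root_.zero_apply]
        abel
      have h3 : ξ + VectorField.lieBracket ℝ F g x ∈ flag k X F Δ₀ j x := by
        rw [ih x hx]
        exact h2
      have h4 : VectorField.lieBracket ℝ F g x ∈ Submodule.span ℝ
          {v | ∃ V g, IsSection k X (flag k X F Δ₀ j) V g ∧ x ∈ V ∧
            v = VectorField.lieBracket ℝ F g x} :=
        Submodule.subset_span ⟨X, g, hg, hx, rfl⟩
      have h5 := Submodule.sub_mem _ (Submodule.mem_sup_left h3) (Submodule.mem_sup_right h4)
      rwa [add_sub_cancel_right] at h5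

end Necessity

/-! ### Necessity: the conditions on `D` and on the flag -/

section Necessity

variable {n m : ℕ} {k : WithTop ℕ∞}

/-- In linearizing coordinates `(φ(x), ψ(x,u))` the derivative of `φ` is invertible and pulls the
range of `B` back to the range of `∂f/∂u`. -/
lemma isInvertible_and_range_partialU (hk : k = ∞ ∨ k = ω) {f : Eucl n × Eucl m → Eucl n}
    {χ : Eucl n × Eucl m → Eucl n × Eucl m} {φ : Eucl n → Eucl n} {A : Eucl n →L[ℝ] Eucl n}
    {B : Eucl m →L[ℝ] Eucl n} {x : Eucl n} {u : Eucl m} (hf : ContDiffAt ℝ k f (x, u))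
    (hχ : DifferentiableAt ℝ χ (x, u)) (hinj : Function.Injective (fderiv ℝ χ (x, u)))
    (hφ : DifferentiableAt ℝ φ x) (hfst : ∀ᶠ q in 𝓝 (x, u), (χ q).1 = φ q.1)
    (hdyn : ∀ᶠ w in 𝓝 u, fderiv ℝ φ x (f (x, w)) = A (φ x) + B (χ (x, w)).2) :
    (fderiv ℝ φ x).IsInvertible ∧ LinearMap.range (partialU f x u : Eucl m →ₗ[ℝ] Eucl n) =
      Submodule.comap (fderiv ℝ φ x : Eucl n →ₗ[ℝ] Eucl n)
        (LinearMap.range (B : Eucl m →ₗ[ℝ] Eucl n)) := by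
  have hsurj : Function.Surjective (fderiv ℝ χ (x, u)) := LinearMap.surjective_of_injective
    (f := (fderiv ℝ χ (x, u) : Eucl n × Eucl m →ₗ[ℝ] Eucl n × Eucl m)) hinj
  have h1 : ∀ q, (fderiv ℝ χ (x, u) q).1 = fderiv ℝ φ x q.1 := by
    intro q
    have h2 : HasFDerivAt (fun q => (χ q).1)
        (.fst ℝ (Eucl n) (Eucl m) ∘L fderiv ℝ χ (x, u)) (x, u) :=
      (ContinuousLinearMap.fst ℝ (Eucl n) (Eucl m)).hasFDerivAt.comp (x, u) hχ.hasFDerivAt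
    have h3 : HasFDerivAt (fun q : Eucl n × Eucl m => φ q.1)
        (fderiv ℝ φ x ∘L .fst ℝ (Eucl n) (Eucl m)) (x, u) :=
      HasFDerivAt.comp (g := φ) (x, u) hφ.hasFDerivAt hasFDerivAt_fst
    exact DFunLike.congr_fun (h2.unique (h3.congr_of_eventuallyEq hfst)) q
  have hφs : Function.Surjective (fderiv ℝ φ x) := fun y => by
    obtain ⟨q, hq⟩ := hsurj (y, 0)
    exact ⟨q.1, by rw [← h1, hq]⟩
  have hφi : Function.Injective (fderiv ℝ φ x) := LinearMap.injective_iff_surjective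
    (f := (fderiv ℝ φ x : Eucl n →ₗ[ℝ] Eucl n)).2 hφs
  have h2 : ∀ v, fderiv ℝ φ x (partialU f x u v) = B (fderiv ℝ χ (x, u) (0, v)).2 := by
    intro v
    have h3 : HasFDerivAt (fun w => fderiv ℝ φ x (f (x, w)))
        (fderiv ℝ φ x ∘L partialU f x u) u :=
      (fderiv ℝ φ x).hasFDerivAt.comp u (hasFDerivAt_partialU hk hf).1
    have h4 : HasFDerivAt (fun w => A (φ x) + B (χ (x, w)).2)
        ((B ∘L .snd ℝ (Eucl n) (Eucl m)) ∘L fderiv ℝ χ (x, u) ∘L .inr ℝ (Eucl n) (Eucl m)) u :=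
      ((B ∘L .snd ℝ (Eucl n) (Eucl m)).hasFDerivAt.comp u
        (hχ.hasFDerivAt.comp u (hasFDerivAt_prodMk_right (𝕜 := ℝ) x u))).const_add _
    exact DFunLike.congr_fun (h3.unique (h4.congr_of_eventuallyEq hdyn)) v
  refine ⟨⟨(LinearEquiv.ofBijective (fderiv ℝ φ x : Eucl n →ₗ[ℝ] Eucl n)
    ⟨hφi, hφs⟩).toContinuousLinearEquiv, rfl⟩, le_antisymm ?_ ?_⟩
  · rintro _ ⟨v, rfl⟩
    exact ⟨_, (h2 v).symm⟩
  · rintro ζ ⟨b, hb⟩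
    obtain ⟨⟨ξ, v⟩, hq⟩ := hsurj (0, b)
    -- A preimage under `dχ` of a purely control direction has no state component, since `dφ` is
    -- injective; hence every value of `B` comes from varying `u` alone.
    have hξ : ξ = 0 := hφi (by rw [map_zero, ← h1 (ξ, v), hq])
    subst hξ
    refine ⟨v, hφi ?_⟩
    change fderiv ℝ φ x (partialU f x u v) = _
    rw [h2, hq]
    exact hb

/-- A locally linearizable system satisfies the conditions on `D` and on the flag. -/
theorem LocallyLinearizableAt.exists_flag (hk : k = ∞ ∨ k = ω) {f : Eucl n × Eucl m → Eucl n}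
    {Ω : Set (Eucl n × Eucl m)} (hΩ : IsOpen Ω) (hf : ContDiffOn ℝ k f Ω) {x₀ : Eucl n}
    {u₀ : Eucl m} (h : LocallyLinearizableAt k f Ω (x₀, u₀)) :
    ∃ (X : Set (Eucl n)) (U : Set (Eucl m)),
      IsOpen X ∧ IsOpen U ∧ x₀ ∈ X ∧ u₀ ∈ U ∧ X ×ˢ U ⊆ Ω ∧
      (∀ x ∈ X, ∀ u ∈ U, ∀ u' ∈ U, dirSpace f U x u = dirSpace f U x u') ∧
      (∃ r : ℕ, ∀ x ∈ X, ∀ u ∈ U, Module.finrank ℝ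
        (LinearMap.range (partialU f x u : Eucl m →ₗ[ℝ] Eucl n)) = r) ∧
      (∀ j < n, Integrable k X
        (flag k X (fun x => f (x, u₀)) (fun x => dirSpace f U x u₀) j)) ∧
      (∀ x ∈ X, Module.finrank ℝ
        (flag k X (fun x => f (x, u₀)) (fun x => dirSpace f U x u₀) (n - 1) x) = n) := by
  obtain ⟨A, B, χ, hctr, hp, hsub, hχk, hχsk, hconj⟩ := h
  have hk0 := smoothness_ne_zero hk
  have hk1 := one_le_smoothness hk
  obtain ⟨X, U, hX, hU, hx₀, hu₀, hXU⟩ := isOpen_prod_iff.1 χ.open_source x₀ u₀ hp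
  have hmem : ∀ x ∈ X, ∀ u ∈ U, (x, u) ∈ χ.source := fun x hx u hu => hXU ⟨hx, hu⟩
  have hχA : ∀ x ∈ X, ∀ u ∈ U, ContDiffAt ℝ k χ (x, u) := fun x hx u hu =>
    hχk.contDiffAt (χ.open_source.mem_nhds (hmem x hx u hu))
  have hfA : ∀ x ∈ X, ∀ u ∈ U, ContDiffAt ℝ k f (x, u) := fun x hx u hu =>
    hf.contDiffAt (hΩ.mem_nhds (hsub (hmem x hx u hu)))
  let LA : Eucl n →L[ℝ] Eucl n := (Matrix.toEuclideanLin A).toContinuousLinearMap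
  let LB : Eucl m →L[ℝ] Eucl n := (Matrix.toEuclideanLin B).toContinuousLinearMap
  have hlin : Continuous (linearSystem A B) := by
    have : linearSystem A B = fun q => LA q.1 + LB q.2 := rfl
    rw [this]
    fun_prop
  let φ : Eucl n → Eucl n := fun x => (χ (x, u₀)).1
  have hφk : ∀ x ∈ X, ContDiffAt ℝ k φ x := fun x hx =>
    (hχA x hx u₀ hu₀).fst.comp (f := fun x => (x, u₀)) x
      (contDiffAt_id.prodMk contDiffAt_const)
  have hcon := fun x hx u hu => hconj.fst_eq_and_fderiv hlin
    (hf.continuousOn.mono hsub) (hmem x hx u hu) ((hfA x hx u hu).of_le hk1)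
    ((hχA x hx u hu).differentiableAt hk0)
  have hfst : ∀ x ∈ X, ∀ u ∈ U, (χ (x, u)).1 = φ x := fun x hx u hu =>
    (hcon x hx u₀ hu₀).1 u (hmem x hx u hu)
  have hfst' : ∀ x ∈ X, ∀ u ∈ U, ∀ᶠ q in 𝓝 (x, u), (χ q).1 = φ q.1 := fun x hx u hu =>
    Filter.eventually_of_mem ((hX.prod hU).mem_nhds ⟨hx, hu⟩) fun q hq => hfst q.1 hq.1 q.2 hq.2
  have hdyn : ∀ x ∈ X, ∀ u ∈ U, fderiv ℝ φ x (f (x, u)) = LA (φ x) + LB (χ (x, u)).2 := by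
    intro x hx u hu
    have h1 := (hcon x hx u hu).2
    have h2 : HasFDerivAt (fun q => (χ q).1)
        (.fst ℝ (Eucl n) (Eucl m) ∘L fderiv ℝ χ (x, u)) (x, u) :=
      (ContinuousLinearMap.fst ℝ (Eucl n) (Eucl m)).hasFDerivAt.comp (x, u)
        ((hχA x hx u hu).differentiableAt hk0).hasFDerivAt
    have h3 : HasFDerivAt (fun q : Eucl n × Eucl m => φ q.1)
        (fderiv ℝ φ x ∘L .fst ℝ (Eucl n) (Eucl m)) (x, u) :=
      HasFDerivAt.comp (g := φ) (x, u)
        ((hφk x hx).differentiableAt hk0).hasFDerivAt hasFDerivAt_fst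
    have h4 := DFunLike.congr_fun (h2.unique (h3.congr_of_eventuallyEq (hfst' x hx u hu)))
      (f (x, u), 0)
    change (fderiv ℝ χ (x, u) (f (x, u), 0)).1 = fderiv ℝ φ x (f (x, u)) at h4
    rw [← h4, h1, ← hfst x hx u hu]
    rfl
  have hinj : ∀ x ∈ X, ∀ u ∈ U, Function.Injective (fderiv ℝ χ (x, u)) := by
    intro x hx u hu
    have hs := hmem x hx u hu
    have h1 : HasFDerivAt χ.symm (fderiv ℝ χ.symm (χ (x, u))) (χ (x, u)) :=
      ((hχsk.contDiffAt (χ.open_target.mem_nhds (χ.map_source hs))).differentiableAt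
        hk0).hasFDerivAt
    have h2 := h1.comp (x, u) ((hχA x hx u hu).differentiableAt hk0).hasFDerivAt
    have h3 : HasFDerivAt (χ.symm ∘ χ) (ContinuousLinearMap.id ℝ _) (x, u) :=
      (hasFDerivAt_id _).congr_of_eventuallyEq (χ.eventually_left_inverse hs)
    exact Function.LeftInverse.injective (g := fderiv ℝ χ.symm (χ (x, u))) fun v =>
      DFunLike.congr_fun (h2.unique h3) v
  have hmain := fun x hx u hu => isInvertible_and_range_partialU hk (hfA x hx u hu)
    ((hχA x hx u hu).differentiableAt hk0) (hinj x hx u hu) ((hφk x hx).differentiableAt hk0)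
    (hfst' x hx u hu) (Filter.eventually_of_mem (hU.mem_nhds hu) (hdyn x hx))
  have hinv : ∀ x ∈ X, (fderiv ℝ φ x).IsInvertible := fun x hx => (hmain x hx u₀ hu₀).1
  have hrank : ∀ x ∈ X, ∀ u ∈ U, Module.finrank ℝ
      (LinearMap.range (partialU f x u : Eucl m →ₗ[ℝ] Eucl n)) =
        Module.finrank ℝ (LinearMap.range (LB : Eucl m →ₗ[ℝ] Eucl n)) := fun x hx u hu => by
    rw [(hmain x hx u hu).2, finrank_comap_of_isInvertible (hinv x hx)]
  have hD : ∀ x ∈ X, ∀ u ∈ U, dirSpace f U x u =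
      Submodule.comap (fderiv ℝ φ x : Eucl n →ₗ[ℝ] Eucl n)
        (LinearMap.range (LB : Eucl m →ₗ[ℝ] Eucl n)) := fun x hx u hu => by
    rw [dirSpace_eq_range hk hU hu (fun w hw => (hfA x hx w hw).comp (f := fun w => (x, w)) w
      (contDiffAt_const.prodMk contDiffAt_id)) (hrank x hx), (hmain x hx u hu).2]
  have hflag := flag_eq_comap_krylov hk hX hφk hinv (F := fun x => f (x, u₀))
    (A := Matrix.toEuclideanLin A) (V := LinearMap.range (LB : Eucl m →ₗ[ℝ] Eucl n))
    (fun x hx => (hfA x hx u₀ hu₀).comp (f := fun x => (x, u₀)) x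
      (contDiffAt_id.prodMk contDiffAt_const))
    (fun x hx => ⟨(χ (x, u₀)).2, by
      rw [hdyn x hx u₀ hu₀]
      exact (add_sub_cancel_left _ _).symm⟩)
    (Δ₀ := fun x => dirSpace f U x u₀) fun x hx => hD x hx u₀ hu₀
  refine ⟨X, U, hX, hU, hx₀, hu₀, hXU.trans hsub, fun x hx u hu u' hu' => ?_, ⟨_, hrank⟩,
    fun j _ => integrable_of_eq_comap hk hφk hinv (hflag j), fun x hx => ?_⟩
  · rw [hD x hx u hu, hD x hx u' hu']
  · rw [hflag (n - 1) x hx, finrank_comap_of_isInvertible (hinv x hx)]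
    have h1 : krylov (Matrix.toEuclideanLin A) (LinearMap.range (LB : Eucl m →ₗ[ℝ] Eucl n))
        (n - 1) = ⊤ := hctr.krylov_eq_top
    rw [h1, finrank_top, finrank_euclideanSpace_fin]

end Necessity

end ControlSys

end

/-! ### The equivalence -/

theorem theorem5p6 (n m : ℕ) (k : WithTop ℕ∞) (hk : k = ∞ ∨ k = ω)
    (f : ControlSys.Eucl n × ControlSys.Eucl m → ControlSys.Eucl n)
    (Ω : Set (ControlSys.Eucl n × ControlSys.Eucl m)) (hΩ : IsOpen Ω)
    (hf : ContDiffOn ℝ k f Ω)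
    (xbar : ControlSys.Eucl n) (ubar : ControlSys.Eucl m) (hp : (xbar, ubar) ∈ Ω) :
    ControlSys.LocallyLinearizableAt k f Ω (xbar, ubar) ↔
      ∃ (X : Set (ControlSys.Eucl n)) (U : Set (ControlSys.Eucl m)),
        IsOpen X ∧ IsOpen U ∧ xbar ∈ X ∧ ubar ∈ U ∧ X ×ˢ U ⊆ Ω ∧
        -- (1) `D(x,u)` does not depend on `u`
        (∀ x ∈ X, ∀ u ∈ U, ∀ u' ∈ U,
          ControlSys.dirSpace f U x u = ControlSys.dirSpace f U x u') ∧
        -- (2) `∂f/∂u` has constant rank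
        (∃ r : ℕ, ∀ x ∈ X, ∀ u ∈ U,
          Module.finrank ℝ (LinearMap.range
            (ControlSys.partialU f x u : ControlSys.Eucl m →ₗ[ℝ] ControlSys.Eucl n)) = r) ∧
        -- (3) `Δ_0, …, Δ_{n-1}` are integrable and `Δ_{n-1}` has rank `n`
        (∀ j < n, ControlSys.Integrable k X
          (ControlSys.flag k X (fun x => f (x, ubar))
            (fun x => ControlSys.dirSpace f U x ubar) j)) ∧
        (∀ x ∈ X, Module.finrank ℝ
          (ControlSys.flag k X (fun x => f (x, ubar))
            (fun x => ControlSys.dirSpace f U x ubar) (n - 1) x) = n) := by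
  refine ⟨fun h => h.exists_flag hk hΩ hf, ?_⟩
  rintro ⟨X, U, hX, hU, hx₀, hu₀, hXU, hD, ⟨r, hr⟩, hint, htop⟩
  -- For `n = 0` truncated subtraction gives `n - 1 = 0`, where the rank condition is trivial; there
  -- is no state and the identity is a linearization.
  rcases Nat.eq_zero_or_pos n with rfl | hn
  · exact ControlSys.locallyLinearizableAt_of_dim_zero f hΩ hp
  · exact ControlSys.locallyLinearizableAt_of_flag hk hn hΩ hf hX hU hx₀ hu₀ hXU hD hr hint htop
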